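/- Let $n\ge 3$ and let $M\subset\mathbb R^n$ be an open ball $\{|x|<\nu\}$ ($0<\nu<\infty$), an open spherical shell $\{\nu_2<|x|<\nu_1\}$ ($0\le\nu_2<\nu_1<\infty$), or $\mathbb R^n$. Let $F$ be a Finsler metric on $M$ (smooth off the zero section, with $F(x,\cdot)$ a Minkowski norm for each $x$) which is spherically symmetric, $F(Ax,Ay)=F(x,y)$ for all $A\in O(n)$, whose Douglas curvature vanishes, and whose flag curvature is constant. Let $I=\{|x| : x\in M,\ x\ne0\}$, $\Omega=\{(r,s): r\in I,\ |s|<r\}$ and $\Omega^*=\{(r,s)\in\Omega: s\ne0\}$. Then there is a function $\phi$, smooth on $\Omega$, with $F(x,y)=|y|\,\phi\big(|x|,\tfrac{\langle x,y\rangle}{|y|}\big)$ for all $x\in M$, $y\ne0$, such that, with $$Q=\frac1{2r}\,\frac{r\phi_{ss}-\phi_r+s\phi_{rs}}{\phi-s\phi_s+(r^2-s^2)\phi_{ss}},\qquad P=\frac{r\phi_s+s\phi_r}{2r\phi}-\frac Q\phi\big[s\phi+(r^2-s^2)\phi_s\big],$$ the following hold. (1) There are a smooth function $g$ on $I$, with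 $2r^2g(r)=1$ for at most one $r\in I$, and functions $T,\overline T$, smooth on $I$, such that, wherever $2r^2g(r)\ne1$ and for suitable choices of the indefinite integrals, $$T=\frac{e^{-\int\frac{4rg}{1-2r^2g}dr}}{(1-2r^2g)^2},\qquad \overline T=4\int\frac{g'+2rg^2}{1-2r^2g}\,T\,dr,\qquad Q(r,s)=g+\frac{g'+2rg^2}{r-2r^3g}\,s^2\quad (|s|<r).$$ Moreover $(r^2-s^2)\overline T(r)-T(r)\neq0$ on $\Omega^*$, and there are a smooth function $h$ on $I$ and a function $\eta$, smooth on the set of values of $\varphi$ on $\Omega^*$, such that on $\Omega^*$ $$P(r,s)=s\Big(h(r)-\int\frac{\eta(\varphi(r,s))}{s^2\sqrt{r^2-s^2}}\,ds\Big),\qquad \varphi(r,s)=\frac{r^2-s^2}{(r^2-s^2)\overline T(r)-T(r)}.$$ (2) There is a smooth function $U$ on $\Omega$ with $$U=\frac{(r^2-s^2)(sP_s-2P)-s(1+sP)}{(r^2-s^2)(2Q-sQ_s)-sP-1}$$ at all points of $\Omega$ where the denominator is nonzero, and these points are dense in $\Omega$. It satisfies on $\Omega$ $$s\big[sU_r+(1-2(r^2-s^2)Q)\,rU_s\big]=r\big[1+2(r^2-s^2)(sQ_s-Q)\big]U+2r(r^2-s^2)(sP_s-P),$$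 and, for a suitable choice (smooth on $\Omega$) of the indefinite integral, $$\phi(r,s)=\sqrt{r^2-s^2}\,\exp\Big(\int\frac{U(r,s)}{r^2-s^2}\,ds\Big)\quad\text{on }\Omega .$$ (3) On $\Omega$, $\ \phi-s\phi_s>0\ $ and $\ \phi-s\phi_s+(r^2-s^2)\phi_{ss}>0$. -/

import Mathlib

open scoped ContDiff

noncomputable section

namespace SphFinsler

/-- Euclidean space `ℝⁿ`, with its Euclidean norm and inner product. -/
abbrev E (n : ℕ) : Type := EuclideanSpace ℝ (Fin n)

/-- The partial derivative `∂/∂x^k` of a function of `(x, y) ∈ ℝⁿ × ℝⁿ`. -/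
def dX {n : ℕ} (k : Fin n) (f : E n → E n → ℝ) : E n → E n → ℝ :=
  fun x y => fderiv ℝ (fun z => f z y) x (EuclideanSpace.single k 1)

/-- The partial derivative `∂/∂y^k` of a function of `(x, y) ∈ ℝⁿ × ℝⁿ`. -/
def dY {n : ℕ} (k : Fin n) (f : E n → E n → ℝ) : E n → E n → ℝ :=
  fun x y => fderiv ℝ (fun v => f x v) y (EuclideanSpace.single k 1)

/-- The function `F²`. -/
def energy {n : ℕ} (F : E n → E n → ℝ) : E n → E n → ℝ := fun x y => F x y ^ 2

/-- The fundamental tensor `g_{ij}(x, y) = ½ ∂²F²/∂y^i∂y^j`. -/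
def fundTensor {n : ℕ} (F : E n → E n → ℝ) (x y : E n) : Matrix (Fin n) (Fin n) ℝ :=
  Matrix.of fun i j => (1 / 2 : ℝ) * dY i (dY j (energy F)) x y

/-- `F` is a Finsler metric on the open set `M ⊆ ℝⁿ`: it is smooth off the zero section, and
each `F x` is a Minkowski norm (positive off `0`, positively homogeneous of degree one, with
positive definite fundamental tensor).  Homogeneity gives `F x 0 = 0`. -/
structure IsFinslerMetric {n : ℕ} (M : Set (E n)) (F : E n → E n → ℝ) : Prop where
  smooth : ContDiffOn ℝ ∞ (fun p : E n × E n => F p.1 p.2) (M ×ˢ {0}ᶜ)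
  pos : ∀ x ∈ M, ∀ y : E n, y ≠ 0 → 0 < F x y
  homog : ∀ x ∈ M, ∀ y : E n, ∀ c : ℝ, 0 < c → F x (c • y) = c * F x y
  posDef : ∀ x ∈ M, ∀ y : E n, y ≠ 0 → (fundTensor F x y).PosDef

/-- The geodesic coefficients
`G^i = ¼ g^{il} ([F²]_{x^k y^l} y^k - [F²]_{x^l})`. -/
def spray {n : ℕ} (F : E n → E n → ℝ) (i : Fin n) : E n → E n → ℝ := fun x y =>
  (1 / 4 : ℝ) * ∑ l, (fundTensor F x y)⁻¹ i l *
    ((∑ k, dX k (dY l (energy F)) x y * y k) - dX l (energy F) x y)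

/-- The Riemann curvature
`R^i_k = 2 ∂G^i/∂x^k - y^j ∂²G^i/∂x^j∂y^k + 2 G^j ∂²G^i/∂y^j∂y^k - ∂G^i/∂y^j ∂G^j/∂y^k`. -/
def riemann {n : ℕ} (F : E n → E n → ℝ) (i k : Fin n) (x y : E n) : ℝ :=
  2 * dX k (spray F i) x y
    - (∑ j, y j * dX j (dY k (spray F i)) x y)
    + 2 * (∑ j, spray F j x y * dY j (dY k (spray F i)) x y)
    - ∑ j, dY j (spray F i) x y * dY k (spray F j) x y

/-- The endomorphism `R_y` of the tangent space, `(R_y u)^i = R^i_k u^k`. -/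
def riemannApply {n : ℕ} (F : E n → E n → ℝ) (x y : E n) (u : Fin n → ℝ) : Fin n → ℝ :=
  fun i => ∑ k, riemann F i k x y * u k

/-- The inner product `g_y(u, v) = g_{ij}(x, y) u^i v^j`. -/
def gInner {n : ℕ} (F : E n → E n → ℝ) (x y : E n) (u v : Fin n → ℝ) : ℝ :=
  ∑ i, ∑ j, fundTensor F x y i j * u i * v j

/-- The flag curvature of the flag with flagpole `y` and tangent plane `span {y, u}`. -/
def flagCurvature {n : ℕ} (F : E n → E n → ℝ) (x y u : E n) : ℝ :=
  gInner F x y (riemannApply F x y u) u /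
    (gInner F x y y y * gInner F x y u u - gInner F x y y u ^ 2)

/-- The flag curvature is one and the same constant for all flags over `M`. -/
def HasConstantFlagCurvature {n : ℕ} (M : Set (E n)) (F : E n → E n → ℝ) : Prop :=
  ∃ K : ℝ, ∀ x ∈ M, ∀ y u : E n, LinearIndependent ℝ ![y, u] → flagCurvature F x y u = K

/-- The Douglas curvature
`D_j^i_{kl} = ∂³/∂y^j∂y^k∂y^l (G^i - 1/(n+1) ∑_m ∂G^m/∂y^m y^i)`. -/
def douglas {n : ℕ} (F : E n → E n → ℝ) (i j k l : Fin n) : E n → E n → ℝ :=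
  dY j (dY k (dY l (fun x y =>
    spray F i x y - (1 / ((n : ℝ) + 1)) * (∑ m, dY m (spray F m) x y) * y i)))

/-- `F` is a Douglas metric on `M`: its Douglas curvature vanishes off the zero section. -/
def IsDouglas {n : ℕ} (M : Set (E n)) (F : E n → E n → ℝ) : Prop :=
  ∀ x ∈ M, ∀ y : E n, y ≠ 0 → ∀ i j k l : Fin n, douglas F i j k l x y = 0

/-- `F` is invariant under the orthogonal group. -/
def IsSphericallySymmetric {n : ℕ} (M : Set (E n)) (F : E n → E n → ℝ) : Prop :=
  ∀ A : E n ≃ₗᵢ[ℝ] E n, ∀ x ∈ M, ∀ y : E n, F (A x) (A y) = F x y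

/-- The domains: an open ball, an open spherical shell (the ball of radius `ν₁` with
its centre removed if `ν₂ = 0`), or the whole space. -/
def IsSymmetricDomain {n : ℕ} (M : Set (E n)) : Prop :=
  (∃ ν : ℝ, 0 < ν ∧ M = {x | ‖x‖ < ν}) ∨
  (∃ ν₁ ν₂ : ℝ, 0 ≤ ν₂ ∧ ν₂ < ν₁ ∧ M = {x | ν₂ < ‖x‖ ∧ ‖x‖ < ν₁}) ∨
  M = Set.univ

/-- The set of positive radii `r = |x|`, `x ∈ M`. -/
def radii {n : ℕ} (M : Set (E n)) : Set ℝ := {r | 0 < r ∧ ∃ x ∈ M, ‖x‖ = r}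

/-- The region `r ∈ radii M`, `r² - s² > 0` of the `(r, s)`-plane. -/
def region {n : ℕ} (M : Set (E n)) : Set (ℝ × ℝ) := {p | p.1 ∈ radii M ∧ |p.2| < p.1}

/-- The part `s ≠ 0` of the region. -/
def regionNe {n : ℕ} (M : Set (E n)) : Set (ℝ × ℝ) := {p | p ∈ region M ∧ p.2 ≠ 0}

/-- The partial derivative in `r` of a function of `(r, s)`. -/
def pr (f : ℝ → ℝ → ℝ) : ℝ → ℝ → ℝ := fun r s => deriv (fun t => f t s) r

/-- The partial derivative in `s` of a function of `(r, s)`. -/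
def ps (f : ℝ → ℝ → ℝ) : ℝ → ℝ → ℝ := fun r s => deriv (fun t => f r t) s

/-- Smoothness of a function of two real variables on a set. -/
def SmoothOn (f : ℝ → ℝ → ℝ) (D : Set (ℝ × ℝ)) : Prop :=
  ContDiffOn ℝ ∞ (fun p : ℝ × ℝ => f p.1 p.2) D

/-- `A` is an indefinite integral `∫ q(r, s) ds` on `D`: a smooth function whose derivative in
`s` is `q`. -/
def IsIntegralInS (A q : ℝ → ℝ → ℝ) (D : Set (ℝ × ℝ)) : Prop :=
  SmoothOn A D ∧ ∀ r s : ℝ, (r, s) ∈ D → HasDerivAt (fun t => A r t) (q r s) s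

/-- `Q = (1/2r) (r φ_ss - φ_r + s φ_rs) / (φ - s φ_s + (r² - s²) φ_ss)`. -/
def coefQ (φ : ℝ → ℝ → ℝ) : ℝ → ℝ → ℝ := fun r s =>
  (1 / (2 * r)) * ((r * ps (ps φ) r s - pr φ r s + s * ps (pr φ) r s) /
    (φ r s - s * ps φ r s + (r ^ 2 - s ^ 2) * ps (ps φ) r s))

/-- `P = (r φ_s + s φ_r) / (2 r φ) - (Q / φ) (s φ + (r² - s²) φ_s)`. -/
def coefP (φ : ℝ → ℝ → ℝ) : ℝ → ℝ → ℝ := fun r s =>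
  (r * ps φ r s + s * pr φ r s) / (2 * r * φ r s)
    - coefQ φ r s / φ r s * (s * φ r s + (r ^ 2 - s ^ 2) * ps φ r s)

/-- The numerator of the rational expression for `U`. -/
def numU (P : ℝ → ℝ → ℝ) : ℝ → ℝ → ℝ := fun r s =>
  (r ^ 2 - s ^ 2) * (s * ps P r s - 2 * P r s) - s * (1 + s * P r s)

/-- The denominator of the rational expression for `U`. -/
def denU (P Q : ℝ → ℝ → ℝ) : ℝ → ℝ → ℝ := fun r s =>
  (r ^ 2 - s ^ 2) * (2 * Q r s - s * ps Q r s) - s * P r s - 1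

/-- The function `(r² - s²) / ((r² - s²) Tbar(r) - T(r))`. -/
def charFn (T Tbar : ℝ → ℝ) : ℝ → ℝ → ℝ := fun r s =>
  (r ^ 2 - s ^ 2) / ((r ^ 2 - s ^ 2) * Tbar r - T r)

/-- On `r ∈ I`, `1 - 2r²g ≠ 0`, the functions `T`, `Tbar` are
`T = exp(-∫ 4rg/(1-2r²g) dr) / (1-2r²g)²` and `Tbar = 4 ∫ (g' + 2rg²)/(1-2r²g) T dr` for some
choice of the indefinite integrals, and they are smooth on all of `I`. -/
def AreTFunctions (I : Set ℝ) (g T Tbar : ℝ → ℝ) : Prop :=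
  ContDiffOn ℝ ∞ T I ∧ ContDiffOn ℝ ∞ Tbar I ∧
  ∃ B : ℝ → ℝ, ∀ r ∈ I, 1 - 2 * r ^ 2 * g r ≠ 0 →
    HasDerivAt B (4 * r * g r / (1 - 2 * r ^ 2 * g r)) r ∧
    T r = Real.exp (-B r) / (1 - 2 * r ^ 2 * g r) ^ 2 ∧
    HasDerivAt Tbar
      (4 * ((deriv g r + 2 * r * g r ^ 2) / (1 - 2 * r ^ 2 * g r) * T r)) r

/-- `Q = g + (g' + 2rg²)/(r - 2r³g) s²` where `2r²g ≠ 1`. -/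
def HasFormQ {n : ℕ} (M : Set (E n)) (Q : ℝ → ℝ → ℝ) (g : ℝ → ℝ) : Prop :=
  ∀ r s : ℝ, (r, s) ∈ region M → 1 - 2 * r ^ 2 * g r ≠ 0 →
    Q r s = g r + (deriv g r + 2 * r * g r ^ 2) / (r - 2 * r ^ 3 * g r) * s ^ 2

/-- `P = s (h(r) - ∫ η(φ(r, s)) / (s² √(r² - s²)) ds)` for `s ≠ 0`, with `h` smooth and `η`
smooth on the set of values of its argument `φ = charFn T Tbar`. -/
def HasFormP {n : ℕ} (M : Set (E n)) (P : ℝ → ℝ → ℝ) (T Tbar h η : ℝ → ℝ) : Prop :=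
  ContDiffOn ℝ ∞ h (radii M) ∧
  (∀ r s : ℝ, (r, s) ∈ regionNe M → (r ^ 2 - s ^ 2) * Tbar r - T r ≠ 0) ∧
  ContDiffOn ℝ ∞ η ((fun p : ℝ × ℝ => charFn T Tbar p.1 p.2) '' regionNe M) ∧
  ∃ A : ℝ → ℝ → ℝ,
    IsIntegralInS A
      (fun r s => η (charFn T Tbar r s) / (s ^ 2 * Real.sqrt (r ^ 2 - s ^ 2))) (regionNe M) ∧
    ∀ r s : ℝ, (r, s) ∈ regionNe M → P r s = s * (h r - A r s)

/-- `U` is the smooth function on the region given by the rational expression in `P` and `Q`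
at the points, dense in the region, at which the denominator does not vanish. -/
def IsU {n : ℕ} (M : Set (E n)) (P Q U : ℝ → ℝ → ℝ) : Prop :=
  SmoothOn U (region M) ∧
  region M ⊆ closure {p | p ∈ region M ∧ denU P Q p.1 p.2 ≠ 0} ∧
  ∀ r s : ℝ, (r, s) ∈ region M → denU P Q r s ≠ 0 → U r s = numU P r s / denU P Q r s

/-- The compatibility equation for `U`. -/
def SatisfiesCompatibility {n : ℕ} (M : Set (E n)) (P Q U : ℝ → ℝ → ℝ) : Prop :=
  ∀ r s : ℝ, (r, s) ∈ region M →
    s * (s * pr U r s + (1 - (r ^ 2 - s ^ 2) * (2 * Q r s)) * r * ps U r s) =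
      r * (1 + (r ^ 2 - s ^ 2) * (2 * (s * ps Q r s - Q r s))) * U r s
        + 2 * r * (r ^ 2 - s ^ 2) * (s * ps P r s - P r s)

end SphFinsler

end

open scoped ContDiff

namespace SphFinsler

/-! ### Calculus of the partial derivatives `pr` and `ps` -/

section TwoVariables

variable {D : Set (ℝ × ℝ)} {f h : ℝ → ℝ → ℝ} {r s : ℝ}

/-! Write ρ = r² - s². Orthogonal invariance reduces `F` to |y| φ(r, s). At linearly independent x,
y the spray then has components |y| P y^i + |y|² Q x^i (`IsGivenBy.spray_eq`). Evaluating the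
fundamental tensor on a vector orthogonal to x and y, and on the vector of span {x, y} that is
g_y-orthogonal to y, yields the two inequalities on φ.

Vanishing Douglas curvature makes the trace-free part of the spray quadratic along lines in y, and
this forces Q = g(r) + b(r) s² (`IsGivenBy.coefQ_eq_quadratic`). Constant flag curvature, tested on
three vectors, gives scalar equations (`IsGivenBy.curvature_equations`). Together with the
definitions of P and Q they become a first order system for φ and P, plus g' + 2rg² = rb(1 - 2r²g)
(`IsGivenBy.isSolution`). The last equation gives the formula for Q. It also shows that T has
logarithmic derivative 4rg + 4r³b, which stays regular where 2r²g = 1.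

For P, put H = P + mφ with m² = -K: the system decouples into a single Riccati-type system for H
(`IsSolution.isRiccati`). With ℓ = (1 - 2r²g)H - 2gs and N = 1 + 2sH + r²H², the functions Tℓ² and N
have vanishing Wronskian in both variables, so they are proportional. Algebra then turns ρ(H -
sH_s)² into a fixed Möbius function of ψ = `charFn` (`IsRiccati.sq_mul_eq`). A smooth square root
gives √ρ (P - sP_s) = η(ψ), and since (-P/s)_s = (P - sP_s)/s² this is the required form of P. The
branch of the root is fixed by connectedness when K ≤ 0 (`IsRiccati.exists_eta_real`) and by φ -
sφ_s > 0 when K > 0 (`IsRiccati.exists_eta_complex`).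

Finally U = s + ρφ_s/φ is smooth from the start. The equation for φ_s says that U times the
denominator is the numerator, and U/ρ is the s-derivative of log φ - ½ log ρ. -/

theorem SmoothOn.contDiffAt (hf : SmoothOn f D) (hD : IsOpen D) (hp : (r, s) ∈ D) :
    ContDiffAt ℝ ∞ (fun p : ℝ × ℝ => f p.1 p.2) (r, s) :=
  ContDiffOn.contDiffAt hf (hD.mem_nhds hp)

theorem SmoothOn.differentiableAt (hf : SmoothOn f D) (hD : IsOpen D) (hp : (r, s) ∈ D) :
    DifferentiableAt ℝ (fun p : ℝ × ℝ => f p.1 p.2) (r, s) :=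
  (hf.contDiffAt hD hp).differentiableAt (by simp)

theorem hasDerivAt_fst_of_differentiableAt
    (hf : DifferentiableAt ℝ (fun p : ℝ × ℝ => f p.1 p.2) (r, s)) :
    HasDerivAt (fun t => f t s) (fderiv ℝ (fun p : ℝ × ℝ => f p.1 p.2) (r, s) (1, 0)) r := by
  have h1 : HasDerivAt (fun t : ℝ => (t, s)) ((1 : ℝ), (0 : ℝ)) r :=
    (hasDerivAt_id r).prodMk (hasDerivAt_const r s)
  exact HasFDerivAt.comp_hasDerivAt (f := fun t : ℝ => (t, s)) r hf.hasFDerivAt h1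

theorem hasDerivAt_snd_of_differentiableAt
    (hf : DifferentiableAt ℝ (fun p : ℝ × ℝ => f p.1 p.2) (r, s)) :
    HasDerivAt (fun t => f r t) (fderiv ℝ (fun p : ℝ × ℝ => f p.1 p.2) (r, s) (0, 1)) s := by
  have h1 : HasDerivAt (fun t : ℝ => (r, t)) ((0 : ℝ), (1 : ℝ)) s :=
    (hasDerivAt_const s r).prodMk (hasDerivAt_id s)
  exact HasFDerivAt.comp_hasDerivAt (f := fun t : ℝ => (r, t)) s hf.hasFDerivAt h1

theorem pr_eq_fderiv (hf : DifferentiableAt ℝ (fun p : ℝ × ℝ => f p.1 p.2) (r, s)) :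
    pr f r s = fderiv ℝ (fun p : ℝ × ℝ => f p.1 p.2) (r, s) (1, 0) :=
  (hasDerivAt_fst_of_differentiableAt hf).deriv

theorem ps_eq_fderiv (hf : DifferentiableAt ℝ (fun p : ℝ × ℝ => f p.1 p.2) (r, s)) :
    ps f r s = fderiv ℝ (fun p : ℝ × ℝ => f p.1 p.2) (r, s) (0, 1) :=
  (hasDerivAt_snd_of_differentiableAt hf).deriv

theorem fderiv_eq_pr_ps (hf : DifferentiableAt ℝ (fun p : ℝ × ℝ => f p.1 p.2) (r, s)) (a b : ℝ) :
    fderiv ℝ (fun p : ℝ × ℝ => f p.1 p.2) (r, s) (a, b) = a * pr f r s + b * ps f r s := by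
  rw [pr_eq_fderiv hf, ps_eq_fderiv hf]
  have : ((a, b) : ℝ × ℝ) = a • ((1 : ℝ), (0 : ℝ)) + b • ((0 : ℝ), (1 : ℝ)) := by simp
  rw [this, map_add, map_smul, map_smul]; simp

theorem SmoothOn.hasDerivAt_fst (hf : SmoothOn f D) (hD : IsOpen D) (hp : (r, s) ∈ D) :
    HasDerivAt (fun t => f t s) (pr f r s) r := by
  rw [pr_eq_fderiv (hf.differentiableAt hD hp)]
  exact hasDerivAt_fst_of_differentiableAt (hf.differentiableAt hD hp)

theorem SmoothOn.hasDerivAt_snd (hf : SmoothOn f D) (hD : IsOpen D) (hp : (r, s) ∈ D) :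
    HasDerivAt (fun t => f r t) (ps f r s) s := by
  rw [ps_eq_fderiv (hf.differentiableAt hD hp)]
  exact hasDerivAt_snd_of_differentiableAt (hf.differentiableAt hD hp)

theorem SmoothOn.pr (hf : SmoothOn f D) (hD : IsOpen D) : SmoothOn (pr f) D := by
  have h1 := (ContDiffOn.fderiv_of_isOpen (m := ∞) hf hD (by simp)).clm_apply
    (contDiffOn_const (c := ((1 : ℝ), (0 : ℝ))))
  exact h1.congr fun p hp => pr_eq_fderiv (hf.differentiableAt hD hp)

theorem SmoothOn.ps (hf : SmoothOn f D) (hD : IsOpen D) : SmoothOn (ps f) D := by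
  have h1 := (ContDiffOn.fderiv_of_isOpen (m := ∞) hf hD (by simp)).clm_apply
    (contDiffOn_const (c := ((0 : ℝ), (1 : ℝ))))
  exact h1.congr fun p hp => ps_eq_fderiv (hf.differentiableAt hD hp)

theorem SmoothOn.pr_ps_comm (hf : SmoothOn f D) (hD : IsOpen D) (hp : (r, s) ∈ D) :
    SphFinsler.pr (SphFinsler.ps f) r s = SphFinsler.ps (SphFinsler.pr f) r s := by
  have hsym := (hf.contDiffAt hD hp).isSymmSndFDerivAt
    (by simpa using (WithTop.coe_le_coe.2 le_top : ((2 : ℕ∞) : WithTop ℕ∞) ≤ ∞))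
  have hd : DifferentiableAt ℝ (fderiv ℝ (fun p : ℝ × ℝ => f p.1 p.2)) (r, s) :=
    ((hf.contDiffAt hD hp).fderiv_right (m := 1) (by norm_cast)).differentiableAt (by simp)
  have key : ∀ v w : ℝ × ℝ,
      fderiv ℝ (fun p : ℝ × ℝ => fderiv ℝ (fun p : ℝ × ℝ => f p.1 p.2) p v) (r, s) w =
        fderiv ℝ (fderiv ℝ (fun p : ℝ × ℝ => f p.1 p.2)) (r, s) w v := by
    intro v w
    rw [fderiv_clm_apply hd (differentiableAt_const v)]
    simp
  have e1 : (fun p : ℝ × ℝ => SphFinsler.ps f p.1 p.2) =ᶠ[nhds (r, s)]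
      fun p => fderiv ℝ (fun p : ℝ × ℝ => f p.1 p.2) p (0, 1) := by
    filter_upwards [hD.mem_nhds hp] with p hp
    exact ps_eq_fderiv (hf.differentiableAt hD hp)
  have e2 : (fun p : ℝ × ℝ => SphFinsler.pr f p.1 p.2) =ᶠ[nhds (r, s)]
      fun p => fderiv ℝ (fun p : ℝ × ℝ => f p.1 p.2) p (1, 0) := by
    filter_upwards [hD.mem_nhds hp] with p hp
    exact pr_eq_fderiv (hf.differentiableAt hD hp)
  rw [pr_eq_fderiv ((hf.ps hD).differentiableAt hD hp),
    ps_eq_fderiv ((hf.pr hD).differentiableAt hD hp), e1.fderiv_eq, e2.fderiv_eq, key, key]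
  exact hsym _ _

theorem SmoothOn.add (hf : SmoothOn f D) (hh : SmoothOn h D) :
    SmoothOn (fun r s => f r s + h r s) D := ContDiffOn.add hf hh

theorem SmoothOn.sub (hf : SmoothOn f D) (hh : SmoothOn h D) :
    SmoothOn (fun r s => f r s - h r s) D := ContDiffOn.sub hf hh

theorem SmoothOn.mul (hf : SmoothOn f D) (hh : SmoothOn h D) :
    SmoothOn (fun r s => f r s * h r s) D := ContDiffOn.mul hf hh

theorem SmoothOn.div (hf : SmoothOn f D) (hh : SmoothOn h D)
    (h0 : ∀ r s, (r, s) ∈ D → h r s ≠ 0) :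
    SmoothOn (fun r s => f r s / h r s) D :=
  ContDiffOn.div hf hh fun p hp => h0 p.1 p.2 hp

theorem smoothOn_fst : SmoothOn (fun r _ => r) D := contDiffOn_fst

theorem smoothOn_snd : SmoothOn (fun _ s => s) D := contDiffOn_snd

theorem smoothOn_const (c : ℝ) : SmoothOn (fun _ _ => c) D := contDiffOn_const

theorem smoothOn_rho : SmoothOn (fun r s => r ^ 2 - s ^ 2) D :=
  (contDiffOn_fst.pow 2).sub (contDiffOn_snd.pow 2)

theorem SmoothOn.mono {D' : Set (ℝ × ℝ)} (hf : SmoothOn f D) (h : D' ⊆ D) : SmoothOn f D' :=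
  ContDiffOn.mono hf h

end TwoVariables

/-! ### The radii of `M` and the reduction of `F` to a function of (r, s) -/

section Domain

variable {n : ℕ} {M : Set (E n)}

theorem radii_isOpen (hn : 1 ≤ n) (hM : IsSymmetricDomain M) :
    IsOpen (radii M) ∧ (radii M).OrdConnected ∧ (radii M).Nonempty ∧ IsOpen M ∧
      (∀ x : E n, ‖x‖ ∈ radii M → x ∈ M) ∧
      (∀ x ∈ M, x ≠ 0 → ‖x‖ ∈ radii M) := by
  have hnt : Nontrivial (E n) := by
    have : Nonempty (Fin n) := ⟨⟨0, hn⟩⟩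
    infer_instance
  have hex : ∀ r : ℝ, 0 < r → ∃ x : E n, ‖x‖ = r := fun r hr =>
    (NormedSpace.sphere_nonempty (x := (0 : E n)) (r := r)).2 hr.le |>.imp fun x hx => by
      simpa using hx
  have hlast : ∀ x ∈ M, x ≠ 0 → ‖x‖ ∈ radii M := fun x hx h0 => ⟨norm_pos_iff.2 h0, x, hx, rfl⟩
  rcases hM with ⟨ν, hν, rfl⟩ | ⟨ν₁, ν₂, h0, h12, rfl⟩ | rfl
  · have hI : radii {x : E n | ‖x‖ < ν} = Set.Ioo 0 ν := by
      ext r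
      constructor
      · rintro ⟨h, x, hx, rfl⟩
        exact ⟨h, hx⟩
      · rintro ⟨h, h'⟩
        obtain ⟨x, hx⟩ := hex r h
        exact ⟨h, x, by simpa [hx] using h', hx⟩
    rw [hI] at hlast ⊢
    exact ⟨isOpen_Ioo, Set.ordConnected_Ioo, Set.nonempty_Ioo.2 hν,
      isOpen_lt continuous_norm continuous_const, fun x hx => hx.2, hlast⟩
  · have hI : radii {x : E n | ν₂ < ‖x‖ ∧ ‖x‖ < ν₁} = Set.Ioo ν₂ ν₁ := by
      ext r
      constructor
      · rintro ⟨h, x, hx, rfl⟩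
        exact hx
      · rintro ⟨h, h'⟩
        obtain ⟨x, hx⟩ := hex r (h0.trans_lt h)
        exact ⟨h0.trans_lt h, x, by simpa [hx] using ⟨h, h'⟩, hx⟩
    rw [hI] at hlast ⊢
    exact ⟨isOpen_Ioo, Set.ordConnected_Ioo, Set.nonempty_Ioo.2 h12,
      (isOpen_lt continuous_const continuous_norm).inter
        (isOpen_lt continuous_norm continuous_const), fun x hx => hx, hlast⟩
  · have hI : radii (Set.univ : Set (E n)) = Set.Ioi 0 := by
      ext r
      constructor
      · rintro ⟨h, -⟩
        exact h
      · intro h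
        obtain ⟨x, hx⟩ := hex r h
        exact ⟨h, x, trivial, hx⟩
    rw [hI] at hlast ⊢
    exact ⟨isOpen_Ioi, Set.ordConnected_Ioi, Set.nonempty_Ioi, isOpen_univ, fun _ _ => trivial,
      hlast⟩

theorem region_isOpen (hI : IsOpen (radii M)) : IsOpen (region M) :=
  (hI.preimage continuous_fst).inter
    (isOpen_lt (continuous_abs.comp continuous_snd) continuous_fst)

theorem region_pos {r s : ℝ} (h : (r, s) ∈ region M) : 0 < r := h.1.1

theorem region_rho_pos {r s : ℝ} (h : (r, s) ∈ region M) : 0 < r ^ 2 - s ^ 2 := by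
  have h1 : |s| < r := h.2
  have := abs_lt.1 h1
  nlinarith

/-- The function `φ` of a spherically symmetric metric. -/
noncomputable def profile (F : E n → E n → ℝ) (e₀ e₁ : E n) : ℝ → ℝ → ℝ := fun r s =>
  F (r • e₀) ((s / r) • e₀ + Real.sqrt (1 - (s / r) ^ 2) • e₁)

/-- Gram–Schmidt with the degenerate cases included: if y is parallel to x the square root vanishes
and any unit b orthogonal to a will do; n ≥ 2 provides one. -/
theorem exists_orthonormal_pair (hn : 2 ≤ n) (x y : E n) (hy : ‖y‖ = 1) :
    ∃ a b : E n, Orthonormal ℝ ![a, b] ∧ x = ‖x‖ • a ∧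
      y = (inner ℝ x y / ‖x‖) • a + Real.sqrt (1 - (inner ℝ x y / ‖x‖) ^ 2) • b := by
  have ortho : ∀ a : E n, ‖a‖ = 1 → ∃ b : E n, ‖b‖ = 1 ∧ inner ℝ a b = 0 := by
    intro a ha
    have h1 : Module.finrank ℝ (E n) = Fintype.card (Fin n) := by simp
    have : Orthonormal ℝ (({⟨0, by omega⟩} : Set (Fin n)).domRestrict fun _ => a) := by
      constructor
      · intro i; simpa using ha
      · intro i j hij
        exact absurd (Subsingleton.elim i j) hij
    obtain ⟨B, hB⟩ := this.exists_orthonormalBasis_extension_of_card_eq h1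
    have h0 : B ⟨0, by omega⟩ = a := hB _ rfl
    refine ⟨B ⟨1, by omega⟩, B.orthonormal.1 _, ?_⟩
    rw [← h0]
    exact B.orthonormal.2 (by simp)
  have pair : ∀ a : E n, ‖a‖ = 1 → ∃ b : E n, Orthonormal ℝ ![a, b] ∧
      y = (inner ℝ a y) • a + Real.sqrt (1 - (inner ℝ a y) ^ 2) • b := by
    intro a ha
    set c : ℝ := inner ℝ a y
    set z := y - c • a with hz
    have haz : inner ℝ a z = 0 := by
      simp [hz, inner_sub_right, inner_smul_right, ha, c]
    have hzn : ‖z‖ ^ 2 = 1 - c ^ 2 := by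
      rw [hz, norm_sub_sq_real, hy, norm_smul, ha, inner_smul_right, real_inner_comm]
      simp [c]; ring
    have hsq : Real.sqrt (1 - c ^ 2) = ‖z‖ := by rw [← hzn, Real.sqrt_sq (norm_nonneg z)]
    by_cases h0 : z = 0
    · obtain ⟨b, hb, hab⟩ := ortho a ha
      refine ⟨b, ?_, ?_⟩
      · rw [orthonormal_vecCons_iff]
        refine ⟨ha, fun i => ?_, ?_⟩
        · fin_cases i; simpa using hab
        · simp [hb]
      · rw [hsq, h0, norm_zero, zero_smul, add_zero]
        exact sub_eq_zero.1 h0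
    · have hz0 : ‖z‖ ≠ 0 := norm_ne_zero_iff.2 h0
      refine ⟨‖z‖⁻¹ • z, ?_, ?_⟩
      · rw [orthonormal_vecCons_iff]
        refine ⟨ha, fun i => ?_, ?_⟩
        · fin_cases i; simp [inner_smul_right, haz]
        · simp [norm_smul, hz0]
      · rw [hsq, smul_smul, mul_inv_cancel₀ hz0, one_smul, hz]; abel
  by_cases hx : x = 0
  · obtain ⟨a, ha, hya⟩ := ortho y hy
    -- Division by ‖x‖ = 0 gives 0, so the last identity reads y = 0 • a + 1 • b with b = y.
    refine ⟨a, y, ?_, by simp [hx], by simp [hx]⟩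
    rw [orthonormal_vecCons_iff]
    refine ⟨ha, fun i => ?_, ?_⟩
    · fin_cases i; rw [real_inner_comm] at hya; simpa using hya
    · simp [hy]
  · have hx0 : ‖x‖ ≠ 0 := norm_ne_zero_iff.2 hx
    obtain ⟨b, hb, hyb⟩ := pair (‖x‖⁻¹ • x) (by simp [norm_smul, hx0])
    refine ⟨_, b, hb, by rw [smul_smul, mul_inv_cancel₀ hx0, one_smul], ?_⟩
    have : inner ℝ x y / ‖x‖ = inner ℝ (‖x‖⁻¹ • x) y := by
      rw [inner_smul_left]; simp; ring
    rw [this]; exact hyb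

/-- Both pairs extend to orthonormal bases, and the isometry matches the bases. -/
theorem exists_isometry_pair (hn : 2 ≤ n) {a b a' b' : E n} (h : Orthonormal ℝ ![a, b])
    (h' : Orthonormal ℝ ![a', b']) : ∃ A : E n ≃ₗᵢ[ℝ] E n, A a = a' ∧ A b = b' := by
  have h1 : Module.finrank ℝ (E n) = Fintype.card (Fin n) := by simp
  have ext : ∀ a b : E n, Orthonormal ℝ ![a, b] → ∃ B : OrthonormalBasis (Fin n) ℝ (E n),
      B ⟨0, by omega⟩ = a ∧ B ⟨1, by omega⟩ = b := by
    intro a b h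
    let v : Fin n → E n := fun i => if i.1 = 0 then a else b
    have hv : Orthonormal ℝ (({⟨0, by omega⟩, ⟨1, by omega⟩} : Set (Fin n)).domRestrict v) := by
      have hab : inner ℝ a b = 0 := h.2 (i := 0) (j := 1) (by simp)
      constructor
      · rintro ⟨i, hi⟩
        rcases hi with rfl | rfl
        · simpa [v] using h.1 0
        · simpa [v] using h.1 1
      · rintro ⟨i, hi⟩ ⟨j, hj⟩ hij
        rcases hi with rfl | rfl <;> rcases hj with rfl | rfl
        · exact absurd rfl hij
        · simpa [v] using hab
        · rw [real_inner_comm] at hab; simpa [v] using hab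
        · exact absurd rfl hij
    obtain ⟨B, hB⟩ := hv.exists_orthonormalBasis_extension_of_card_eq h1
    exact ⟨B, by simpa [v] using hB ⟨0, by omega⟩ (by simp),
      by simpa [v] using hB ⟨1, by omega⟩ (by simp)⟩
  obtain ⟨B, hB0, hB1⟩ := ext a b h
  obtain ⟨B', hB0', hB1'⟩ := ext a' b' h'
  refine ⟨B.equiv B' (Equiv.refl _), ?_, ?_⟩
  · rw [← hB0, ← hB0', OrthonormalBasis.equiv_apply_basis]; rfl
  · rw [← hB1, ← hB1', OrthonormalBasis.equiv_apply_basis]; rfl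

/-- An isometry carries x and y/|y| into the plane of the fixed frame. The argument covers x = 0 and
collinear x, y, which lie outside `region M`. -/
theorem eq_norm_mul_profile (hn : 2 ≤ n) {F : E n → E n → ℝ} (hF : IsFinslerMetric M F)
    (hsym : IsSphericallySymmetric M F) {e₀ e₁ : E n} (he : Orthonormal ℝ ![e₀, e₁])
    {x y : E n} (hx : x ∈ M) (hy : y ≠ 0) :
    F x y = ‖y‖ * profile F e₀ e₁ ‖x‖ (inner ℝ x y / ‖y‖) := by
  have hy0 : 0 < ‖y‖ := norm_pos_iff.2 hy
  obtain ⟨a, b, hab, hxa, hyb⟩ := exists_orthonormal_pair hn x (‖y‖⁻¹ • y)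
    (by simp [norm_smul, hy0.ne'])
  obtain ⟨A, hA0, hA1⟩ := exists_isometry_pair hn hab he
  have hi : inner ℝ x (‖y‖⁻¹ • y) = inner ℝ x y / ‖y‖ := by
    rw [inner_smul_right]; field_simp
  have h1 : F x y = ‖y‖ * F x (‖y‖⁻¹ • y) := by
    rw [← hF.homog x hx _ _ hy0, smul_smul, mul_inv_cancel₀ hy0.ne', one_smul]
  rw [h1, ← hsym A x hx]
  have hAx : A x = ‖x‖ • e₀ := by
    rw [← hA0, ← map_smul, ← hxa]
  have hAy : A (‖y‖⁻¹ • y) = (inner ℝ x y / ‖y‖ / ‖x‖) • e₀ +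
      Real.sqrt (1 - (inner ℝ x y / ‖y‖ / ‖x‖) ^ 2) • e₁ := by
    rw [hyb, hi, map_add, map_smul, map_smul, hA0, hA1]
  rw [hAx, hAy, profile]

/-- Inside the region the radicand 1 - (s/r)² is positive. So the root is smooth, and the second
argument of `F`, having a nonzero component along `e₁`, stays off the zero section. -/
theorem profile_smoothOn {F : E n → E n → ℝ} (hF : IsFinslerMetric M F)
    (hMem : ∀ x : E n, ‖x‖ ∈ radii M → x ∈ M)
    {e₀ e₁ : E n} (he : Orthonormal ℝ ![e₀, e₁]) : SmoothOn (profile F e₀ e₁) (region M) := by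
  have h0 : ‖e₀‖ = 1 := he.1 0
  have h1 : ‖e₁‖ = 1 := he.1 1
  have h01 : inner ℝ e₁ e₀ = 0 := he.2 (i := 1) (j := 0) (by simp)
  have hpos : ∀ p ∈ region M, 0 < 1 - (p.2 / p.1) ^ 2 := by
    rintro ⟨r, s⟩ hp
    have hr := region_pos hp
    have h2 := region_rho_pos hp
    have : 1 - (s / r) ^ 2 = (r ^ 2 - s ^ 2) / r ^ 2 := by field_simp
    simp only [this]; positivity
  have hq : ContDiffOn ℝ ∞ (fun p : ℝ × ℝ => p.2 / p.1) (region M) :=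
    contDiffOn_snd.div contDiffOn_fst fun p hp => (region_pos (s := p.2) hp).ne'
  have hsq : ContDiffOn ℝ ∞ (fun p : ℝ × ℝ => Real.sqrt (1 - (p.2 / p.1) ^ 2)) (region M) :=
    (contDiffOn_const.sub (hq.pow 2)).sqrt fun p hp => (hpos p hp).ne'
  have hg : ContDiffOn ℝ ∞ (fun p : ℝ × ℝ =>
      ((p.1 • e₀, (p.2 / p.1) • e₀ + Real.sqrt (1 - (p.2 / p.1) ^ 2) • e₁) : E n × E n))
      (region M) :=
    (contDiffOn_fst.smul contDiffOn_const).prodMk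
      ((hq.smul contDiffOn_const).add (hsq.smul contDiffOn_const))
  refine ContDiffOn.comp (g := fun p : E n × E n => F p.1 p.2) hF.smooth hg ?_
  rintro ⟨r, s⟩ hp
  refine ⟨hMem _ ?_, ?_⟩
  · have hr := region_pos hp
    simpa [norm_smul, h0, abs_of_pos hr] using hp.1
  · intro h
    have h' : (s / r) • e₀ + Real.sqrt (1 - (s / r) ^ 2) • e₁ = 0 := h
    have h2 := congrArg (fun v => inner ℝ e₁ v) h'
    simp only [inner_add_right, inner_smul_right, h01, real_inner_self_eq_norm_sq, h1,
      inner_zero_right] at h2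
    have := Real.sqrt_pos.2 (hpos _ hp)
    simp only [mul_zero, mul_one, one_pow, zero_add] at h2
    exact this.ne' h2

end Domain

/-! ### Directional derivatives in x and in y -/

section Directional

variable {n : ℕ} {f g : E n → E n → ℝ} {x y : E n} {p q : E n → ℝ}

/-- `f` is differentiable in its first argument at `(x, y)`, with derivative `p`. -/
def HasX (f : E n → E n → ℝ) (x y : E n) (p : E n → ℝ) : Prop :=
  ∃ L : E n →L[ℝ] ℝ, HasFDerivAt (fun z => f z y) L x ∧ ∀ u, L u = p u

/-- `f` is differentiable in its second argument at `(x, y)`, with derivative `p`. -/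
def HasY (f : E n → E n → ℝ) (x y : E n) (p : E n → ℝ) : Prop :=
  ∃ L : E n →L[ℝ] ℝ, HasFDerivAt (fun z => f x z) L y ∧ ∀ u, L u = p u

theorem HasX.congr (h : HasX f x y p) (hpq : ∀ u, p u = q u) : HasX f x y q := by
  obtain ⟨L, h1, h2⟩ := h
  exact ⟨L, h1, fun u => (h2 u).trans (hpq u)⟩

theorem HasY.congr (h : HasY f x y p) (hpq : ∀ u, p u = q u) : HasY f x y q := by
  obtain ⟨L, h1, h2⟩ := h
  exact ⟨L, h1, fun u => (h2 u).trans (hpq u)⟩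

theorem HasX.congr_of_eventually (h : HasX f x y p) (hfg : ∀ᶠ z in nhds x, g z y = f z y) :
    HasX g x y p := by
  obtain ⟨L, h1, h2⟩ := h
  exact ⟨L, h1.congr_of_eventuallyEq hfg, h2⟩

theorem HasY.congr_of_eventually (h : HasY f x y p) (hfg : ∀ᶠ z in nhds y, g x z = f x z) :
    HasY g x y p := by
  obtain ⟨L, h1, h2⟩ := h
  exact ⟨L, h1.congr_of_eventuallyEq hfg, h2⟩

theorem HasX.add (hf : HasX f x y p) (hg : HasX g x y q) :
    HasX (fun x y => f x y + g x y) x y (fun u => p u + q u) := by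
  obtain ⟨L, h1, h2⟩ := hf
  obtain ⟨L', h1', h2'⟩ := hg
  exact ⟨L + L', h1.add h1', fun u => by simp [h2, h2']⟩

theorem HasY.add (hf : HasY f x y p) (hg : HasY g x y q) :
    HasY (fun x y => f x y + g x y) x y (fun u => p u + q u) := by
  obtain ⟨L, h1, h2⟩ := hf
  obtain ⟨L', h1', h2'⟩ := hg
  exact ⟨L + L', h1.add h1', fun u => by simp [h2, h2']⟩

theorem HasX.mul (hf : HasX f x y p) (hg : HasX g x y q) :
    HasX (fun x y => f x y * g x y) x y (fun u => f x y * q u + g x y * p u) := by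
  obtain ⟨L, h1, h2⟩ := hf
  obtain ⟨L', h1', h2'⟩ := hg
  exact ⟨_, h1.mul h1', fun u => by simp [h2, h2']⟩

theorem HasY.mul (hf : HasY f x y p) (hg : HasY g x y q) :
    HasY (fun x y => f x y * g x y) x y (fun u => f x y * q u + g x y * p u) := by
  obtain ⟨L, h1, h2⟩ := hf
  obtain ⟨L', h1', h2'⟩ := hg
  exact ⟨_, h1.mul h1', fun u => by simp [h2, h2']⟩

theorem HasX.const (c : E n → ℝ) : HasX (fun _ y => c y) x y (fun _ => 0) :=
  ⟨0, hasFDerivAt_const _ _, fun _ => rfl⟩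

theorem HasY.const (c : E n → ℝ) : HasY (fun x _ => c x) x y (fun _ => 0) :=
  ⟨0, hasFDerivAt_const _ _, fun _ => rfl⟩

theorem HasX.inner_const (v : E n) : HasX (fun x _ => inner ℝ x v) x y (fun u => inner ℝ v u) := by
  refine ⟨innerSL ℝ v, ?_, fun u => by simp⟩
  have : (fun z : E n => inner ℝ z v) = fun z => innerSL ℝ v z := by
    ext z; simp [real_inner_comm]
  rw [this]; exact (innerSL ℝ v).hasFDerivAt

theorem HasY.inner_const (v : E n) : HasY (fun _ y => inner ℝ y v) x y (fun u => inner ℝ v u) := by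
  refine ⟨innerSL ℝ v, ?_, fun u => by simp⟩
  have : (fun z : E n => inner ℝ z v) = fun z => innerSL ℝ v z := by
    ext z; simp [real_inner_comm]
  rw [this]; exact (innerSL ℝ v).hasFDerivAt

theorem hasFDerivAt_norm_inner (hx : x ≠ 0) :
    HasFDerivAt (fun z : E n => ‖z‖) (‖x‖⁻¹ • innerSL ℝ x) x := by
  have h1 : HasFDerivAt (fun z : E n => ‖z‖ ^ 2) (2 • innerSL ℝ x) x :=
    (hasStrictFDerivAt_norm_sq x).hasFDerivAt
  have h0 : ‖x‖ ≠ 0 := norm_ne_zero_iff.2 hx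
  have h2 := h1.sqrt (by positivity)
  simp only [Real.sqrt_sq (norm_nonneg _)] at h2
  refine h2.congr_fderiv ?_
  rw [← Nat.cast_smul_eq_nsmul ℝ, smul_smul]
  congr 1
  push_cast
  field_simp

theorem HasY.norm (hy : y ≠ 0) :
    HasY (fun (_ : E n) y => ‖y‖) x y (fun u => inner ℝ y u / ‖y‖) :=
  ⟨_, hasFDerivAt_norm_inner hy, fun u => by simp; ring⟩

theorem HasY.inv_norm (hy : y ≠ 0) :
    HasY (fun (_ : E n) y => ‖y‖⁻¹) x y (fun u => -(inner ℝ y u / ‖y‖ ^ 3)) := by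
  have h0 : ‖y‖ ≠ 0 := norm_ne_zero_iff.2 hy
  refine ⟨_, (hasDerivAt_inv h0).comp_hasFDerivAt y (hasFDerivAt_norm_inner hy), fun u => ?_⟩
  simp
  field_simp

/-- Index contractions of partial derivatives become single directional derivatives, so the sums in
the spray and the curvature need not be expanded. -/
theorem sum_mul_clm (L : E n →L[ℝ] ℝ) (v : E n) :
    ∑ k, v k * L (EuclideanSpace.single k 1) = L v := by
  conv_rhs => rw [← (EuclideanSpace.basisFun (Fin n) ℝ).sum_repr v]
  simp [map_sum]

theorem HasX.dX_eq (h : HasX f x y p) (k : Fin n) :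
    dX k f x y = p (EuclideanSpace.single k 1) := by
  obtain ⟨L, h1, h2⟩ := h
  rw [dX, h1.fderiv, h2]

theorem HasY.dY_eq (h : HasY f x y p) (k : Fin n) :
    dY k f x y = p (EuclideanSpace.single k 1) := by
  obtain ⟨L, h1, h2⟩ := h
  rw [dY, h1.fderiv, h2]

theorem HasX.sum_eq (h : HasX f x y p) (v : E n) :
    ∑ k, v k * p (EuclideanSpace.single k 1) = p v := by
  obtain ⟨L, h1, h2⟩ := h
  simp only [← h2]; exact sum_mul_clm L v

theorem HasY.sum_eq (h : HasY f x y p) (v : E n) :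
    ∑ k, v k * p (EuclideanSpace.single k 1) = p v := by
  obtain ⟨L, h1, h2⟩ := h
  simp only [← h2]; exact sum_mul_clm L v

end Directional

/-! ### Linearly independent x, y and functions of (|x|, s) -/

section Generic

variable {n : ℕ} {M : Set (E n)} {x y : E n} {h : ℝ → ℝ → ℝ}

/-- The variable `s = ⟨x, y⟩ / |y|`. -/
noncomputable def sval (x y : E n) : ℝ := inner ℝ x y / ‖y‖

/-- `x` and `y` are linearly independent, with `|x|` a radius of `M`. -/
def Gen (M : Set (E n)) (x y : E n) : Prop := y ≠ 0 ∧ (‖x‖, sval x y) ∈ region M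

theorem Gen.norm_pos_left (hg : Gen M x y) : 0 < ‖x‖ := region_pos hg.2

theorem Gen.norm_pos_right (hg : Gen M x y) : 0 < ‖y‖ := norm_pos_iff.2 hg.1

theorem Gen.left_ne_zero (hg : Gen M x y) : x ≠ 0 := norm_pos_iff.1 hg.norm_pos_left

theorem Gen.inner_eq (hg : Gen M x y) : inner ℝ x y = sval x y * ‖y‖ := by
  have := hg.norm_pos_right
  rw [sval]; field_simp

theorem Gen.eventually_left (hI : IsOpen (radii M)) (hg : Gen M x y) :
    ∀ᶠ z in nhds x, Gen M z y := by
  have hc : ContinuousAt (fun z : E n => ((‖z‖, sval z y) : ℝ × ℝ)) x := by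
    unfold sval; fun_prop
  filter_upwards [hc.preimage_mem_nhds ((region_isOpen hI).mem_nhds hg.2)] with z hz
  exact ⟨hg.1, hz⟩

theorem Gen.eventually_right (hI : IsOpen (radii M)) (hg : Gen M x y) :
    ∀ᶠ z in nhds y, Gen M x z := by
  have hc : ContinuousAt (fun z : E n => ((‖x‖, sval x z) : ℝ × ℝ)) y := by
    unfold sval
    have := hg.norm_pos_right.ne'
    fun_prop (disch := assumption)
  filter_upwards [hc.preimage_mem_nhds ((region_isOpen hI).mem_nhds hg.2),
    isOpen_ne.mem_nhds hg.1] with z hz hz'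
  exact ⟨hz', hz⟩

theorem HasX.comp_region (hI : IsOpen (radii M)) (hh : SmoothOn h (region M)) (hg : Gen M x y) :
    HasX (fun x y => h ‖x‖ (sval x y)) x y (fun u =>
      pr h ‖x‖ (sval x y) * (inner ℝ x u / ‖x‖) + ps h ‖x‖ (sval x y) * (inner ℝ y u / ‖y‖)) := by
  have hd := hh.differentiableAt (region_isOpen hI) hg.2
  have h1 : HasFDerivAt (fun z : E n => sval z y) (‖y‖⁻¹ • innerSL ℝ y) x := by
    have : (fun z : E n => sval z y) = fun z => (‖y‖⁻¹ • innerSL ℝ y) z := by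
      ext z; simp [sval, real_inner_comm]; ring
    rw [this]; exact (‖y‖⁻¹ • innerSL ℝ y).hasFDerivAt
  refine ⟨_, HasFDerivAt.comp (g := fun p : ℝ × ℝ => h p.1 p.2) (f := fun z => (‖z‖, sval z y)) x
    hd.hasFDerivAt ((hasFDerivAt_norm_inner hg.left_ne_zero).prodMk h1), fun u => ?_⟩
  simp only [ContinuousLinearMap.comp_apply, ContinuousLinearMap.prod_apply]
  rw [fderiv_eq_pr_ps hd]
  simp; ring

theorem HasY.comp_region (hI : IsOpen (radii M)) (hh : SmoothOn h (region M)) (hg : Gen M x y) :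
    HasY (fun x y => h ‖x‖ (sval x y)) x y (fun u =>
      ps h ‖x‖ (sval x y) * ((inner ℝ x u - sval x y * (inner ℝ y u / ‖y‖)) / ‖y‖)) := by
  have hd := hh.differentiableAt (region_isOpen hI) hg.2
  have hy0 := hg.norm_pos_right.ne'
  have h1 : HasY (fun x y => inner ℝ x y * ‖y‖⁻¹) x y (fun u =>
      (inner ℝ x u - sval x y * (inner ℝ y u / ‖y‖)) / ‖y‖) := by
    refine (HasY.mul (f := fun x y => inner ℝ x y) (p := fun u => inner ℝ x u)
      ⟨innerSL ℝ x, (innerSL ℝ x).hasFDerivAt, fun u => by simp⟩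
      (HasY.inv_norm hg.1)).congr fun u => ?_
    rw [hg.inner_eq]; field_simp; ring
  obtain ⟨L, hL, hL'⟩ := h1
  refine ⟨_, HasFDerivAt.comp (g := fun p : ℝ × ℝ => h p.1 p.2) (f := fun z => (‖x‖, sval x z)) y
    hd.hasFDerivAt ((hasFDerivAt_const ‖x‖ y).prodMk hL), fun u => ?_⟩
  simp only [ContinuousLinearMap.comp_apply, ContinuousLinearMap.prod_apply]
  rw [fderiv_eq_pr_ps hd, hL']
  simp [mul_comm]

/-- Lets pointwise tensor identities be read as identities in (r, s). The vector e orthogonal to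
both x and y exists because n ≥ 3. -/
theorem exists_gen_frame (hn : 3 ≤ n) {r s : ℝ} (hp : (r, s) ∈ region M) :
    ∃ x y e : E n, Gen M x y ∧ ‖x‖ = r ∧ ‖y‖ = 1 ∧ sval x y = s ∧ ‖e‖ = 1 ∧
      inner ℝ x e = 0 ∧ inner ℝ y e = 0 := by
  have hr := region_pos hp
  have hρ := region_rho_pos hp
  have h01 : (⟨0, by omega⟩ : Fin n) ≠ ⟨1, by omega⟩ := by simp
  have h02 : (⟨0, by omega⟩ : Fin n) ≠ ⟨2, by omega⟩ := by simp
  have h12 : (⟨1, by omega⟩ : Fin n) ≠ ⟨2, by omega⟩ := by simp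
  let x : E n := r • EuclideanSpace.single ⟨0, by omega⟩ 1
  let y : E n := (s / r) • EuclideanSpace.single ⟨0, by omega⟩ 1 +
    Real.sqrt (1 - (s / r) ^ 2) • EuclideanSpace.single ⟨1, by omega⟩ 1
  have hpos : 0 < 1 - (s / r) ^ 2 := by
    have : 1 - (s / r) ^ 2 = (r ^ 2 - s ^ 2) / r ^ 2 := by field_simp
    rw [this]; positivity
  have hx : ‖x‖ = r := by simp [x, norm_smul, abs_of_pos hr]
  have hy : ‖y‖ = 1 := by
    have : ‖y‖ ^ 2 = 1 := by
      rw [← real_inner_self_eq_norm_sq]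
      simp only [y, inner_add_left, inner_add_right, inner_smul_left, inner_smul_right,
        EuclideanSpace.inner_single_left]
      simp [h01, h01.symm]
      rw [Real.mul_self_sqrt (by simpa using hpos.le)]; ring
    nlinarith [norm_nonneg y]
  have hxy : inner ℝ x y = s := by
    simp only [x, y, inner_add_right, inner_smul_left, inner_smul_right,
      EuclideanSpace.inner_single_left]
    simp [h01]
    field_simp
  have hsv : sval x y = s := by rw [sval, hxy, hy, div_one]
  refine ⟨x, y, EuclideanSpace.single ⟨2, by omega⟩ 1, ⟨?_, ?_⟩, hx, hy, hsv, by simp, ?_, ?_⟩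
  · rw [← norm_pos_iff, hy]; exact one_pos
  · rw [hx, hsv]; exact hp
  · simp only [x, inner_smul_left, EuclideanSpace.inner_single_left]
    simp [h02]
  · simp only [y, inner_add_left, inner_smul_left,
      EuclideanSpace.inner_single_left]
    simp [h02, h12]

end Generic

/-! ### The fundamental tensor and the Finsler inequalities -/

section Metric

variable {n : ℕ} {M : Set (E n)} {x y : E n} {φ h : ℝ → ℝ → ℝ} {F : E n → E n → ℝ}

/-- The combination `h - s h_s`. -/
noncomputable def intercept (h : ℝ → ℝ → ℝ) : ℝ → ℝ → ℝ := fun r s => h r s - s * ps h r s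

theorem SmoothOn.intercept (hI : IsOpen (radii M)) (hh : SmoothOn h (region M)) :
    SmoothOn (intercept h) (region M) :=
  hh.sub (smoothOn_snd.mul (hh.ps (region_isOpen hI)))

theorem ps_intercept (hI : IsOpen (radii M)) (hh : SmoothOn h (region M)) {r s : ℝ}
    (hp : (r, s) ∈ region M) : ps (intercept h) r s = -(s * ps (ps h) r s) := by
  have hD := region_isOpen hI
  have h1 := (hh.hasDerivAt_snd hD hp).sub
    ((hasDerivAt_id s).mul ((hh.ps hD).hasDerivAt_snd hD hp))
  refine (h1.deriv : _).trans ?_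
  simp

theorem pr_intercept (hI : IsOpen (radii M)) (hh : SmoothOn h (region M)) {r s : ℝ}
    (hp : (r, s) ∈ region M) : pr (intercept h) r s = pr h r s - s * ps (pr h) r s := by
  have hD := region_isOpen hI
  have h1 := (hh.hasDerivAt_fst hD hp).sub
    (((hh.ps hD).hasDerivAt_fst hD hp).const_mul s)
  rw [hh.pr_ps_comm hD hp] at h1
  exact h1.deriv

/-- The second fundamental form `g_y(u, v)` of `F = |y| φ(|x|, ⟨x, y⟩ / |y|)`. -/
noncomputable def metricForm (φ : ℝ → ℝ → ℝ) (x y u v : E n) : ℝ :=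
  (ps φ ‖x‖ (sval x y) * inner ℝ x u + intercept φ ‖x‖ (sval x y) * (inner ℝ y u / ‖y‖)) *
    (ps φ ‖x‖ (sval x y) * inner ℝ x v + intercept φ ‖x‖ (sval x y) * (inner ℝ y v / ‖y‖)) +
  φ ‖x‖ (sval x y) *
    (ps (ps φ) ‖x‖ (sval x y) * (inner ℝ x u - sval x y * (inner ℝ y u / ‖y‖)) *
      (inner ℝ x v - sval x y * (inner ℝ y v / ‖y‖)) +
    intercept φ ‖x‖ (sval x y) * (inner ℝ u v - inner ℝ y u / ‖y‖ * (inner ℝ y v / ‖y‖)))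

theorem metricForm_comm (u v : E n) : metricForm φ x y u v = metricForm φ x y v u := by
  unfold metricForm
  rw [real_inner_comm u v]; ring

/-- `F` is given by the smooth function `φ` at generic points. -/
structure IsGivenBy (M : Set (E n)) (F : E n → E n → ℝ) (φ : ℝ → ℝ → ℝ) : Prop where
  isOpen : IsOpen (radii M)
  mem : ∀ x : E n, ‖x‖ ∈ radii M → x ∈ M
  smooth : SmoothOn φ (region M)
  eq : ∀ x y, Gen M x y → F x y = ‖y‖ * φ ‖x‖ (sval x y)

variable (hφ : IsGivenBy M F φ)
include hφ

theorem IsGivenBy.energy_hasY (hg : Gen M x y) :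
    HasY (energy F) x y (fun u => 2 * φ ‖x‖ (sval x y) *
      (‖y‖ * ps φ ‖x‖ (sval x y) * inner ℝ x u + intercept φ ‖x‖ (sval x y) * inner ℝ y u)) := by
  have h1 := (HasY.norm (x := x) hg.1).mul (HasY.comp_region hφ.isOpen hφ.smooth hg)
  have hy := hg.norm_pos_right
  refine ((h1.mul h1).congr_of_eventually ?_).congr fun u => ?_
  · filter_upwards [hg.eventually_right hφ.isOpen] with z hz
    rw [energy, hφ.eq _ _ hz, sq]
  · simp only [SphFinsler.intercept]; field_simp; ring

theorem IsGivenBy.energy_hasX (hg : Gen M x y) :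
    HasX (energy F) x y (fun u => 2 * φ ‖x‖ (sval x y) * ‖y‖ ^ 2 *
      (pr φ ‖x‖ (sval x y) * (inner ℝ x u / ‖x‖) +
        ps φ ‖x‖ (sval x y) * (inner ℝ y u / ‖y‖))) := by
  have h1 := (HasX.const (x := x) (y := y) (fun y => ‖y‖)).mul
    (HasX.comp_region hφ.isOpen hφ.smooth hg)
  have hy := hg.norm_pos_right
  have hx := hg.norm_pos_left
  refine ((h1.mul h1).congr_of_eventually ?_).congr fun u => ?_
  · filter_upwards [hg.eventually_left hφ.isOpen] with z hz
    rw [energy, hφ.eq _ _ hz, sq]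
  · field_simp; ring

theorem IsGivenBy.dY_energy_hasY (hg : Gen M x y) (l : Fin n) :
    HasY (dY l (energy F)) x y (fun u =>
      2 * metricForm φ x y (EuclideanSpace.single l 1) u) := by
  have hD := region_isOpen hφ.isOpen
  have hy := hg.norm_pos_right
  set w : E n := EuclideanSpace.single l 1
  have h1 := HasY.comp_region hφ.isOpen hφ.smooth hg
  have h2 := HasY.comp_region hφ.isOpen (hφ.smooth.ps hD) hg
  have h3 := HasY.comp_region hφ.isOpen (SmoothOn.intercept hφ.isOpen hφ.smooth) hg
  have h4 := ((HasY.const (x := x) (y := y) (fun _ => (2 : ℝ))).mul h1).mul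
    ((((HasY.norm (x := x) hg.1).mul h2).mul
      (HasY.const (x := x) (y := y) (fun x => inner ℝ x w))).add (h3.mul (HasY.inner_const w)))
  refine (h4.congr_of_eventually ?_).congr fun u => ?_
  · filter_upwards [hg.eventually_right hφ.isOpen] with z hz
    exact (hφ.energy_hasY hz).dY_eq l
  · rw [ps_intercept hφ.isOpen hφ.smooth hg.2]
    simp only [metricForm, SphFinsler.intercept]; field_simp; ring

theorem IsGivenBy.dY_energy_hasX (hg : Gen M x y) (l : Fin n) :
    HasX (dY l (energy F)) x y (fun u =>
      2 * (pr φ ‖x‖ (sval x y) * (inner ℝ x u / ‖x‖) + ps φ ‖x‖ (sval x y) * (inner ℝ y u / ‖y‖)) *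
        (‖y‖ * ps φ ‖x‖ (sval x y) * inner ℝ x (EuclideanSpace.single l 1) +
          intercept φ ‖x‖ (sval x y) * inner ℝ y (EuclideanSpace.single l 1)) +
      2 * φ ‖x‖ (sval x y) *
        (‖y‖ * (ps (pr φ) ‖x‖ (sval x y) * (inner ℝ x u / ‖x‖) +
            ps (ps φ) ‖x‖ (sval x y) * (inner ℝ y u / ‖y‖)) *
            inner ℝ x (EuclideanSpace.single l 1) +
          ‖y‖ * ps φ ‖x‖ (sval x y) * inner ℝ (EuclideanSpace.single l 1) u +
          ((pr φ ‖x‖ (sval x y) - sval x y * ps (pr φ) ‖x‖ (sval x y)) * (inner ℝ x u / ‖x‖) -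
            sval x y * ps (ps φ) ‖x‖ (sval x y) * (inner ℝ y u / ‖y‖)) *
            inner ℝ y (EuclideanSpace.single l 1))) := by
  have hD := region_isOpen hφ.isOpen
  have hy := hg.norm_pos_right
  have hx := hg.norm_pos_left
  set w : E n := EuclideanSpace.single l 1
  have h1 := HasX.comp_region hφ.isOpen hφ.smooth hg
  have h2 := HasX.comp_region hφ.isOpen (hφ.smooth.ps hD) hg
  have h3 := HasX.comp_region hφ.isOpen (SmoothOn.intercept hφ.isOpen hφ.smooth) hg
  have h4 := ((HasX.const (x := x) (y := y) (fun _ => (2 : ℝ))).mul h1).mul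
    ((((HasX.const (x := x) (y := y) (fun y => ‖y‖)).mul h2).mul (HasX.inner_const w)).add
      (h3.mul (HasX.const (x := x) (y := y) (fun y => inner ℝ y w))))
  refine (h4.congr_of_eventually ?_).congr fun u => ?_
  · filter_upwards [hg.eventually_left hφ.isOpen] with z hz
    exact (hφ.energy_hasY hz).dY_eq l
  · rw [ps_intercept hφ.isOpen hφ.smooth hg.2, pr_intercept hφ.isOpen hφ.smooth hg.2,
      hφ.smooth.pr_ps_comm hD hg.2]
    field_simp; ring

theorem IsGivenBy.fundTensor_eq (hg : Gen M x y) (i j : Fin n) :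
    fundTensor F x y i j =
      metricForm φ x y (EuclideanSpace.single i 1) (EuclideanSpace.single j 1) := by
  rw [fundTensor, Matrix.of_apply, (hφ.dY_energy_hasY hg j).dY_eq i, metricForm_comm]; ring

theorem IsGivenBy.sum_metricForm (hg : Gen M x y) (u v : E n) :
    ∑ k, v k * metricForm φ x y u (EuclideanSpace.single k 1) = metricForm φ x y u v := by
  have key : ∀ (l : Fin n) (v : E n), ∑ k, v k * metricForm φ x y (EuclideanSpace.single l 1)
      (EuclideanSpace.single k 1) = metricForm φ x y (EuclideanSpace.single l 1) v := by
    intro l v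
    have := (hφ.dY_energy_hasY hg l).sum_eq v
    rw [← mul_right_inj' (two_ne_zero (α := ℝ)), ← this, Finset.mul_sum]
    exact Finset.sum_congr rfl fun k _ => by ring
  have hlin : ∀ w : E n, (∑ k, u k * metricForm φ x y (EuclideanSpace.single k 1) w) =
      metricForm φ x y u w := by
    intro w
    have hx : ∑ k, u k * inner ℝ x (EuclideanSpace.single k 1) = inner ℝ x u := by
      simpa using sum_mul_clm (innerSL ℝ x) u
    have hy : ∑ k, u k * inner ℝ y (EuclideanSpace.single k 1) = inner ℝ y u := by
      simpa using sum_mul_clm (innerSL ℝ y) u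
    have hw : ∑ k, u k * inner ℝ (EuclideanSpace.single k 1) w = inner ℝ u w := by
      have := sum_mul_clm (innerSL ℝ w) u
      simp only [innerSL_apply_apply] at this
      rw [real_inner_comm, ← this]
      simp only [real_inner_comm w]
    simp only [metricForm]
    rw [← hx, ← hy, ← hw]
    simp only [Finset.mul_sum, Finset.sum_mul, Finset.sum_div, ← Finset.sum_add_distrib,
      ← Finset.sum_sub_distrib, mul_add, add_mul, mul_sub, sub_mul]
    refine Finset.sum_congr rfl fun k _ => ?_
    ring
  calc ∑ k, v k * metricForm φ x y u (EuclideanSpace.single k 1)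
      = ∑ k, ∑ l, v k * (u l * metricForm φ x y (EuclideanSpace.single l 1)
          (EuclideanSpace.single k 1)) := by
        refine Finset.sum_congr rfl fun k _ => ?_
        rw [← hlin, Finset.mul_sum]
    _ = ∑ l, u l * metricForm φ x y (EuclideanSpace.single l 1) v := by
        rw [Finset.sum_comm]
        refine Finset.sum_congr rfl fun l _ => ?_
        rw [← key, Finset.mul_sum]
        exact Finset.sum_congr rfl fun k _ => by ring
    _ = metricForm φ x y u v := hlin v

theorem IsGivenBy.gInner_eq (hg : Gen M x y) (u v : E n) :
    gInner F x y u v = metricForm φ x y u v := by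
  rw [gInner, metricForm_comm, ← hφ.sum_metricForm hg v u]
  refine Finset.sum_congr rfl fun i _ => ?_
  rw [metricForm_comm, ← hφ.sum_metricForm hg _ v, Finset.mul_sum]
  refine Finset.sum_congr rfl fun j _ => ?_
  rw [hφ.fundTensor_eq hg]; ring

theorem IsGivenBy.mulVec_eq (hg : Gen M x y) (v : E n) (i : Fin n) :
    (fundTensor F x y).mulVec v i = metricForm φ x y (EuclideanSpace.single i 1) v := by
  rw [← hφ.sum_metricForm hg, Matrix.mulVec, dotProduct]
  refine Finset.sum_congr rfl fun j _ => ?_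
  rw [hφ.fundTensor_eq hg]; ring

theorem IsGivenBy.metricForm_pos (hF : IsFinslerMetric M F) (hg : Gen M x y) {u : E n}
    (hu : u ≠ 0) : 0 < metricForm φ x y u u := by
  have hpd := hF.posDef x (hφ.mem x hg.2.1) y hg.1
  have hu' : (u : Fin n → ℝ) ≠ 0 := fun h => hu (by ext i; simpa using congrFun h i)
  have h1 := hpd.dotProduct_mulVec_pos hu'
  rw [← hφ.gInner_eq hg]
  refine lt_of_lt_of_eq h1 ?_
  rw [dotProduct, gInner]
  refine Finset.sum_congr rfl fun i _ => ?_
  rw [Matrix.mulVec, dotProduct, Finset.mul_sum]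
  refine Finset.sum_congr rfl fun j _ => ?_
  simp only [Pi.star_apply, star_trivial]
  ring

theorem IsGivenBy.pos (hn : 3 ≤ n) (hF : IsFinslerMetric M F) {r s : ℝ}
    (hp : (r, s) ∈ region M) : 0 < φ r s := by
  obtain ⟨x, y, e, hg, rfl, hy, rfl, -⟩ := exists_gen_frame hn hp
  have := hF.pos x (hφ.mem x hg.2.1) y hg.1
  rwa [hφ.eq _ _ hg, hy, one_mul] at this

/-- On a unit vector orthogonal to x and y the fundamental form equals φ(φ - sφ_s). -/
theorem IsGivenBy.intercept_pos (hn : 3 ≤ n) (hF : IsFinslerMetric M F) {r s : ℝ}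
    (hp : (r, s) ∈ region M) : 0 < intercept φ r s := by
  have hφ0 := hφ.pos hn hF hp
  obtain ⟨x, y, e, hg, rfl, hy, rfl, he, hxe, hye⟩ := exists_gen_frame hn hp
  have h1 := hφ.metricForm_pos hF hg (u := e) (by rw [← norm_pos_iff, he]; exact one_pos)
  simp only [metricForm, hxe, hye, real_inner_self_eq_norm_sq, he] at h1
  ring_nf at h1
  exact pos_of_mul_pos_left h1 hφ0.le

/-- The vector `u` with `g_y(y, u) = 0` in the span of `x` and `y`, for `|y| = 1`. -/
theorem IsGivenBy.exists_normal (hn : 3 ≤ n) (hF : IsFinslerMetric M F) (hg : Gen M x y)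
    (hy : ‖y‖ = 1) :
    ∃ u : E n, u = x - (sval x y + (‖x‖ ^ 2 - sval x y ^ 2) * ps φ ‖x‖ (sval x y) /
        φ ‖x‖ (sval x y)) • y ∧ u ≠ 0 ∧ metricForm φ x y y u = 0 ∧
      metricForm φ x y u u = φ ‖x‖ (sval x y) * (‖x‖ ^ 2 - sval x y ^ 2) *
        (intercept φ ‖x‖ (sval x y) +
          (‖x‖ ^ 2 - sval x y ^ 2) * ps (ps φ) ‖x‖ (sval x y)) := by
  have hφ0 := hφ.pos hn hF hg.2
  have hρ := region_rho_pos hg.2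
  have hxy := hg.inner_eq
  have hyx : inner ℝ y x = sval x y := by rw [real_inner_comm, hxy, hy, mul_one]
  rw [hy, mul_one] at hxy
  refine ⟨_, rfl, ?_, ?_, ?_⟩
  -- If u = 0, then x is a multiple of y; pairing with y shows the factor is s, and pairing with x
  -- gives r² = s², which is excluded in the region.
  · intro h0
    have h2 := sub_eq_zero.1 h0
    have h3 := congrArg (fun v => inner ℝ x v) h2
    have h4 := congrArg (fun v => inner ℝ y v) h2
    simp only [inner_smul_right, real_inner_self_eq_norm_sq, hxy, hyx, hy] at h3 h4
    rw [one_pow, mul_one] at h4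
    rw [← h4] at h3
    linarith
  · simp only [metricForm, inner_sub_right, inner_smul_right, hxy, hyx, hy,
      real_inner_self_eq_norm_sq, SphFinsler.intercept]
    field_simp; ring
  · simp only [metricForm, inner_sub_right, inner_sub_left, inner_smul_left, inner_smul_right,
      hxy, hyx, hy, real_inner_self_eq_norm_sq, SphFinsler.intercept]
    simp
    field_simp; ring

/-- On the g_y-normal u to y in span {x, y}, the fundamental form is φρ times the quantity in
question. -/
theorem IsGivenBy.lambda_pos (hn : 3 ≤ n) (hF : IsFinslerMetric M F) {r s : ℝ}
    (hp : (r, s) ∈ region M) :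
    0 < intercept φ r s + (r ^ 2 - s ^ 2) * ps (ps φ) r s := by
  have hφ0 := hφ.pos hn hF hp
  have hρ := region_rho_pos hp
  obtain ⟨x, y, e, hg, rfl, hy, rfl, -⟩ := exists_gen_frame hn hp
  obtain ⟨u, -, hu, -, h2⟩ := hφ.exists_normal hn hF hg hy
  have h3 := hφ.metricForm_pos hF hg hu
  rw [h2] at h3
  exact pos_of_mul_pos_right h3 (by positivity)

end Metric

/-! ### The geodesic coefficients in terms of P and Q -/

section Spray

variable {n : ℕ} {M : Set (E n)} {x y : E n} {φ P Q : ℝ → ℝ → ℝ} {F : E n → E n → ℝ}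

/-- `φ` defines a metric of positive definite type at generic points. -/
structure IsPositive (M : Set (E n)) (φ : ℝ → ℝ → ℝ) : Prop where
  isOpen : IsOpen (radii M)
  smooth : SmoothOn φ (region M)
  pos : ∀ {r s : ℝ}, (r, s) ∈ region M → 0 < φ r s
  intercept_pos : ∀ {r s : ℝ}, (r, s) ∈ region M → 0 < intercept φ r s
  lambda_pos : ∀ {r s : ℝ}, (r, s) ∈ region M →
    0 < φ r s - s * ps φ r s + (r ^ 2 - s ^ 2) * ps (ps φ) r s

theorem IsGivenBy.isPositive (hn : 3 ≤ n) (hF : IsFinslerMetric M F) (hφ : IsGivenBy M F φ) :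
    IsPositive M φ :=
  ⟨hφ.isOpen, hφ.smooth, fun hp => hφ.pos hn hF hp, fun hp => hφ.intercept_pos hn hF hp,
    fun hp => hφ.lambda_pos hn hF hp⟩

theorem IsPositive.coefQ_eq (hφ : IsPositive M φ) {r s : ℝ} (hp : (r, s) ∈ region M) :
    2 * r * coefQ φ r s * (φ r s - s * ps φ r s + (r ^ 2 - s ^ 2) * ps (ps φ) r s) =
      r * ps (ps φ) r s - pr φ r s + s * ps (pr φ) r s := by
  have h1 := (hφ.lambda_pos hp).ne'
  have h2 := (region_pos hp).ne'
  rw [coefQ, mul_assoc, mul_assoc (1 / (2 * r)), div_mul_cancel₀ _ h1]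
  field_simp

theorem IsPositive.coefP_eq (hφ : IsPositive M φ) {r s : ℝ} (hp : (r, s) ∈ region M) :
    2 * r * (coefP φ r s * φ r s + coefQ φ r s * (s * φ r s + (r ^ 2 - s ^ 2) * ps φ r s)) =
      r * ps φ r s + s * pr φ r s := by
  have h1 := (hφ.pos hp).ne'
  have h2 := (region_pos hp).ne'
  rw [coefP]; field_simp; ring

theorem IsPositive.coefQ_smooth (hφ : IsPositive M φ) : SmoothOn (coefQ φ) (region M) := by
  have hD := region_isOpen hφ.isOpen
  have h1 := hφ.smooth.ps hD
  have h2 := h1.ps hD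
  have h3 := hφ.smooth.pr hD
  have h4 := h3.ps hD
  exact ((smoothOn_const 1).div ((smoothOn_const 2).mul smoothOn_fst)
    fun r s hp => mul_ne_zero two_ne_zero (region_pos hp).ne').mul
    ((((smoothOn_fst.mul h2).sub h3).add (smoothOn_snd.mul h4)).div
      ((hφ.smooth.sub (smoothOn_snd.mul h1)).add (smoothOn_rho.mul h2))
      fun r s hp => (hφ.lambda_pos hp).ne')

theorem IsPositive.coefP_smooth (hφ : IsPositive M φ) : SmoothOn (coefP φ) (region M) := by
  have hD := region_isOpen hφ.isOpen
  have h1 := hφ.smooth.ps hD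
  have h3 := hφ.smooth.pr hD
  have hQ := hφ.coefQ_smooth
  exact (((smoothOn_fst.mul h1).add (smoothOn_snd.mul h3)).div
      (((smoothOn_const 2).mul smoothOn_fst).mul hφ.smooth)
      fun r s hp => mul_ne_zero (mul_ne_zero two_ne_zero (region_pos hp).ne') (hφ.pos hp).ne').sub
    ((hQ.div hφ.smooth fun r s hp => (hφ.pos hp).ne').mul
      ((smoothOn_snd.mul hφ.smooth).add (smoothOn_rho.mul h1)))

theorem sum_mul_self_eq (x : E n) : ∑ k, x k * x k = ‖x‖ ^ 2 := by
  rw [EuclideanSpace.norm_sq_eq]; simp [sq]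

theorem Gen.sum_mul_eq (hg : Gen M x y) : ∑ k, x k * y k = sval x y * ‖y‖ := by
  rw [← hg.inner_eq, PiLp.inner_apply]; simp [mul_comm]

/-- The fundamental tensor is not inverted explicitly. The proposed vector G is lowered with g_y and
compared with the bracket in the definition of the spray; invertibility from positive definiteness
does the rest. The comparison uses only the defining relations of P and Q. -/
theorem IsGivenBy.spray_eq (hφ : IsGivenBy M F φ) (hp : IsPositive M φ)
    (hF : IsFinslerMetric M F) (hg : Gen M x y) (i : Fin n) :
    spray F i x y = ‖y‖ * coefP φ ‖x‖ (sval x y) * y i +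
      ‖y‖ ^ 2 * coefQ φ ‖x‖ (sval x y) * x i := by
  have hr := hg.norm_pos_left
  have hN := hg.norm_pos_right
  have hxy := hg.inner_eq
  have hyx : inner ℝ y x = sval x y * ‖y‖ := by rw [real_inner_comm, hxy]
  have hQ := hp.coefQ_eq hg.2
  have hP := hp.coefP_eq hg.2
  set r := ‖x‖ with hr_def
  set N := ‖y‖ with hN_def
  set s := sval x y with hs_def
  set P := coefP φ r s
  set Q := coefQ φ r s
  set G : E n := (N * P) • y + (N ^ 2 * Q) • x with hG
  have key : ∀ l : Fin n, (∑ k, dX k (dY l (energy F)) x y * y k) - dX l (energy F) x y =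
      4 * metricForm φ x y (EuclideanSpace.single l 1) G := by
    intro l
    have e1 : ∀ k, dX k (dY l (energy F)) x y * y k = y k * _ := fun k => by
      rw [(hφ.dY_energy_hasX hg l).dX_eq k, mul_comm]
    simp only [e1]
    rw [(hφ.dY_energy_hasX hg l).sum_eq y, (hφ.energy_hasX hg).dX_eq l]
    set w : E n := EuclideanSpace.single l 1
    obtain ⟨η, hη⟩ : ∃ η : ℝ, inner ℝ y w = η * N := ⟨inner ℝ y w / N, by field_simp⟩
    have hwy : inner ℝ w y = η * N := by rw [real_inner_comm, hη]
    have hxG : inner ℝ x G = N ^ 2 * P * s + N ^ 2 * Q * r ^ 2 := by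
      rw [hG, inner_add_right, inner_smul_right, inner_smul_right, hxy,
        real_inner_self_eq_norm_sq]; ring
    have hyG : inner ℝ y G = (N ^ 2 * P + N ^ 2 * Q * s) * N := by
      rw [hG, inner_add_right, inner_smul_right, inner_smul_right, hyx,
        real_inner_self_eq_norm_sq]; ring
    have hwG : inner ℝ w G = N ^ 2 * P * η + N ^ 2 * Q * inner ℝ x w := by
      rw [hG, inner_add_right, inner_smul_right, inner_smul_right, hwy, real_inner_comm]; ring
    simp only [metricForm, ← hr_def, ← hN_def, ← hs_def, hη, hwy, hxG, hyG, hwG, hxy,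
      real_inner_self_eq_norm_sq, intercept]
    rw [mul_div_cancel_right₀ _ hN.ne', mul_div_cancel_right₀ _ hN.ne', sq N,
      mul_div_cancel_right₀ _ hN.ne', ← sq N]
    have h1 : P * φ r s + Q * (s * φ r s + (r ^ 2 - s ^ 2) * ps φ r s) =
        (s * pr φ r s / r + ps φ r s) / 2 := by
      field_simp; linear_combination hP
    have h2 : Q * (φ r s - s * ps φ r s + (r ^ 2 - s ^ 2) * ps (ps φ) r s) =
        (s * ps (pr φ) r s / r + ps (ps φ) r s - pr φ r s / r) / 2 := by
      field_simp; linear_combination hQ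
    linear_combination
      -4 * N ^ 2 * (ps φ r s * inner ℝ x w + (φ r s - s * ps φ r s) * η) * h1
      - 4 * N ^ 2 * φ r s * (inner ℝ x w - s * η) * h2
  have hunit : IsUnit (fundTensor F x y).det := by
    rw [← Matrix.isUnit_iff_isUnit_det]
    exact (hF.posDef x (hφ.mem x hg.2.1) y hg.1).isUnit
  have h3 : ∑ l, (fundTensor F x y)⁻¹ i l *
      ((∑ k, dX k (dY l (energy F)) x y * y k) - dX l (energy F) x y) = 4 * G i := by
    have h4 : ((fundTensor F x y)⁻¹.mulVec ((fundTensor F x y).mulVec G)) i = G i := by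
      rw [Matrix.mulVec_mulVec, Matrix.nonsing_inv_mul _ hunit, Matrix.one_mulVec]
    rw [← h4, Matrix.mulVec, dotProduct, Finset.mul_sum]
    refine Finset.sum_congr rfl fun l _ => ?_
    rw [key, hφ.mulVec_eq hg]; ring
  rw [spray, h3, hG]
  simp

/-- The `i`-th component of `|y| P y + |y|² Q x`. -/
noncomputable def sprayForm (P Q : ℝ → ℝ → ℝ) (i : Fin n) (x y : E n) : ℝ :=
  ‖y‖ * P ‖x‖ (sval x y) * y i + ‖y‖ ^ 2 * Q ‖x‖ (sval x y) * x i

theorem HasY.coord (i : Fin n) : HasY (fun _ y => y i) x y (fun u => u i) :=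
  ⟨EuclideanSpace.proj i, (EuclideanSpace.proj (𝕜 := ℝ) i).hasFDerivAt, fun _ => rfl⟩

theorem HasX.coord (i : Fin n) : HasX (fun x _ => x i) x y (fun u => u i) :=
  ⟨EuclideanSpace.proj i, (EuclideanSpace.proj (𝕜 := ℝ) i).hasFDerivAt, fun _ => rfl⟩

theorem HasY.sprayForm (hI : IsOpen (radii M)) (hP : SmoothOn P (region M))
    (hQ : SmoothOn Q (region M)) (hg : Gen M x y) (i : Fin n) :
    HasY (sprayForm P Q i) x y (fun u =>
      y i * (ps P ‖x‖ (sval x y) * inner ℝ x u +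
        intercept P ‖x‖ (sval x y) * (inner ℝ y u / ‖y‖)) +
      ‖y‖ * P ‖x‖ (sval x y) * u i +
      ‖y‖ * x i * (ps Q ‖x‖ (sval x y) * inner ℝ x u +
        (2 * Q ‖x‖ (sval x y) - sval x y * ps Q ‖x‖ (sval x y)) * (inner ℝ y u / ‖y‖))) := by
  have hN := hg.norm_pos_right
  have h1 := HasY.norm (x := x) hg.1
  have h2 := (h1.mul (HasY.comp_region hI hP hg)).mul (HasY.coord i)
  have h3 := ((h1.mul h1).mul (HasY.comp_region hI hQ hg)).mul
    (HasY.const (x := x) (y := y) (fun x => x i))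
  refine ((h2.add h3).congr_of_eventually ?_).congr fun u => ?_
  · exact Filter.Eventually.of_forall fun z => by simp only [SphFinsler.sprayForm]; ring
  · simp only [SphFinsler.intercept]; field_simp; ring

theorem HasX.sprayForm (hI : IsOpen (radii M)) (hP : SmoothOn P (region M))
    (hQ : SmoothOn Q (region M)) (hg : Gen M x y) (i : Fin n) :
    HasX (sprayForm P Q i) x y (fun u =>
      ‖y‖ * y i * (pr P ‖x‖ (sval x y) * (inner ℝ x u / ‖x‖) +
        ps P ‖x‖ (sval x y) * (inner ℝ y u / ‖y‖)) +
      ‖y‖ ^ 2 * x i * (pr Q ‖x‖ (sval x y) * (inner ℝ x u / ‖x‖) +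
        ps Q ‖x‖ (sval x y) * (inner ℝ y u / ‖y‖)) +
      ‖y‖ ^ 2 * Q ‖x‖ (sval x y) * u i) := by
  have h1 := HasX.const (x := x) (y := y) (fun y => ‖y‖)
  have h2 := (h1.mul (HasX.comp_region hI hP hg)).mul
    (HasX.const (x := x) (y := y) (fun y => y i))
  have h3 := ((h1.mul h1).mul (HasX.comp_region hI hQ hg)).mul (HasX.coord i)
  refine ((h2.add h3).congr_of_eventually ?_).congr fun u => ?_
  · exact Filter.Eventually.of_forall fun z => by simp only [SphFinsler.sprayForm]; ring
  · ring

theorem sum_dY_sprayForm (hI : IsOpen (radii M)) (hP : SmoothOn P (region M))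
    (hQ : SmoothOn Q (region M)) (hg : Gen M x y) :
    ∑ m, dY m (sprayForm P Q m) x y = ‖y‖ * ((n + 1) * P ‖x‖ (sval x y) +
      2 * sval x y * Q ‖x‖ (sval x y) +
      (‖x‖ ^ 2 - sval x y ^ 2) * ps Q ‖x‖ (sval x y)) := by
  have hN := hg.norm_pos_right
  have e : ∀ m : Fin n, dY m (sprayForm P Q m) x y =
      (ps P ‖x‖ (sval x y) + (2 * Q ‖x‖ (sval x y) - sval x y * ps Q ‖x‖ (sval x y))) *
        (x m * y m) + intercept P ‖x‖ (sval x y) / ‖y‖ * (y m * y m) +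
      ‖y‖ * P ‖x‖ (sval x y) + ‖y‖ * ps Q ‖x‖ (sval x y) * (x m * x m) := by
    intro m
    rw [(HasY.sprayForm hI hP hQ hg m).dY_eq m]
    simp only [EuclideanSpace.inner_single_right]
    simp
    field_simp; ring
  simp only [e, Finset.sum_add_distrib, ← Finset.mul_sum, sum_mul_self_eq, hg.sum_mul_eq]
  simp only [intercept]
  simp
  field_simp; ring

end Spray

/-! ### Vanishing Douglas curvature makes Q quadratic in s -/

section Douglas

variable {n : ℕ} {M : Set (E n)} {φ : ℝ → ℝ → ℝ} {F : E n → E n → ℝ}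

theorem contDiffOn_dY {f : E n → E n → ℝ} {x : E n} {S : Set (E n)} (hS : IsOpen S)
    (hf : ContDiffOn ℝ ∞ (f x) S) (k : Fin n) : ContDiffOn ℝ ∞ (dY k f x) S :=
  (ContDiffOn.fderiv_of_isOpen (m := ∞) hf hS (by simp)).clm_apply contDiffOn_const

theorem hasDerivAt_dY {f : E n → E n → ℝ} {x y : E n} {S : Set (E n)} (hS : IsOpen S)
    (hf : ContDiffOn ℝ ∞ (f x) S) (k : Fin n) {t : ℝ}
    (ht : y + t • EuclideanSpace.single k (1 : ℝ) ∈ S) :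
    HasDerivAt (fun t : ℝ => f x (y + t • EuclideanSpace.single k (1 : ℝ)))
      (dY k f x (y + t • EuclideanSpace.single k (1 : ℝ))) t := by
  have h1 : DifferentiableAt ℝ (f x) (y + t • EuclideanSpace.single k (1 : ℝ)) :=
    (hf.contDiffAt (hS.mem_nhds ht)).differentiableAt (by simp)
  have h2 : HasDerivAt (fun t : ℝ => y + t • EuclideanSpace.single k (1 : ℝ))
      (EuclideanSpace.single k (1 : ℝ)) t := by
    simpa using ((hasDerivAt_id t).smul_const (EuclideanSpace.single k (1 : ℝ))).const_add y
  exact h1.hasFDerivAt.comp_hasDerivAt t h2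

theorem eq_quadratic_of_hasDerivAt {f f₁ f₂ : ℝ → ℝ} (h : ∀ t, HasDerivAt f (f₁ t) t)
    (h₁ : ∀ t, HasDerivAt f₁ (f₂ t) t) (h₂ : ∀ t, HasDerivAt f₂ 0 t) (t : ℝ) :
    f t = f 0 + f₁ 0 * t + f₂ 0 / 2 * t ^ 2 := by
  have c : ∀ g : ℝ → ℝ, (∀ t, HasDerivAt g 0 t) → ∀ t, g t = g 0 := fun g hg t =>
    is_const_of_deriv_eq_zero (fun t => (hg t).differentiableAt) (fun t => (hg t).deriv) t 0
  have e2 := c f₂ h₂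
  have e1 := c (fun t => f₁ t - f₂ 0 * t) fun t => by
    have := (h₁ t).sub ((hasDerivAt_id t).const_mul (f₂ 0))
    exact this.congr_deriv (by simp [e2 t])
  have e0 := c (fun t => f t - f₁ 0 * t - f₂ 0 / 2 * t ^ 2) fun t => by
    have := ((h t).sub ((hasDerivAt_id t).const_mul (f₁ 0))).sub
      (((hasDerivAt_id t).pow 2).const_mul (f₂ 0 / 2))
    have e1' := e1 t
    simp only [mul_zero, sub_zero] at e1'
    refine this.congr_deriv ?_
    simp only [id_eq, Nat.cast_ofNat, mul_one]
    linear_combination e1'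
  have := e0 t
  simp at this
  linear_combination this

/-- The trace-free part `|y|² Q x - |y| C y` of the spray. -/
noncomputable def traceFree (Q C : ℝ → ℝ → ℝ) (i : Fin n) (x y : E n) : ℝ :=
  ‖y‖ ^ 2 * Q ‖x‖ (sval x y) * x i - ‖y‖ * C ‖x‖ (sval x y) * y i

theorem contDiffOn_traceFree (hI : IsOpen (radii M)) {Q C : ℝ → ℝ → ℝ}
    (hQ : SmoothOn Q (region M)) (hC : SmoothOn C (region M)) (i : Fin n) (x : E n) :
    ContDiffOn ℝ ∞ (traceFree Q C i x) {y | Gen M x y} := by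
  intro y hy
  refine ContDiffAt.contDiffWithinAt ?_
  have hD := region_isOpen hI
  have hn : ContDiffAt ℝ ∞ (fun y : E n => ‖y‖) y := contDiffAt_norm ℝ hy.1
  have hs : ContDiffAt ℝ ∞ (fun y : E n => (‖x‖, sval x y)) y := by
    refine contDiffAt_const.prodMk ?_
    exact ContDiffAt.div (contDiffAt_const.inner ℝ contDiffAt_id) hn hy.norm_pos_right.ne'
  have h1 : ContDiffAt ℝ ∞ (fun y : E n => Q ‖x‖ (sval x y)) y :=
    ContDiffAt.comp (g := fun p : ℝ × ℝ => Q p.1 p.2) y (hQ.contDiffAt hD hy.2) hs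
  have h2 : ContDiffAt ℝ ∞ (fun y : E n => C ‖x‖ (sval x y)) y :=
    ContDiffAt.comp (g := fun p : ℝ × ℝ => C p.1 p.2) y (hC.contDiffAt hD hy.2) hs
  have h3 : ContDiffAt ℝ ∞ (fun y : E n => y i) y :=
    (EuclideanSpace.proj (𝕜 := ℝ) i).contDiff.contDiffAt
  exact (((hn.pow 2).mul h1).mul contDiffAt_const).sub ((hn.mul h2).mul h3)

theorem dY_congr {f g : E n → E n → ℝ} {x : E n} {S : Set (E n)} (hS : IsOpen S)
    (hfg : ∀ y ∈ S, f x y = g x y) (k : Fin n) : ∀ y ∈ S, dY k f x y = dY k g x y := by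
  intro y hy
  have : f x =ᶠ[nhds y] g x := Filter.eventually_of_mem (hS.mem_nhds hy) hfg
  exact congrArg (fun L : E n →L[ℝ] ℝ => L (EuclideanSpace.single k 1)) this.fderiv_eq

theorem gen_isOpen (hI : IsOpen (radii M)) (x : E n) : IsOpen {y | Gen M x y} :=
  isOpen_iff_mem_nhds.2 fun _ hy => Gen.eventually_right hI hy

/-- The divergence of |y| P y is (n + 1)|y| P, so subtracting the trace removes P: the Douglas
tensor depends on Q alone. -/
theorem IsGivenBy.douglas_eq (hφ : IsGivenBy M F φ) (hp : IsPositive M φ)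
    (hF : IsFinslerMetric M F) {x y : E n} (hg : Gen M x y) (i k : Fin n) :
    douglas F i k k k x y = dY k (dY k (dY k (traceFree (coefQ φ) (fun r s =>
      1 / ((n : ℝ) + 1) * (2 * s * coefQ φ r s + (r ^ 2 - s ^ 2) * ps (coefQ φ) r s)) i))) x y := by
  have hS := gen_isOpen (M := M) hφ.isOpen x
  rw [douglas]
  refine dY_congr hS (dY_congr hS (dY_congr hS ?_ k) k) k y hg
  intro z hz
  have e1 : ∀ m, ∀ v ∈ {y | Gen M x y}, spray F m x v = sprayForm (coefP φ) (coefQ φ) m x v :=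
    fun m v hv => hφ.spray_eq hp hF hv m
  have e2 : ∀ m, dY m (spray F m) x z = dY m (sprayForm (coefP φ) (coefQ φ) m) x z :=
    fun m => dY_congr hS (e1 m) m z hz
  simp only [e2]
  rw [sum_dY_sprayForm hφ.isOpen hp.coefP_smooth hp.coefQ_smooth hz, e1 i z hz]
  simp only [sprayForm, traceFree]
  have : (n : ℝ) + 1 ≠ 0 := by positivity
  field_simp; ring

/-- Move y along t ↦ y + t e₂, with e₂ orthogonal to x and y and |y| = 1. Then |x| and ⟨x, y⟩ stay
fixed while |y| = √(1 + t²), so s is scaled by κ = (1 + t²)^(-1/2). Each trace-free component has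
zero third derivative in t and is a quadratic polynomial. The component along e₁, where x has no
part, determines the C term; the component along e₀ then determines (1 + t²) Q. -/
theorem IsGivenBy.coefQ_scaling (hn : 3 ≤ n) (hφ : IsGivenBy M F φ) (hp : IsPositive M φ)
    (hF : IsFinslerMetric M F) (hD : IsDouglas M F) {r s : ℝ} (hrs : (r, s) ∈ region M) :
    ∃ α β : ℝ, ∀ κ : ℝ, 0 < κ → κ ≤ 1 → coefQ φ r (κ * s) = α + β * κ ^ 2 := by
  have hr := region_pos hrs
  have hρ := region_rho_pos hrs
  have hI := hφ.isOpen
  set i₀ : Fin n := ⟨0, by omega⟩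
  set i₁ : Fin n := ⟨1, by omega⟩
  set i₂ : Fin n := ⟨2, by omega⟩
  have h01 : i₀ ≠ i₁ := by simp [i₀, i₁]
  have h02 : i₀ ≠ i₂ := by simp [i₀, i₂]
  have h12 : i₁ ≠ i₂ := by simp [i₁, i₂]
  have hpos : 0 < 1 - (s / r) ^ 2 := by
    have : 1 - (s / r) ^ 2 = (r ^ 2 - s ^ 2) / r ^ 2 := by field_simp
    rw [this]; positivity
  set τ := Real.sqrt (1 - (s / r) ^ 2) with hτ
  have hτ0 : 0 < τ := Real.sqrt_pos.2 hpos
  have hτ2 : τ ^ 2 = 1 - (s / r) ^ 2 := Real.sq_sqrt hpos.le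
  let x : E n := r • EuclideanSpace.single i₀ 1
  let y : E n := (s / r) • EuclideanSpace.single i₀ 1 + τ • EuclideanSpace.single i₁ 1
  let yt : ℝ → E n := fun t => y + t • EuclideanSpace.single i₂ (1 : ℝ)
  have hx : ‖x‖ = r := by simp [x, norm_smul, abs_of_pos hr]
  have hx0 : x i₀ = r := by simp [x]
  have hx1 : x i₁ = 0 := by simp [x, h01.symm]
  have hy0 : ∀ t, yt t i₀ = s / r := fun t => by simp [yt, y, h01, h02]
  have hy1 : ∀ t, yt t i₁ = τ := fun t => by simp [yt, y, h01.symm, h12]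
  have hyn2 : ∀ t, ‖yt t‖ ^ 2 = 1 + t ^ 2 := by
    intro t
    rw [← real_inner_self_eq_norm_sq]
    simp only [yt, y, inner_add_left, inner_add_right, inner_smul_left, inner_smul_right,
      EuclideanSpace.inner_single_left]
    simp [h01, h02, h12, h01.symm, h02.symm, h12.symm]
    linear_combination hτ2
  have hyn : ∀ t, ‖yt t‖ = Real.sqrt (1 + t ^ 2) := fun t => by
    rw [← hyn2, Real.sqrt_sq (norm_nonneg _)]
  have hyn0 : ∀ t, 0 < ‖yt t‖ := fun t => by rw [hyn]; positivity
  have hs : ∀ t, sval x (yt t) = s / ‖yt t‖ := by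
    intro t
    have : inner ℝ x (yt t) = s := by
      simp only [x, inner_smul_left, EuclideanSpace.inner_single_left]
      rw [hy0]; simp; field_simp
    rw [sval, this]
  have hone : ∀ t, 1 ≤ ‖yt t‖ := fun t => by
    rw [hyn]; exact Real.one_le_sqrt.2 (by nlinarith [sq_nonneg t])
  have hgen : ∀ t, Gen M x (yt t) := by
    intro t
    refine ⟨norm_pos_iff.1 (hyn0 t), ?_⟩
    rw [hx, hs]
    refine ⟨hrs.1, ?_⟩
    have : |s / ‖yt t‖| ≤ |s| := by
      rw [abs_div, abs_norm]; exact div_le_self (abs_nonneg _) (hone t)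
    exact lt_of_le_of_lt this hrs.2
  set C : ℝ → ℝ → ℝ := fun r s =>
    1 / ((n : ℝ) + 1) * (2 * s * coefQ φ r s + (r ^ 2 - s ^ 2) * ps (coefQ φ) r s) with hC
  have hCs : SmoothOn C (region M) := (smoothOn_const _).mul
    ((((smoothOn_const 2).mul smoothOn_snd).mul hp.coefQ_smooth).add
      (smoothOn_rho.mul (hp.coefQ_smooth.ps (region_isOpen hI))))
  have quad : ∀ i : Fin n, ∃ a b c : ℝ, ∀ t,
      traceFree (coefQ φ) C i x (yt t) = a + b * t + c * t ^ 2 := by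
    intro i
    have hS := gen_isOpen (M := M) hI x
    have s0 := contDiffOn_traceFree hI hp.coefQ_smooth hCs i x
    have s1 := contDiffOn_dY hS s0 i₂
    have s2 := contDiffOn_dY hS s1 i₂
    refine ⟨_, _, _, eq_quadratic_of_hasDerivAt (fun t => hasDerivAt_dY hS s0 i₂ (hgen t))
      (fun t => hasDerivAt_dY hS s1 i₂ (hgen t)) fun t => ?_⟩
    have h3 := hasDerivAt_dY hS s2 i₂ (hgen t)
    rwa [← hφ.douglas_eq hp hF (hgen t),
      hD x (hφ.mem x (hgen t).2.1) _ (hgen t).1] at h3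
  obtain ⟨a₀, b₀, c₀, h₀⟩ := quad i₀
  obtain ⟨a₁, b₁, c₁, h₁⟩ := quad i₁
  simp only [traceFree, hx, hs, hx0, hx1, hy0, hy1, hyn2] at h₀ h₁
  -- All quantities depend on t only through t², so the linear coefficients vanish.
  have hev : ∀ t, ‖yt (-t)‖ = ‖yt t‖ := fun t => by rw [hyn, hyn, neg_sq]
  have hb₁ : b₁ = 0 := by
    have e1 := h₁ 1
    have e2 := h₁ (-1)
    rw [hev] at e2
    linarith
  have hb₀ : b₀ = 0 := by
    have e1 := h₀ 1
    have e2 := h₀ (-1)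
    rw [hev] at e2
    linarith
  have hC' : ∀ t, ‖yt t‖ * C r (s / ‖yt t‖) = -(a₁ + c₁ * t ^ 2) / τ := fun t => by
    have := h₁ t
    rw [hb₁] at this
    field_simp
    linear_combination -this
  have hQ' : ∀ t, (1 + t ^ 2) * coefQ φ r (s / ‖yt t‖) =
      (a₀ + c₀ * t ^ 2 - (a₁ + c₁ * t ^ 2) / τ * (s / r)) / r := fun t => by
    have := h₀ t
    rw [hb₀, hC' t] at this
    rw [eq_div_iff hr.ne']
    linear_combination this
  -- Multiplying (1 + t²) Q = A + B t² by κ² and inserting t² = κ⁻² - 1 gives Q = B + (A - B) κ².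
  refine ⟨(c₀ - c₁ / τ * (s / r)) / r,
    (a₀ - a₁ / τ * (s / r)) / r - (c₀ - c₁ / τ * (s / r)) / r, fun κ h0 h1 => ?_⟩
  have hκ : 0 ≤ (1 / κ) ^ 2 - 1 := by
    have : 1 ≤ 1 / κ := (one_le_div h0).2 h1
    nlinarith
  have ht2 : Real.sqrt ((1 / κ) ^ 2 - 1) ^ 2 = (1 / κ) ^ 2 - 1 := Real.sq_sqrt hκ
  have hn' : ‖yt (Real.sqrt ((1 / κ) ^ 2 - 1))‖ = 1 / κ := by
    rw [hyn, ht2, add_sub_cancel, Real.sqrt_sq (by positivity)]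
  have := hQ' (Real.sqrt ((1 / κ) ^ 2 - 1))
  rw [hn', ht2] at this
  have e : s / (1 / κ) = κ * s := by field_simp
  rw [e] at this
  have e3 : coefQ φ r (κ * s) = κ ^ 2 * ((1 + ((1 / κ) ^ 2 - 1)) * coefQ φ r (κ * s)) := by
    field_simp; ring
  rw [e3, this]
  field_simp; ring

/-- In `IsGivenBy.coefQ_scaling` the constants may depend on s. Letting κ → 0⁺ in the identity and
in its second κ-derivative identifies them as Q(r, 0) and ½ s² Q_ss(r, 0); then κ = 1. -/
theorem IsGivenBy.coefQ_eq_quadratic (hn : 3 ≤ n) (hφ : IsGivenBy M F φ) (hp : IsPositive M φ)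
    (hF : IsFinslerMetric M F) (hD : IsDouglas M F) {r s : ℝ} (hrs : (r, s) ∈ region M) :
    coefQ φ r s = coefQ φ r 0 + ps (ps (coefQ φ)) r 0 / 2 * s ^ 2 := by
  have hR := region_isOpen hφ.isOpen
  have hr := region_pos hrs
  have hQ := hp.coefQ_smooth
  have hmem : ∀ κ : ℝ, 0 ≤ κ → κ ≤ 1 → (r, κ * s) ∈ region M := by
    intro κ h0 h1
    refine ⟨hrs.1, ?_⟩
    have : |κ * s| ≤ |s| := by
      rw [abs_mul, abs_of_nonneg h0]; exact mul_le_of_le_one_left (abs_nonneg _) h1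
    exact lt_of_le_of_lt this hrs.2
  obtain ⟨α, β, h⟩ := hφ.coefQ_scaling hn hp hF hD hrs
  by_cases hs : s = 0
  · simp [hs]
  have hIoo : Set.Ioo (0 : ℝ) 1 ∈ nhdsWithin (0 : ℝ) (Set.Ioi 0) := Ioo_mem_nhdsGT one_pos
  have d1 : ∀ κ ∈ Set.Ioo (0 : ℝ) 1, ps (coefQ φ) r (κ * s) * s = 2 * β * κ := by
    intro κ hκ
    have h1 : HasDerivAt (fun κ => coefQ φ r (κ * s)) (ps (coefQ φ) r (κ * s) * s) κ := by
      have := (hQ.hasDerivAt_snd hR (hmem κ hκ.1.le hκ.2.le)).comp κ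
        ((hasDerivAt_id κ).mul_const s)
      exact this.congr_deriv (by simp)
    have h2 : HasDerivAt (fun κ => α + β * κ ^ 2) (2 * β * κ) κ := by
      have := (((hasDerivAt_id κ).pow 2).const_mul β).const_add α
      refine this.congr_deriv ?_
      simp; ring
    refine h1.unique (h2.congr_of_eventuallyEq ?_)
    filter_upwards [isOpen_Ioo.mem_nhds hκ] with κ hκ
    exact h κ hκ.1 hκ.2.le
  have d2 : ∀ κ ∈ Set.Ioo (0 : ℝ) 1, ps (ps (coefQ φ)) r (κ * s) * s * s = 2 * β := by
    intro κ hκ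
    have h1 : HasDerivAt (fun κ => ps (coefQ φ) r (κ * s) * s)
        (ps (ps (coefQ φ)) r (κ * s) * s * s) κ := by
      have := ((((hQ.ps hR).hasDerivAt_snd hR (hmem κ hκ.1.le hκ.2.le)).comp κ
        ((hasDerivAt_id κ).mul_const s))).mul_const s
      exact this.congr_deriv (by simp)
    have h2 : HasDerivAt (fun κ => 2 * β * κ) (2 * β) κ := by
      simpa using (hasDerivAt_id κ).const_mul (2 * β)
    refine h1.unique (h2.congr_of_eventuallyEq ?_)
    filter_upwards [isOpen_Ioo.mem_nhds hκ] with κ hκ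
    exact d1 κ hκ
  have cont : ∀ {f : ℝ → ℝ → ℝ}, SmoothOn f (region M) →
      Filter.Tendsto (fun κ => f r (κ * s)) (nhdsWithin 0 (Set.Ioi 0)) (nhds (f r 0)) := by
    intro f hf
    have h0 : (r, (0 : ℝ)) ∈ region M := by simpa using hmem 0 le_rfl zero_le_one
    have h1 : ContinuousAt (fun t => f r t) ((0 : ℝ) * s) := by
      rw [zero_mul]; exact (hf.hasDerivAt_snd hR h0).continuousAt
    have h2 : ContinuousAt (fun κ : ℝ => f r (κ * s)) 0 :=
      ContinuousAt.comp (f := fun κ : ℝ => κ * s) h1 (by fun_prop)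
    have h3 := h2.tendsto
    rw [zero_mul] at h3
    exact h3.mono_left nhdsWithin_le_nhds
  have e1 : coefQ φ r 0 = α := by
    refine tendsto_nhds_unique (cont hQ) ?_
    have : Filter.Tendsto (fun κ : ℝ => α + β * κ ^ 2) (nhdsWithin 0 (Set.Ioi 0)) (nhds α) := by
      have h1 : ContinuousAt (fun κ : ℝ => α + β * κ ^ 2) 0 := by fun_prop
      have h2 := h1.tendsto
      simp only [ne_eq, OfNat.ofNat_ne_zero, not_false_eq_true, zero_pow, mul_zero,
        add_zero] at h2
      exact h2.mono_left nhdsWithin_le_nhds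
    refine this.congr' ?_
    filter_upwards [hIoo] with κ hκ
    exact (h κ hκ.1 hκ.2.le).symm
  have e2 : ps (ps (coefQ φ)) r 0 * s * s = 2 * β := by
    refine tendsto_nhds_unique (((cont ((hQ.ps hR).ps hR)).mul_const s).mul_const s) ?_
    refine (tendsto_const_nhds (x := 2 * β)).congr' ?_
    filter_upwards [hIoo] with κ hκ
    exact (d2 κ hκ).symm
  have := h 1 one_pos le_rfl
  rw [one_mul] at this
  rw [this, e1]
  linear_combination -e2 / 2

end Douglas

/-! ### The Riemann curvature of a spray |y| P y + |y|² Q x -/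

section Curvature

theorem HasX.contract {n : ℕ} {f : E n → E n → ℝ} {x y : E n} {p : E n → ℝ} (h : HasX f x y p)
    (v : E n) : ∑ k, v k * dX k f x y = p v := by
  simp only [h.dX_eq]; exact h.sum_eq v

theorem HasY.contract {n : ℕ} {f : E n → E n → ℝ} {x y : E n} {p : E n → ℝ} (h : HasY f x y p)
    (v : E n) : ∑ k, v k * dY k f x y = p v := by
  simp only [h.dY_eq]; exact h.sum_eq v

variable {n : ℕ} {M : Set (E n)} {x y : E n} {φ P Q : ℝ → ℝ → ℝ} {F : E n → E n → ℝ}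

/-- The coefficient of the identity in the Riemann curvature, for `|y| = 1`. -/
noncomputable def riemannId (P Q : ℝ → ℝ → ℝ) (r s : ℝ) : ℝ :=
  2 * Q r s * (1 + (s * P r s + (r ^ 2 - s ^ 2) * ps P r s)) + P r s ^ 2 -
    (s * pr P r s / r + ps P r s)

/-- The coefficient of `y^i x_k` in the Riemann curvature, for `|y| = 1`. -/
noncomputable def riemannYX (P Q : ℝ → ℝ → ℝ) (r s : ℝ) : ℝ :=
  2 * pr P r s / r - (s * ps (pr P) r s / r + ps (ps P) r s) - ps Q r s +
    2 * Q r s * (P r s - s * ps P r s + (r ^ 2 - s ^ 2) * ps (ps P) r s) - P r s * ps P r s -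
    ps Q r s * (s * P r s + (r ^ 2 - s ^ 2) * ps P r s)

/-- The coefficient of `y^i y_k` in the Riemann curvature, for `|y| = 1`. -/
noncomputable def riemannYY (P Q : ℝ → ℝ → ℝ) (r s : ℝ) : ℝ :=
  ps P r s - (s * (pr P r s - s * ps (pr P) r s) / r - s * ps (ps P) r s) -
    (2 * Q r s - s * ps Q r s) -
    2 * Q r s * s * (P r s - s * ps P r s + (r ^ 2 - s ^ 2) * ps (ps P) r s) -
    P r s * (P r s - s * ps P r s) -
    (2 * Q r s - s * ps Q r s) * (s * P r s + (r ^ 2 - s ^ 2) * ps P r s)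

/-- The coefficient of `x^i x_k` in the Riemann curvature, for `|y| = 1`. -/
noncomputable def riemannXX (Q : ℝ → ℝ → ℝ) (r s : ℝ) : ℝ :=
  2 * pr Q r s / r - (s * ps (pr Q) r s / r + ps (ps Q) r s) +
    2 * Q r s * (s * ps Q r s + (r ^ 2 - s ^ 2) * ps (ps Q) r s + 2 * Q r s - s * ps Q r s) -
    ps Q r s * (ps Q r s * r ^ 2 + (2 * Q r s - s * ps Q r s) * s)

/-- The coefficient of `x^i y_k` in the Riemann curvature, for `|y| = 1`. -/
noncomputable def riemannXY (Q : ℝ → ℝ → ℝ) (r s : ℝ) : ℝ :=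
  ps Q r s - (s * (2 * pr Q r s - s * ps (pr Q) r s) / r + ps Q r s - s * ps (ps Q) r s) +
    2 * Q r s * (r ^ 2 - s ^ 2) * (ps Q r s - s * ps (ps Q) r s) -
    (2 * Q r s - s * ps Q r s) * (ps Q r s * r ^ 2 + (2 * Q r s - s * ps Q r s) * s)

/-- The derivative of `sprayForm P Q i` in the direction `w` of the second argument. -/
noncomputable def connForm (P Q : ℝ → ℝ → ℝ) (i : Fin n) (w x y : E n) : ℝ :=
  y i * (ps P ‖x‖ (sval x y) * inner ℝ x w +
    intercept P ‖x‖ (sval x y) * (inner ℝ y w * ‖y‖⁻¹)) +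
  ‖y‖ * P ‖x‖ (sval x y) * w i +
  x i * (‖y‖ * (ps Q ‖x‖ (sval x y) * inner ℝ x w) +
    (Q ‖x‖ (sval x y) + intercept Q ‖x‖ (sval x y)) * inner ℝ y w)

theorem dY_sprayForm (hI : IsOpen (radii M)) (hP : SmoothOn P (region M))
    (hQ : SmoothOn Q (region M)) (hg : Gen M x y) (i k : Fin n) :
    dY k (sprayForm P Q i) x y = connForm P Q i (EuclideanSpace.single k 1) x y := by
  have hN := hg.norm_pos_right
  rw [(HasY.sprayForm hI hP hQ hg i).dY_eq k]
  simp only [connForm, intercept]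
  field_simp; ring

/-- By homogeneity it is enough for later use to work at |y| = 1. Derivatives are taken before this
normalisation is inserted. -/
theorem riemann_sprayForm (hI : IsOpen (radii M)) (hP : SmoothOn P (region M))
    (hQ : SmoothOn Q (region M)) (hG : ∀ x y, Gen M x y → ∀ i, spray F i x y = sprayForm P Q i x y)
    (hg : Gen M x y) (hy : ‖y‖ = 1) (i k : Fin n) :
    riemann F i k x y =
      riemannId P Q ‖x‖ (sval x y) * (EuclideanSpace.single k (1 : ℝ) : E n) i +
      y i * (riemannYX P Q ‖x‖ (sval x y) * inner ℝ x (EuclideanSpace.single k 1) +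
        riemannYY P Q ‖x‖ (sval x y) * inner ℝ y (EuclideanSpace.single k 1)) +
      x i * (riemannXX Q ‖x‖ (sval x y) * inner ℝ x (EuclideanSpace.single k 1) +
        riemannXY Q ‖x‖ (sval x y) * inner ℝ y (EuclideanSpace.single k 1)) := by
  have hR := region_isOpen hI
  have hr := hg.norm_pos_left
  have hxy := hg.inner_eq
  rw [hy, mul_one] at hxy
  have hyx : inner ℝ y x = sval x y := by rw [real_inner_comm, hxy]
  have hev := hg.eventually_left hI
  have hev' := hg.eventually_right hI
  have hdY : ∀ x y, Gen M x y → ∀ i k,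
      dY k (spray F i) x y = connForm P Q i (EuclideanSpace.single k 1) x y := by
    intro x y hg i k
    rw [← dY_sprayForm hI hP hQ hg]
    exact dY_congr (gen_isOpen (M := M) hI x) (fun z hz => hG x z hz i) k y hg
  set w : E n := EuclideanSpace.single k 1 with hw
  have hwx : inner ℝ w x = inner ℝ x w := real_inner_comm _ _
  have hwy : inner ℝ w y = inner ℝ y w := real_inner_comm _ _
  have hPs := hP.ps hR
  have hQs := hQ.ps hR
  have hPi := SmoothOn.intercept hI hP
  have hQi := SmoothOn.intercept hI hQ
  have dXs : HasX (spray F i) x y _ := (HasX.sprayForm hI hP hQ hg i).congr_of_eventually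
    (hev.mono fun z hz => hG z y hz i)
  have dYs : HasY (spray F i) x y _ := (HasY.sprayForm hI hP hQ hg i).congr_of_eventually
    (hev'.mono fun z hz => hG x z hz i)
  have cX : ∀ c : E n → ℝ, HasX (fun _ y => c y) x y (fun _ => 0) := HasX.const
  have cY : ∀ c : E n → ℝ, HasY (fun x _ => c x) x y (fun _ => 0) := HasY.const
  have dXc : HasX (dY k (spray F i)) x y _ :=
    ((((cX fun y => y i).mul (((HasX.comp_region hI hPs hg).mul (HasX.inner_const w)).add
      ((HasX.comp_region hI hPi hg).mul (cX fun y => inner ℝ y w * ‖y‖⁻¹)))).add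
    (((cX fun y => ‖y‖).mul (HasX.comp_region hI hP hg)).mul (cX fun _ => w i))).add
    ((HasX.coord i).mul (((cX fun y => ‖y‖).mul
      ((HasX.comp_region hI hQs hg).mul (HasX.inner_const w))).add
      (((HasX.comp_region hI hQ hg).add (HasX.comp_region hI hQi hg)).mul
        (cX fun y => inner ℝ y w))))).congr_of_eventually
    (hev.mono fun z hz => hdY z y hz i k)
  have dYc : HasY (dY k (spray F i)) x y _ :=
    ((((HasY.coord i).mul (((HasY.comp_region hI hPs hg).mul (cY fun x => inner ℝ x w)).add
      ((HasY.comp_region hI hPi hg).mul ((HasY.inner_const w).mul (HasY.inv_norm hg.1))))).add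
    (((HasY.norm hg.1).mul (HasY.comp_region hI hP hg)).mul (cY fun _ => w i))).add
    ((cY fun x => x i).mul (((HasY.norm hg.1).mul
      ((HasY.comp_region hI hQs hg).mul (cY fun x => inner ℝ x w))).add
      (((HasY.comp_region hI hQ hg).add (HasY.comp_region hI hQi hg)).mul
        (HasY.inner_const w))))).congr_of_eventually
    (hev'.mono fun z hz => hdY x z hz i k)
  set r := ‖x‖ with hr_def
  set s := sval x y with hs_def
  -- `G` is the spray vector and `N` its derivative in the direction `w`. With them the three sums
  -- over j are directional derivatives along y, `G` and `N`.
  set G : E n := P r s • y + Q r s • x with hG_def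
  set N : E n := (ps P r s * inner ℝ x w + intercept P r s * inner ℝ y w) • y + P r s • w +
    (ps Q r s * inner ℝ x w + (Q r s + intercept Q r s) * inner ℝ y w) • x with hN_def
  have hGj : ∀ j, spray F j x y = G j := fun j => by
    rw [hG x y hg, sprayForm, hy, hG_def, ← hr_def, ← hs_def]; simp
  have hNj : ∀ j, dY k (spray F j) x y = N j := fun j => by
    rw [hdY x y hg, connForm, hy, hN_def, ← hr_def, ← hs_def, ← hw]; simp; ring
  have e1 := dXs.dX_eq k
  have e2 := dXc.contract y
  have e3 := dYc.contract G
  have e4 := dYs.contract N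
  have e5 : ∑ j, dY j (spray F i) x y * N j = ∑ j, N j * dY j (spray F i) x y :=
    Finset.sum_congr rfl fun j _ => mul_comm _ _
  rw [riemann]
  simp only [hGj, hNj]
  rw [e1, e2, e3, e5, e4]
  have hxx : inner ℝ x x = r ^ 2 := real_inner_self_eq_norm_sq x
  have hyy : inner ℝ y y = 1 := by rw [real_inner_self_eq_norm_sq, hy, one_pow]
  have hxG : inner ℝ x G = P r s * s + Q r s * r ^ 2 := by
    rw [hG_def, inner_add_right, inner_smul_right, inner_smul_right, hxy, hxx]
  have hyG : inner ℝ y G = P r s + Q r s * s := by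
    rw [hG_def, inner_add_right, inner_smul_right, inner_smul_right, hyx, hyy, mul_one]
  have hwG : inner ℝ w G = P r s * inner ℝ y w + Q r s * inner ℝ x w := by
    rw [hG_def, inner_add_right, inner_smul_right, inner_smul_right, hwx, hwy]
  have hGi : G i = P r s * y i + Q r s * x i := by simp [hG_def]
  have hxN : inner ℝ x N = (ps P r s * inner ℝ x w + intercept P r s * inner ℝ y w) * s +
      P r s * inner ℝ x w +
      (ps Q r s * inner ℝ x w + (Q r s + intercept Q r s) * inner ℝ y w) * r ^ 2 := by
    rw [hN_def, inner_add_right, inner_add_right, inner_smul_right, inner_smul_right,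
      inner_smul_right, hxy, hxx]
  have hyN : inner ℝ y N = (ps P r s * inner ℝ x w + intercept P r s * inner ℝ y w) +
      P r s * inner ℝ y w +
      (ps Q r s * inner ℝ x w + (Q r s + intercept Q r s) * inner ℝ y w) * s := by
    rw [hN_def, inner_add_right, inner_add_right, inner_smul_right, inner_smul_right,
      inner_smul_right, hyx, hyy, mul_one]
  have hNi : N i = (ps P r s * inner ℝ x w + intercept P r s * inner ℝ y w) * y i +
      P r s * w i +
      (ps Q r s * inner ℝ x w + (Q r s + intercept Q r s) * inner ℝ y w) * x i := by
    simp [hN_def]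
  have hrs : (r, s) ∈ region M := hg.2
  simp only [hy, hxG, hyG, hwG, hGi, hxN, hyN, hNi, hxy, hyy, hwy,
    ← hw, hP.pr_ps_comm hR hrs, hQ.pr_ps_comm hR hrs, ps_intercept hI hP hrs,
    ps_intercept hI hQ hrs, pr_intercept hI hP hrs, pr_intercept hI hQ hrs]
  simp only [riemannId, riemannYX, riemannYY, riemannXX, riemannXY, intercept]
  field_simp
  ring

end Curvature

/-! ### From constant flag curvature to a first order system -/

section Equations

variable {n : ℕ} {M : Set (E n)} {x y : E n} {φ P Q : ℝ → ℝ → ℝ} {F : E n → E n → ℝ} {K : ℝ}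

theorem metricForm_linear (a b c : ℝ) (u v w z : E n) :
    metricForm φ x y (a • u + b • v + c • w) z =
      a * metricForm φ x y u z + b * metricForm φ x y v z + c * metricForm φ x y w z := by
  simp only [metricForm, inner_add_left, inner_add_right, inner_smul_left, inner_smul_right,
    conj_trivial]
  ring

theorem metricForm_self_left (hg : Gen M x y) (hy : ‖y‖ = 1) :
    metricForm φ x y y y = φ ‖x‖ (sval x y) ^ 2 := by
  have hxy := hg.inner_eq
  rw [hy, mul_one] at hxy
  simp only [metricForm, hxy, real_inner_self_eq_norm_sq, hy, intercept]
  ring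

theorem riemannApply_eq (hI : IsOpen (radii M)) (hP : SmoothOn P (region M))
    (hQ : SmoothOn Q (region M)) (hG : ∀ x y, Gen M x y → ∀ i, spray F i x y = sprayForm P Q i x y)
    (hg : Gen M x y) (hy : ‖y‖ = 1) (u : E n) :
    riemannApply F x y u = (riemannId P Q ‖x‖ (sval x y) • u +
      (riemannYX P Q ‖x‖ (sval x y) * inner ℝ x u +
        riemannYY P Q ‖x‖ (sval x y) * inner ℝ y u) • y +
      (riemannXX Q ‖x‖ (sval x y) * inner ℝ x u +
        riemannXY Q ‖x‖ (sval x y) * inner ℝ y u) • x : E n) := by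
  have hX : ∑ k, u k * inner ℝ x (EuclideanSpace.single k 1) = inner ℝ x u := by
    simpa using sum_mul_clm (innerSL ℝ x) u
  have hY : ∑ k, u k * inner ℝ y (EuclideanSpace.single k 1) = inner ℝ y u := by
    simpa using sum_mul_clm (innerSL ℝ y) u
  ext i
  have hi : ∑ k, u k * (EuclideanSpace.single k (1 : ℝ) : E n) i = u i :=
    sum_mul_clm (EuclideanSpace.proj (𝕜 := ℝ) i) u
  rw [riemannApply]
  simp only [riemann_sprayForm hI hP hQ hG hg hy i, PiLp.add_apply, PiLp.smul_apply, smul_eq_mul]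
  rw [← hX, ← hY]
  conv_rhs => rw [← hi]
  simp only [Finset.mul_sum, ← Finset.sum_add_distrib, Finset.sum_mul]
  exact Finset.sum_congr rfl fun k _ => by ring

/-- Flags spanned by y and a test vector v isolate the three parts of R_y. A vector e orthogonal to
x and y sees only the identity part; the g_y-normal u to y then shows that the x-part vanishes on u;
u + y shows the same for the y-part. The result is rewritten as the action of R_y on x = u + cy. -/
theorem IsGivenBy.curvature_equations (hn : 3 ≤ n) (hφ : IsGivenBy M F φ) (hp : IsPositive M φ)
    (hF : IsFinslerMetric M F)
    (hK : ∀ x ∈ M, ∀ y u : E n, LinearIndependent ℝ ![y, u] → flagCurvature F x y u = K)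
    {r s : ℝ} (hrs : (r, s) ∈ region M) :
    riemannId (coefP φ) (coefQ φ) r s = K * φ r s ^ 2 ∧
    riemannXX (coefQ φ) r s * r ^ 2 + riemannXY (coefQ φ) r s * s = 0 ∧
    riemannYX (coefP φ) (coefQ φ) r s * r ^ 2 + riemannYY (coefP φ) (coefQ φ) r s * s =
      -(K * φ r s * (s * φ r s + (r ^ 2 - s ^ 2) * ps φ r s)) := by
  obtain ⟨x, y, e, hg, rfl, hy, rfl, he, hxe, hye⟩ := exists_gen_frame hn hrs
  have hφ0 := hp.pos hrs
  have hf0 := hp.intercept_pos hrs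
  have hr := hg.norm_pos_left
  have hρ := region_rho_pos hg.2
  have hL := hp.lambda_pos hrs
  have hxy := hg.inner_eq
  rw [hy, mul_one] at hxy
  have hyx : inner ℝ y x = sval x y := by rw [real_inner_comm, hxy]
  have hxx : inner ℝ x x = ‖x‖ ^ 2 := real_inner_self_eq_norm_sq x
  have hyy : inner ℝ y y = 1 := by rw [real_inner_self_eq_norm_sq, hy, one_pow]
  have hR := riemannApply_eq hφ.isOpen hp.coefP_smooth hp.coefQ_smooth
    (fun x y hg i => hφ.spray_eq hp hF hg i) hg hy
  obtain ⟨u, hu, hu0, hyu, huu⟩ := hφ.exists_normal hn hF hg hy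
  set r := ‖x‖
  set s := sval x y
  set P := coefP φ
  set Q := coefQ φ
  have hmyy : metricForm φ x y y y = φ r s ^ 2 := metricForm_self_left hg hy
  have flag : ∀ v : E n,
      φ r s ^ 2 * metricForm φ x y v v - metricForm φ x y y v ^ 2 ≠ 0 →
      riemannId P Q r s * metricForm φ x y v v +
        (riemannYX P Q r s * inner ℝ x v + riemannYY P Q r s * inner ℝ y v) *
          metricForm φ x y y v +
        (riemannXX Q r s * inner ℝ x v + riemannXY Q r s * inner ℝ y v) * metricForm φ x y x v =
      K * (φ r s ^ 2 * metricForm φ x y v v - metricForm φ x y y v ^ 2) := by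
    intro v hv
    have hli : LinearIndependent ℝ ![y, v] := by
      rw [LinearIndependent.pair_iff' hg.1]
      rintro a rfl
      refine hv ?_
      have e1 : metricForm φ x y y (a • y) = a * φ r s ^ 2 := by
        rw [metricForm_comm, ← hmyy]
        simpa using metricForm_linear (φ := φ) (x := x) (y := y) a 0 0 y 0 0 y
      have e2 : metricForm φ x y (a • y) (a • y) = a * (a * φ r s ^ 2) := by
        rw [← e1]
        simpa using metricForm_linear (φ := φ) (x := x) (y := y) a 0 0 y 0 0 (a • y)
      rw [e1, e2]; ring
    have h1 := hK x (hφ.mem x hg.2.1) y v hli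
    rw [flagCurvature, hR v, hφ.gInner_eq hg, hφ.gInner_eq hg, hφ.gInner_eq hg, hφ.gInner_eq hg,
      hmyy, div_eq_iff hv, metricForm_linear] at h1
    exact h1
  have hId : riemannId P Q r s = K * φ r s ^ 2 := by
    have e1 : metricForm φ x y e e = φ r s * intercept φ r s := by
      simp only [metricForm, hxe, hye, real_inner_self_eq_norm_sq, he]; ring
    have e2 : metricForm φ x y y e = 0 := by
      simp only [metricForm, hxe, hye]; ring
    have e3 : metricForm φ x y x e = 0 := by
      simp only [metricForm, hxe, hye]; ring
    have := flag e (by rw [e1, e2, zero_pow two_ne_zero, sub_zero]; positivity)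
    rw [e1, e2, e3] at this
    have h2 : φ r s * intercept φ r s ≠ 0 := by positivity
    apply mul_right_cancel₀ h2
    linear_combination this
  have hG00 : 0 < metricForm φ x y u u := hφ.metricForm_pos hF hg hu0
  set c := s + (r ^ 2 - s ^ 2) * ps φ r s / φ r s with hc
  have hxu : metricForm φ x y x u = metricForm φ x y u u := by
    have : x = (1 : ℝ) • u + c • y + (0 : ℝ) • y := by rw [hu]; module
    calc metricForm φ x y x u = metricForm φ x y ((1 : ℝ) • u + c • y + (0 : ℝ) • y) u := by
          rw [← this]
      _ = _ := by rw [metricForm_linear, hyu]; ring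
  have ixu : inner ℝ x u = r ^ 2 - c * s := by
    rw [hu, inner_sub_right, inner_smul_right, hxx, hxy]
  have iyu : inner ℝ y u = s - c := by
    rw [hu, inner_sub_right, inner_smul_right, hyy, hyx, mul_one]
  -- This identity and the next express R_y(y) = 0, which holds for every spray of this form.
  have hν0 : riemannXX Q r s * s + riemannXY Q r s = 0 := by
    simp only [riemannXX, riemannXY]; field_simp; ring
  have hμ0 : riemannYX P Q r s * s + riemannYY P Q r s = -riemannId P Q r s := by
    simp only [riemannYX, riemannYY, riemannId]; field_simp; ring
  have hν : riemannXX Q r s * inner ℝ x u + riemannXY Q r s * inner ℝ y u = 0 := by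
    have := flag u (by rw [hyu, zero_pow two_ne_zero, sub_zero]; positivity)
    rw [hyu, hxu, hId] at this
    apply mul_right_cancel₀ hG00.ne'
    linear_combination this
  -- The y-part is invisible on u itself because g_y(y, u) = 0, so the flag is tested with u + y.
  have hμ : riemannYX P Q r s * inner ℝ x u + riemannYY P Q r s * inner ℝ y u = 0 := by
    have e1 : ∀ z, metricForm φ x y z ((1 : ℝ) • u + (1 : ℝ) • y + (0 : ℝ) • y) =
        metricForm φ x y u z + metricForm φ x y y z := fun z => by
      rw [metricForm_comm, metricForm_linear]; ring
    have e2 : metricForm φ x y ((1 : ℝ) • u + (1 : ℝ) • y + (0 : ℝ) • y)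
        ((1 : ℝ) • u + (1 : ℝ) • y + (0 : ℝ) • y) = metricForm φ x y u u + φ r s ^ 2 := by
      rw [metricForm_linear, e1, e1, hmyy, hyu, metricForm_comm (φ := φ) u y, hyu]; ring
    have e3 : metricForm φ x y y ((1 : ℝ) • u + (1 : ℝ) • y + (0 : ℝ) • y) = φ r s ^ 2 := by
      rw [e1, hmyy, metricForm_comm, hyu]; ring
    have := flag ((1 : ℝ) • u + (1 : ℝ) • y + (0 : ℝ) • y) (by
      rw [e2, e3]
      have : φ r s ^ 2 * (metricForm φ x y u u + φ r s ^ 2) - (φ r s ^ 2) ^ 2 =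
        φ r s ^ 2 * metricForm φ x y u u := by ring
      rw [this]; positivity)
    rw [e2, e3, hId] at this
    simp only [inner_add_right, inner_smul_right, hxy, hyy] at this
    have h2 : φ r s ^ 2 ≠ 0 := by positivity
    apply mul_right_cancel₀ h2
    linear_combination this - φ r s ^ 2 * hμ0 + φ r s ^ 2 * hId -
      metricForm φ x y x ((1 : ℝ) • u + (1 : ℝ) • y + (0 : ℝ) • y) * (hν + hν0)
  rw [ixu, iyu] at hν hμ
  refine ⟨hId, ?_, ?_⟩
  · linear_combination hν + c * hν0
  · have hcφ : c * φ r s = s * φ r s + (r ^ 2 - s ^ 2) * ps φ r s := by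
      rw [hc]; field_simp
    linear_combination hμ + c * hμ0 - c * hId - K * φ r s * hcφ

/-- The equations satisfied by `φ`, `P` and `Q` by virtue of the definition of `P` and `Q`. -/
theorem IsPositive.derivative_equations (hp : IsPositive M φ) {r s : ℝ}
    (hrs : (r, s) ∈ region M) :
    pr φ r s = r * (ps φ r s * coefP φ r s + φ r s * ps (coefP φ) r s) +
      r * ps (coefQ φ) r s * (s * φ r s + (r ^ 2 - s ^ 2) * ps φ r s) ∧
    ps φ r s = 2 * φ r s * coefP φ r s -
      s * (ps φ r s * coefP φ r s + φ r s * ps (coefP φ) r s) +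
      (2 * coefQ φ r s - s * ps (coefQ φ) r s) *
        (s * φ r s + (r ^ 2 - s ^ 2) * ps φ r s) := by
  have hD := region_isOpen hp.isOpen
  have hr := region_pos hrs
  have h0 := hp.smooth.hasDerivAt_snd hD hrs
  have h1 := (hp.smooth.ps hD).hasDerivAt_snd hD hrs
  have h2 := (hp.smooth.pr hD).hasDerivAt_snd hD hrs
  have hP := hp.coefP_smooth.hasDerivAt_snd hD hrs
  have hQ := hp.coefQ_smooth.hasDerivAt_snd hD hrs
  have hρ : HasDerivAt (fun t : ℝ => r ^ 2 - t ^ 2) (-(2 * s)) s :=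
    (((hasDerivAt_id s).pow 2).const_sub (r ^ 2)).congr_deriv (by simp)
  have lhs := ((hP.mul h0).add (hQ.mul (((hasDerivAt_id s).mul h0).add (hρ.mul h1)))).const_mul
    (2 * r)
  have rhs := (h1.const_mul r).add ((hasDerivAt_id s).mul h2)
  have hev : (fun t => 2 * r * (coefP φ r t * φ r t +
      coefQ φ r t * (t * φ r t + (r ^ 2 - t ^ 2) * ps φ r t))) =ᶠ[nhds s]
      fun t => r * ps φ r t + t * pr φ r t := by
    have : {t : ℝ | (r, t) ∈ region M} ∈ nhds s :=
      (hD.preimage (Continuous.prodMk_right r)).mem_nhds hrs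
    filter_upwards [this] with t ht
    exact hp.coefP_eq ht
  -- The s-derivative of the relation defining P contains φ_ss and φ_rs in the same combination as
  -- the relation defining Q; subtracting the two leaves φ_r.
  have key := lhs.unique (rhs.congr_of_eventuallyEq hev)
  have e1 := hp.coefP_eq hrs
  have e2 := hp.coefQ_eq hrs
  simp only [id_eq, one_mul, Pi.add_apply, Pi.mul_apply] at key
  have first : pr φ r s = r * (ps φ r s * coefP φ r s + φ r s * ps (coefP φ) r s) +
      r * ps (coefQ φ) r s * (s * φ r s + (r ^ 2 - s ^ 2) * ps φ r s) := by
    linear_combination (e2 - key) / 2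
  refine ⟨first, ?_⟩
  apply mul_left_cancel₀ hr.ne'
  linear_combination -e1 - s * first

theorem curvature_ps (hI : IsOpen (radii M)) (hφ : SmoothOn φ (region M))
    (hP : SmoothOn P (region M)) (hQ : SmoothOn Q (region M))
    (h : ∀ r s, (r, s) ∈ region M → riemannId P Q r s = K * φ r s ^ 2) {r s : ℝ}
    (hrs : (r, s) ∈ region M) :
    2 * ps Q r s * (1 + (s * P r s + (r ^ 2 - s ^ 2) * ps P r s)) +
      2 * Q r s * (P r s - s * ps P r s + (r ^ 2 - s ^ 2) * ps (ps P) r s) +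
      2 * P r s * ps P r s - (pr P r s / r + s * ps (pr P) r s / r + ps (ps P) r s) =
    2 * K * φ r s * ps φ r s := by
  have hD := region_isOpen hI
  have hr := region_pos hrs
  have hφd := hφ.hasDerivAt_snd hD hrs
  have hPd := hP.hasDerivAt_snd hD hrs
  have hPsd := (hP.ps hD).hasDerivAt_snd hD hrs
  have hPrd := (hP.pr hD).hasDerivAt_snd hD hrs
  have hQd := hQ.hasDerivAt_snd hD hrs
  have hρ : HasDerivAt (fun t : ℝ => r ^ 2 - t ^ 2) (-(2 * s)) s :=
    (((hasDerivAt_id s).pow 2).const_sub (r ^ 2)).congr_deriv (by simp)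
  have lhs := (((hQd.const_mul 2).mul ((((hasDerivAt_id s).mul hPd).add
    (hρ.mul hPsd)).const_add 1)).add (hPd.pow 2)).sub
    ((((hasDerivAt_id s).mul hPrd).div_const r).add hPsd)
  have rhs := (hφd.pow 2).const_mul K
  have hev : (fun t => riemannId P Q r t) =ᶠ[nhds s] fun t => K * φ r t ^ 2 := by
    have : {t : ℝ | (r, t) ∈ region M} ∈ nhds s :=
      (hD.preimage (Continuous.prodMk_right r)).mem_nhds hrs
    filter_upwards [this] with t ht
    exact h r t ht
  have key := HasDerivAt.unique (f := fun t => riemannId P Q r t) lhs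
    (rhs.congr_of_eventuallyEq hev)
  simp only [id_eq, one_mul, Pi.add_apply, Pi.mul_apply, Nat.cast_ofNat, Nat.add_one_sub_one, pow_one] at key
  linear_combination key

/-- A solution of the equations for a spherically symmetric Douglas metric of constant flag
curvature, with `Q = g + b s²`. -/
structure IsSolution (M : Set (E n)) (φ P Q : ℝ → ℝ → ℝ) (g b : ℝ → ℝ) (K : ℝ) : Prop where
  isOpen : IsOpen (radii M)
  smooth : SmoothOn φ (region M)
  smooth_P : SmoothOn P (region M)
  smooth_g : ContDiffOn ℝ ∞ g (radii M)
  smooth_b : ContDiffOn ℝ ∞ b (radii M)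
  pos : ∀ {r s : ℝ}, (r, s) ∈ region M → 0 < φ r s
  intercept_pos : ∀ {r s : ℝ}, (r, s) ∈ region M → 0 < intercept φ r s
  Q_eq : ∀ {r s : ℝ}, (r, s) ∈ region M → Q r s = g r + b r * s ^ 2
  deriv_g : ∀ {r : ℝ}, r ∈ radii M → deriv g r + 2 * r * g r ^ 2 = r * b r * (1 - 2 * r ^ 2 * g r)
  pr_phi : ∀ {r s : ℝ}, (r, s) ∈ region M → pr φ r s =
    r * (ps φ r s * P r s + φ r s * ps P r s) +
      r * ps Q r s * (s * φ r s + (r ^ 2 - s ^ 2) * ps φ r s)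
  ps_phi : ∀ {r s : ℝ}, (r, s) ∈ region M → ps φ r s =
    2 * φ r s * P r s - s * (ps φ r s * P r s + φ r s * ps P r s) +
      (2 * Q r s - s * ps Q r s) * (s * φ r s + (r ^ 2 - s ^ 2) * ps φ r s)
  pr_P : ∀ {r s : ℝ}, (r, s) ∈ region M → pr P r s =
    r * ps Q r s * (1 + (s * P r s + (r ^ 2 - s ^ 2) * ps P r s)) + r * P r s * ps P r s -
      r * K * φ r s * ps φ r s
  ps_P : ∀ {r s : ℝ}, (r, s) ∈ region M → ps P r s =
    (2 * Q r s - s * ps Q r s) * (1 + (s * P r s + (r ^ 2 - s ^ 2) * ps P r s)) +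
      P r s * (P r s - s * ps P r s) - K * φ r s * (φ r s - s * ps φ r s)

theorem region_mem_zero {r s : ℝ} (h : (r, s) ∈ region M) : (r, (0 : ℝ)) ∈ region M :=
  ⟨h.1, by simpa using region_pos h⟩

theorem radii_mem_region {r : ℝ} (h : r ∈ radii M) : (r, (0 : ℝ)) ∈ region M :=
  ⟨h, by simpa using h.1⟩

theorem SmoothOn.restrict_zero (h : SmoothOn φ (region M)) :
    ContDiffOn ℝ ∞ (fun r => φ r 0) (radii M) :=
  ContDiffOn.comp (g := fun p : ℝ × ℝ => φ p.1 p.2) h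
    (contDiffOn_id.prodMk contDiffOn_const) fun _ hr => radii_mem_region hr

theorem IsGivenBy.isSolution (hn : 3 ≤ n) (hφ : IsGivenBy M F φ) (hp : IsPositive M φ)
    (hF : IsFinslerMetric M F) (hD : IsDouglas M F)
    (hK : ∀ x ∈ M, ∀ y u : E n, LinearIndependent ℝ ![y, u] → flagCurvature F x y u = K) :
    IsSolution M φ (coefP φ) (coefQ φ) (fun r => coefQ φ r 0)
      (fun r => ps (ps (coefQ φ)) r 0 / 2) K := by
  have hR := region_isOpen hφ.isOpen
  have hP := hp.coefP_smooth
  have hQ := hp.coefQ_smooth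
  have hQeq : ∀ {r s : ℝ}, (r, s) ∈ region M →
      coefQ φ r s = coefQ φ r 0 + ps (ps (coefQ φ)) r 0 / 2 * s ^ 2 :=
    fun h => hφ.coefQ_eq_quadratic hn hp hF hD h
  have heq := fun {r s : ℝ} (h : (r, s) ∈ region M) => hφ.curvature_equations hn hp hF hK h
  have hs := fun {r s : ℝ} (h : (r, s) ∈ region M) =>
    curvature_ps hφ.isOpen hφ.smooth hP hQ (fun r s h => (heq h).1) h
  have hpr : ∀ {r s : ℝ}, (r, s) ∈ region M → pr (coefP φ) r s =
      r * ps (coefQ φ) r s * (1 + (s * coefP φ r s + (r ^ 2 - s ^ 2) * ps (coefP φ) r s)) +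
        r * coefP φ r s * ps (coefP φ) r s - r * K * φ r s * ps φ r s := by
    intro r s h
    have hr := region_pos h
    have hρ := region_rho_pos h
    obtain ⟨h1, -, h3⟩ := heq h
    have h4 := hs h
    simp only [riemannId] at h1
    simp only [riemannYX, riemannYY] at h3
    field_simp at h1 h3 h4
    -- The curvature equations and the s-derivative of the first combine so that a factor r² - s²
    -- splits off. What remains eliminates P_rs and P_ss and leaves a formula for P_r.
    have h5 : (r ^ 2 - s ^ 2) * (pr (coefP φ) r s - s * ps (pr (coefP φ)) r s -
        r * ps (ps (coefP φ)) r s + 2 * r * coefQ φ r s * (coefP φ r s - s * ps (coefP φ) r s +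
            (r ^ 2 - s ^ 2) * ps (ps (coefP φ)) r s)) = 0 := by
      linear_combination (2 / 3) * (h3 + s * h1 + (r ^ 2 - s ^ 2) / 2 * h4)
    have h6 := (mul_eq_zero.1 h5).resolve_left hρ.ne'
    linear_combination -h4 / 2 + h6 / 2
  refine ⟨hφ.isOpen, hφ.smooth, hP, hQ.restrict_zero,
    ((hQ.ps hR).ps hR).restrict_zero.div_const 2, hp.pos, hp.intercept_pos, hQeq, ?_,
    fun h => (hp.derivative_equations h).1, fun h => (hp.derivative_equations h).2, hpr, ?_⟩
  · intro r hr
    have h0 := radii_mem_region hr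
    have hr0 := region_pos h0
    -- At s = 0 one has Q_s = 0 and Q_ss = 2b, and the vanishing of the x-part becomes the
    -- differential equation for g.
    have h1 := (heq h0).2.1
    have hQs : ps (coefQ φ) r 0 = 0 := by
      have h2 : HasDerivAt (fun t : ℝ => coefQ φ r 0 + ps (ps (coefQ φ)) r 0 / 2 * t ^ 2) 0 0 :=
        ((((hasDerivAt_id (0 : ℝ)).pow 2).const_mul _).const_add _).congr_deriv (by simp)
      refine (hQ.hasDerivAt_snd hR h0).unique (h2.congr_of_eventuallyEq ?_)
      have : {t : ℝ | (r, t) ∈ region M} ∈ nhds 0 :=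
        (hR.preimage (Continuous.prodMk_right r)).mem_nhds h0
      filter_upwards [this] with t ht
      exact hQeq ht
    have hg : deriv (fun r => coefQ φ r 0) r = pr (coefQ φ) r 0 := rfl
    rw [hg]
    simp only [riemannXX, riemannXY, hQs] at h1
    field_simp at h1 ⊢
    simp at h1
    rcases h1 with h1 | h1
    · exact absurd h1 hr0.ne'
    · linear_combination h1
  · intro r s h
    have hr := region_pos h
    have h1 := (heq h).1
    have h2 := hpr h
    simp only [riemannId] at h1
    have h3 : s * pr (coefP φ) r s / r = s * (ps (coefQ φ) r s *
        (1 + (s * coefP φ r s + (r ^ 2 - s ^ 2) * ps (coefP φ) r s)) +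
        coefP φ r s * ps (coefP φ) r s - K * φ r s * ps φ r s) := by
      rw [h2]; field_simp
    rw [h3] at h1
    linear_combination -h1

end Equations

/-! ### Smooth primitives on an interval -/

section Primitive

theorem exists_primitive {I : Set ℝ} (hI : IsOpen I) (hc : I.OrdConnected) (hne : I.Nonempty)
    {k : ℝ → ℝ} (hk : ContinuousOn k I) : ∃ A : ℝ → ℝ, ∀ r ∈ I, HasDerivAt A (k r) r := by
  obtain ⟨r₀, h₀⟩ := hne
  refine ⟨fun r => ∫ t in r₀..r, k t, fun r hr => ?_⟩
  have h1 : IntervalIntegrable k MeasureTheory.volume r₀ r :=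
    (hk.mono (hc.uIcc_subset h₀ hr)).intervalIntegrable
  exact intervalIntegral.integral_hasDerivAt_right h1
    (hk.stronglyMeasurableAtFilter hI r hr) (hk.continuousAt (hI.mem_nhds hr))

theorem contDiffOn_of_hasDerivAt {I : Set ℝ} (hI : IsOpen I) {A k : ℝ → ℝ}
    (hk : ContDiffOn ℝ ∞ k I) (hA : ∀ r ∈ I, HasDerivAt A (k r) r) : ContDiffOn ℝ ∞ A I := by
  rw [contDiffOn_infty_iff_deriv_of_isOpen hI]
  exact ⟨fun r hr => (hA r hr).differentiableAt.differentiableWithinAt,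
    hk.congr fun r hr => (hA r hr).deriv⟩

end Primitive

/-! ### The functions T and `Tbar`, and the form of Q -/

section Solution

variable {n : ℕ} {M : Set (E n)} {φ P Q : ℝ → ℝ → ℝ} {g b : ℝ → ℝ} {K : ℝ}

namespace IsSolution

theorem hasDerivAt_g (h : IsSolution M φ P Q g b K) {r : ℝ} (hr : r ∈ radii M) :
    HasDerivAt g (r * b r * (1 - 2 * r ^ 2 * g r) - 2 * r * g r ^ 2) r := by
  have h1 := ((h.smooth_g.contDiffAt (h.isOpen.mem_nhds hr)).differentiableAt
    (by simp)).hasDerivAt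
  exact h1.congr_deriv (by linear_combination h.deriv_g hr)

theorem hasDerivAt_w (h : IsSolution M φ P Q g b K) {r : ℝ} (hr : r ∈ radii M) :
    HasDerivAt (fun r => 1 - 2 * r ^ 2 * g r)
      (-(4 * r * g r + 2 * r ^ 2 *
        (r * b r * (1 - 2 * r ^ 2 * g r) - 2 * r * g r ^ 2))) r := by
  have h1 := ((((hasDerivAt_id r).pow 2).const_mul 2).mul (h.hasDerivAt_g hr)).const_sub 1
  refine h1.congr_deriv ?_
  simp only [Pi.pow_apply, id_eq, Nat.cast_ofNat]
  norm_num only [pow_one]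
  ring

theorem ps_Q (h : IsSolution M φ P Q g b K) {r s : ℝ} (hrs : (r, s) ∈ region M) :
    ps Q r s = 2 * b r * s := by
  have h2 : HasDerivAt (fun t : ℝ => g r + b r * t ^ 2) (2 * b r * s) s := by
    refine ((((hasDerivAt_id s).pow 2).const_mul (b r)).const_add (g r)).congr_deriv ?_
    simp; ring
  refine (HasDerivAt.congr_of_eventuallyEq h2 ?_).deriv
  have : {t : ℝ | (r, t) ∈ region M} ∈ nhds s :=
    ((region_isOpen h.isOpen).preimage (Continuous.prodMk_right r)).mem_nhds hrs
  filter_upwards [this] with t ht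
  exact h.Q_eq ht

/-- A positive function with logarithmic derivative `4rg + 4r³b`. -/
theorem exists_T (h : IsSolution M φ P Q g b K) (hc : (radii M).OrdConnected)
    (hne : (radii M).Nonempty) : ∃ T : ℝ → ℝ, (∀ r, 0 < T r) ∧ ContDiffOn ℝ ∞ T (radii M) ∧
      ∀ r ∈ radii M, HasDerivAt T ((4 * r * g r + 4 * r ^ 3 * b r) * T r) r := by
  have hk : ContDiffOn ℝ ∞ (fun r => 4 * r * g r + 4 * r ^ 3 * b r) (radii M) :=
    ((contDiffOn_const.mul contDiffOn_id).mul h.smooth_g).add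
      ((contDiffOn_const.mul (contDiffOn_id.pow 3)).mul h.smooth_b)
  obtain ⟨A, hA⟩ := exists_primitive h.isOpen hc hne hk.continuousOn
  refine ⟨fun r => Real.exp (A r), fun r => Real.exp_pos _,
    (contDiffOn_of_hasDerivAt h.isOpen hk hA).exp, fun r hr => ?_⟩
  exact (hA r hr).exp.congr_deriv (by ring)

/-- The function (1 - 2r²g) √T / r has derivative -√T / r² < 0, so it is injective on the interval
of radii, and its zeros are those of 1 - 2r²g. -/
theorem subsingleton_zeros (h : IsSolution M φ P Q g b K) (hc : (radii M).OrdConnected)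
    (hne : (radii M).Nonempty) :
    {r | r ∈ radii M ∧ 1 - 2 * r ^ 2 * g r = 0}.Subsingleton := by
  obtain ⟨T, hT, -, hT'⟩ := h.exists_T hc hne
  have hd : ∀ r ∈ radii M, HasDerivAt (fun r => (1 - 2 * r ^ 2 * g r) * Real.sqrt (T r) / r)
      (-(Real.sqrt (T r) / r ^ 2)) r := by
    intro r hr
    have hr0 : r ≠ 0 := hr.1.ne'
    have h1 := (h.hasDerivAt_w hr).mul ((hT' r hr).sqrt (hT r).ne')
    refine (h1.div (hasDerivAt_id r) hr0).congr_deriv ?_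
    have hS : Real.sqrt (T r) ≠ 0 := (Real.sqrt_pos.2 (hT r)).ne'
    have hS2 : T r = Real.sqrt (T r) ^ 2 := (Real.sq_sqrt (hT r).le).symm
    have e : (4 * r * g r + 4 * r ^ 3 * b r) * T r / (2 * Real.sqrt (T r)) =
        (2 * r * g r + 2 * r ^ 3 * b r) * Real.sqrt (T r) := by
      rw [div_eq_iff (by positivity)]
      nth_rewrite 1 [hS2]; ring
    rw [e]
    simp only [Pi.mul_apply, id_eq]
    field_simp
    ring
  have hanti : StrictAntiOn (fun r => (1 - 2 * r ^ 2 * g r) * Real.sqrt (T r) / r) (radii M) := by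
    refine strictAntiOn_of_deriv_neg hc.convex
      (fun r hr => (hd r hr).continuousAt.continuousWithinAt) fun r hr => ?_
    rw [h.isOpen.interior_eq] at hr
    rw [(hd r hr).deriv]
    have := Real.sqrt_pos.2 (hT r)
    have := hr.1
    exact neg_neg_of_pos (by positivity)
  rintro r₁ ⟨h1, h1'⟩ r₂ ⟨h2, h2'⟩
  exact hanti.injOn h1 h2 (by simp [h1', h2'])

/-- The closed form of `Tbar` comes from r² `Tbar` = (1 - (1 - 2r²g)²) T. Its derivative is 4rbT,
which agrees with the required integrand by the equation for g. No division by 1 - 2r²g occurs, so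
both functions are smooth at its zero. -/
theorem areTFunctions (h : IsSolution M φ P Q g b K) {T : ℝ → ℝ} (hT : ∀ r, 0 < T r)
    (hTs : ContDiffOn ℝ ∞ T (radii M))
    (hT' : ∀ r ∈ radii M, HasDerivAt T ((4 * r * g r + 4 * r ^ 3 * b r) * T r) r) :
    AreTFunctions (radii M) g T (fun r => 4 * g r * (1 - r ^ 2 * g r) * T r) := by
  refine ⟨hTs, ((contDiffOn_const.mul h.smooth_g).mul
    (contDiffOn_const.sub ((contDiffOn_id.pow 2).mul h.smooth_g))).mul hTs,
    -- The primitive is forced by solving T = e^(-B) / (1 - 2r²g)² for B.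
    fun r => -Real.log (T r * (1 - 2 * r ^ 2 * g r) ^ 2), fun r hr hw => ⟨?_, ?_, ?_⟩⟩
  · have hp : T r * (1 - 2 * r ^ 2 * g r) ^ 2 ≠ 0 := mul_ne_zero (hT r).ne' (pow_ne_zero 2 hw)
    have hT0 := (hT r).ne'
    have h1 := (((hT' r hr).mul ((h.hasDerivAt_w hr).pow 2)).log hp).neg
    refine h1.congr_deriv ?_
    simp only [Pi.mul_apply, Pi.pow_apply]
    rw [← neg_div, div_eq_div_iff hp hw]
    push_cast
    ring
  · have hp : 0 < T r * (1 - 2 * r ^ 2 * g r) ^ 2 := mul_pos (hT r) (by positivity)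
    rw [neg_neg, Real.exp_log hp, mul_div_assoc, div_self (pow_ne_zero 2 hw), mul_one]
  · have hg := h.hasDerivAt_g hr
    have h1 := ((hg.const_mul 4).mul ((((hasDerivAt_id r).pow 2).mul hg).const_sub 1)).mul (hT' r hr)
    refine h1.congr_deriv ?_
    rw [h.deriv_g hr, mul_div_assoc, div_self hw, mul_one]
    simp
    ring

theorem hasFormQ (h : IsSolution M φ P Q g b K) : HasFormQ M Q g := by
  intro r s hrs hw
  have hr := (region_pos hrs).ne'
  have : r - 2 * r ^ 3 * g r ≠ 0 := by
    have e : r - 2 * r ^ 3 * g r = r * (1 - 2 * r ^ 2 * g r) := by ring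
    rw [e]; exact mul_ne_zero hr hw
  rw [h.Q_eq hrs, h.deriv_g hrs.1]
  have e : r * b r * (1 - 2 * r ^ 2 * g r) / (r - 2 * r ^ 3 * g r) = b r := by
    rw [div_eq_iff this]; ring
  rw [e]

end IsSolution

end Solution

/-! ### The function U, its equation, and the recovery of φ -/

section Compatibility

variable {n : ℕ} {M : Set (E n)} {φ : ℝ → ℝ → ℝ} {g b : ℝ → ℝ} {K : ℝ}

/-- The function `U = (s φ + (r² - s²) φ_s) / φ`. -/
noncomputable def potential (φ : ℝ → ℝ → ℝ) : ℝ → ℝ → ℝ := fun r s =>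
  (s * φ r s + (r ^ 2 - s ^ 2) * ps φ r s) / φ r s

theorem hasDerivAt_rho_snd (r s : ℝ) : HasDerivAt (fun t : ℝ => r ^ 2 - t ^ 2) (-(2 * s)) s :=
  (((hasDerivAt_id s).pow 2).const_sub (r ^ 2)).congr_deriv (by simp)

theorem hasDerivAt_rho_fst (r s : ℝ) : HasDerivAt (fun t : ℝ => t ^ 2 - s ^ 2) (2 * r) r :=
  (((hasDerivAt_id r).pow 2).sub_const (s ^ 2)).congr_deriv (by simp)

theorem IsPositive.potential_smooth (hp : IsPositive M φ) : SmoothOn (potential φ) (region M) :=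
  ((smoothOn_snd.mul hp.smooth).add (smoothOn_rho.mul (hp.smooth.ps (region_isOpen hp.isOpen)))).div
    hp.smooth fun _ _ h => (hp.pos h).ne'

/-- This is the equation for φ_s multiplied by r² - s². In product form it also holds where the
denominator vanishes. -/
theorem IsPositive.potential_mul_denU (hp : IsPositive M φ) {r s : ℝ} (hrs : (r, s) ∈ region M) :
    potential φ r s * denU (coefP φ) (coefQ φ) r s = numU (coefP φ) r s := by
  have h1 := (hp.derivative_equations hrs).2
  have h0 := (hp.pos hrs).ne'
  rw [potential, denU, numU, div_mul_eq_mul_div, div_eq_iff h0]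
  linear_combination -(r ^ 2 - s ^ 2) * h1

/-- The second derivatives φ_ss and φ_rs enter only through the combination that defines Q; the
formula for φ_r and the relation defining P remove the rest. -/
theorem IsPositive.satisfiesCompatibility (hp : IsPositive M φ) :
    SatisfiesCompatibility M (coefP φ) (coefQ φ) (potential φ) := by
  intro r s hrs
  have hD := region_isOpen hp.isOpen
  have h0 := (hp.pos hrs).ne'
  have hps := hp.smooth.ps hD
  have d1 := ((((hasDerivAt_id s).mul (hp.smooth.hasDerivAt_snd hD hrs)).add
    ((hasDerivAt_rho_snd r s).mul (hps.hasDerivAt_snd hD hrs))).div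
    (hp.smooth.hasDerivAt_snd hD hrs) h0).deriv
  have d2 := ((((hp.smooth.hasDerivAt_fst hD hrs).const_mul s).add
    ((hasDerivAt_rho_fst r s).mul (hps.hasDerivAt_fst hD hrs))).div
    (hp.smooth.hasDerivAt_fst hD hrs) h0).deriv
  simp only [id_eq, one_mul, Pi.add_apply, Pi.mul_apply, hp.smooth.pr_ps_comm hD hrs] at d1 d2
  have e1 : ps (potential φ) r s = _ := d1
  have e2 : pr (potential φ) r s = _ := d2
  rw [e1, e2]
  simp only [potential]
  have c1 := hp.coefP_eq hrs
  have c2 := hp.coefQ_eq hrs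
  have c3 := (hp.derivative_equations hrs).1
  field_simp
  linear_combination (-s * (r ^ 2 - s ^ 2) * φ r s) * c2 + (2 * (r ^ 2 - s ^ 2) * s * φ r s) * c3 +
    (r ^ 2 - s ^ 2) * (φ r s + s * ps φ r s) * c1

/-- The integral is chosen as log φ - ½ log(r² - s²). -/
theorem IsPositive.exists_integral (hp : IsPositive M φ) :
    ∃ Θ : ℝ → ℝ → ℝ, IsIntegralInS Θ (fun r s => potential φ r s / (r ^ 2 - s ^ 2)) (region M) ∧
      ∀ r s : ℝ, (r, s) ∈ region M → φ r s = Real.sqrt (r ^ 2 - s ^ 2) * Real.exp (Θ r s) := by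
  have hD := region_isOpen hp.isOpen
  refine ⟨fun r s => Real.log (φ r s) - Real.log (r ^ 2 - s ^ 2) / 2, ⟨?_, fun r s hrs => ?_⟩,
    fun r s hrs => ?_⟩
  · exact (ContDiffOn.log hp.smooth fun p h => (hp.pos h).ne').sub
      ((ContDiffOn.log smoothOn_rho fun p h => (region_rho_pos h).ne').div_const 2)
  · have h0 := (hp.pos hrs).ne'
    have hρ := (region_rho_pos hrs).ne'
    have h1 := ((hp.smooth.hasDerivAt_snd hD hrs).log h0).sub
      (((hasDerivAt_rho_snd r s).log hρ).div_const 2)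
    refine h1.congr_deriv ?_
    simp only [potential]
    field_simp
    ring
  · have h0 := hp.pos hrs
    have hρ := region_rho_pos hrs
    rw [Real.exp_sub, Real.exp_log h0, Real.exp_half, Real.exp_log hρ]
    have := (Real.sqrt_pos.2 hρ).ne'
    field_simp

/-- Since 2Q - sQ_s = 2g, the denominator is 2gρ - sP - 1. If it vanished on an open set, so would
its s-derivative, and the numerator too because U is finite. These relations give P = -2gs, hence 1
- 2r²g = 0, which can hold for one radius only. -/
theorem IsSolution.denU_dense (h : IsSolution M φ (coefP φ) (coefQ φ) g b K)
    (hp : IsPositive M φ) (hz : {r | r ∈ radii M ∧ 1 - 2 * r ^ 2 * g r = 0}.Subsingleton) :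
    region M ⊆ closure {p | p ∈ region M ∧ denU (coefP φ) (coefQ φ) p.1 p.2 ≠ 0} := by
  rintro ⟨r₀, s₀⟩ hrs₀
  have hD := region_isOpen h.isOpen
  by_contra hcl
  have hO : (closure {p | p ∈ region M ∧ denU (coefP φ) (coefQ φ) p.1 p.2 ≠ 0})ᶜ ∩ region M ∈
      nhds (r₀, s₀) :=
    (isClosed_closure.isOpen_compl.inter hD).mem_nhds ⟨hcl, hrs₀⟩
  obtain ⟨V, hV, W, hW, hVW⟩ := mem_nhds_prod_iff.1 hO
  have hVr : ∀ r ∈ V, r ∈ radii M := fun r hr =>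
    (hVW (Set.mk_mem_prod hr (mem_of_mem_nhds hW))).2.1
  have hzero : ∀ r ∈ V, ∀ s ∈ W, denU (coefP φ) (coefQ φ) r s = 0 := by
    intro r hr s hs
    by_contra hne
    have := hVW (Set.mk_mem_prod hr hs)
    exact this.1 (subset_closure ⟨this.2, hne⟩)
  obtain ⟨r, hr, hrw⟩ : ∃ r ∈ V, 1 - 2 * r ^ 2 * g r ≠ 0 := by
    obtain ⟨r, hr, hr'⟩ := (infinite_of_mem_nhds r₀ hV).exists_notMem_finite hz.finite
    exact ⟨r, hr, fun h0 => hr' ⟨hVr r hr, h0⟩⟩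
  obtain ⟨s, hs, hs0⟩ : ∃ s ∈ interior W, s ≠ 0 := by
    obtain ⟨s, hs, hs'⟩ := (infinite_of_mem_nhds s₀ (interior_mem_nhds.2 hW)).exists_notMem_finite
      (Set.finite_singleton (0 : ℝ))
    exact ⟨s, hs, hs'⟩
  have hrs : (r, s) ∈ region M := (hVW (Set.mk_mem_prod hr (interior_subset hs))).2
  have hρ := (region_rho_pos hrs).ne'
  have hden : ∀ t ∈ interior W,
      1 - 2 * g r * (r ^ 2 - t ^ 2) + t * coefP φ r t = 0 := by
    intro t ht
    have h1 := hzero r hr t (interior_subset ht)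
    have hrt : (r, t) ∈ region M := (hVW (Set.mk_mem_prod hr (interior_subset ht))).2
    rw [denU, h.ps_Q hrt, h.Q_eq hrt] at h1
    linear_combination -h1
  have hd : HasDerivAt (fun t => 1 - 2 * g r * (r ^ 2 - t ^ 2) + t * coefP φ r t)
      (4 * g r * s + (coefP φ r s + s * ps (coefP φ) r s)) s := by
    refine ((((hasDerivAt_rho_snd r s).const_mul (2 * g r)).const_sub 1).add
      ((hasDerivAt_id s).mul (h.smooth_P.hasDerivAt_snd hD hrs))).congr_deriv ?_
    simp; ring
  have h0 := hd.unique ((hasDerivAt_const s (0 : ℝ)).congr_of_eventuallyEq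
    (Filter.eventually_of_mem (isOpen_interior.mem_nhds hs) hden))
  have h2 := hp.potential_mul_denU hrs
  rw [hzero r hr s (interior_subset hs), mul_zero, numU] at h2
  have h3 := hden s hs
  have h4 : s * ps (coefP φ) r s - 2 * coefP φ r s - 2 * g r * s = 0 := by
    apply mul_left_cancel₀ hρ
    linear_combination -h2 + s * h3
  apply hrw
  have h5 : coefP φ r s = -2 * g r * s := by linear_combination (h0 - h4) / 3
  rw [h5] at h3
  linear_combination h3

theorem IsSolution.isU (h : IsSolution M φ (coefP φ) (coefQ φ) g b K)
    (hp : IsPositive M φ) (hz : {r | r ∈ radii M ∧ 1 - 2 * r ^ 2 * g r = 0}.Subsingleton) :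
    IsU M (coefP φ) (coefQ φ) (potential φ) :=
  ⟨hp.potential_smooth, h.denU_dense hp hz, fun _ _ hrs hne => by
    rw [eq_div_iff hne, hp.potential_mul_denU hrs]⟩

end Compatibility

/-! ### The Riccati system and its first integral -/

section Riccati

variable {𝕜 : Type*} [RCLike 𝕜] {n : ℕ} {M : Set (E n)}

theorem hasDerivAt_ofReal {f : ℝ → ℝ} {f' x : ℝ} (h : HasDerivAt f f' x) :
    HasDerivAt (fun t => (f t : 𝕜)) (f' : 𝕜) x :=
  (RCLike.ofRealCLM (K := 𝕜)).hasFDerivAt.comp_hasDerivAt x h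

/-- A solution `H` of the first order system satisfied by `P + m φ`, `m² = -K`. -/
structure IsRiccati (M : Set (E n)) (g b : ℝ → ℝ) (H Hr Hs : ℝ → ℝ → 𝕜) : Prop where
  deriv_fst : ∀ {r s : ℝ}, (r, s) ∈ region M → HasDerivAt (fun t => H t s) (Hr r s) r
  deriv_snd : ∀ {r s : ℝ}, (r, s) ∈ region M → HasDerivAt (fun t => H r t) (Hs r s) s
  fst_eq : ∀ {r s : ℝ}, (r, s) ∈ region M → Hr r s =
    (r : 𝕜) * (2 * (b r : 𝕜) * s * (1 + (s * H r s + ((r : 𝕜) ^ 2 - (s : 𝕜) ^ 2) * Hs r s)) +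
      H r s * Hs r s)
  snd_eq : ∀ {r s : ℝ}, (r, s) ∈ region M → Hs r s =
    2 * (g r : 𝕜) * (1 + (s * H r s + ((r : 𝕜) ^ 2 - (s : 𝕜) ^ 2) * Hs r s)) +
      H r s * (H r s - s * Hs r s)

/-- The function `ℓ = (1 - 2r²g) H - 2gs`. -/
def linPart (g : ℝ → ℝ) (H : ℝ → ℝ → 𝕜) (r s : ℝ) : 𝕜 :=
  ((1 - 2 * r ^ 2 * g r : ℝ) : 𝕜) * H r s - ((2 * g r * s : ℝ) : 𝕜)

/-- The function `N = 1 + 2sH + r²H²`. -/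
def quadPart (H : ℝ → ℝ → 𝕜) (r s : ℝ) : 𝕜 :=
  1 + ((2 * s : ℝ) : 𝕜) * H r s + ((r ^ 2 : ℝ) : 𝕜) * (H r s * H r s)

/-- The function `D = 1 - 2r²g + 2gs² + sH`. -/
def denPart (g : ℝ → ℝ) (H : ℝ → ℝ → 𝕜) (r s : ℝ) : 𝕜 :=
  ((1 - 2 * r ^ 2 * g r + 2 * g r * s ^ 2 : ℝ) : 𝕜) + s * H r s

namespace IsRiccati

variable {g b T : ℝ → ℝ} {H Hr Hs : ℝ → ℝ → 𝕜}

/-- The s-equation of the system, solved for V = H - sH_s in the form V D = ℓ. -/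
theorem mul_denPart (h : IsRiccati M g b H Hr Hs) {r s : ℝ} (hrs : (r, s) ∈ region M) :
    (H r s - s * Hs r s) * denPart g H r s = linPart g H r s := by
  have := h.snd_eq hrs
  rw [denPart, linPart]
  push_cast
  linear_combination (-(s : 𝕜)) * this

theorem denPart_sq (r s : ℝ) :
    (r : 𝕜) ^ 2 * (denPart g H r s ^ 2 + ((r : 𝕜) ^ 2 - (s : 𝕜) ^ 2) * linPart g H r s ^ 2) =
      quadPart H r s * (((1 - 2 * r ^ 2 * g r) ^ 2 * (r ^ 2 - s ^ 2) + s ^ 2 : ℝ) : 𝕜) := by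
  rw [denPart, linPart, quadPart]
  push_cast
  ring

/-- The final relation says that ℓ² / N has zero s-derivative, wherever the quotient makes sense. -/
theorem exists_deriv_snd (h : IsRiccati M g b H Hr Hs) {r s : ℝ} (hrs : (r, s) ∈ region M) :
    ∃ L' N' : 𝕜, HasDerivAt (fun t => linPart g H r t) L' s ∧
      HasDerivAt (fun t => quadPart H r t) N' s ∧
      N' * linPart g H r s = 2 * quadPart H r s * L' := by
  have h1 := h.deriv_snd hrs
  have h2 := h.snd_eq hrs
  have d2 : HasDerivAt (fun t : ℝ => ((2 * g r * t : ℝ) : 𝕜)) ((2 * g r * 1 : ℝ) : 𝕜) s :=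
    hasDerivAt_ofReal ((hasDerivAt_id s).const_mul (2 * g r))
  have d3 : HasDerivAt (fun t : ℝ => ((2 * t : ℝ) : 𝕜)) ((2 * 1 : ℝ) : 𝕜) s :=
    hasDerivAt_ofReal ((hasDerivAt_id s).const_mul 2)
  refine ⟨_, _, (h1.const_mul _).sub d2,
    ((d3.mul h1).const_add 1).add ((h1.mul h1).const_mul _), ?_⟩
  rw [linPart, quadPart]
  push_cast
  linear_combination (-2 : 𝕜) * h2

/-- In r the same relation holds up to the factor 4rg + 4r³b, the logarithmic derivative of T; hence
the weight T in the first integral Tℓ² / N. -/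
theorem exists_deriv_fst (h : IsRiccati M g b H Hr Hs) {r s : ℝ} (hrs : (r, s) ∈ region M)
    (hg : HasDerivAt g (r * b r * (1 - 2 * r ^ 2 * g r) - 2 * r * g r ^ 2) r) :
    ∃ L' N' : 𝕜, HasDerivAt (fun t => linPart g H t s) L' r ∧
      HasDerivAt (fun t => quadPart H t s) N' r ∧
      N' * linPart g H r s = 2 * quadPart H r s * L' +
        ((4 * r * g r + 4 * r ^ 3 * b r : ℝ) : 𝕜) * linPart g H r s * quadPart H r s := by
  have h1 := h.deriv_fst hrs
  have h2 := h.snd_eq hrs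
  have h3 := h.fst_eq hrs
  have d0 : HasDerivAt (fun t : ℝ => t ^ 2) (2 * r) r := by simpa using hasDerivAt_pow 2 r
  have d1 : HasDerivAt (fun t : ℝ => ((1 - 2 * t ^ 2 * g t : ℝ) : 𝕜)) _ r :=
    hasDerivAt_ofReal (((d0.const_mul 2).mul hg).const_sub 1)
  have d2 : HasDerivAt (fun t : ℝ => ((2 * g t * s : ℝ) : 𝕜)) _ r :=
    hasDerivAt_ofReal ((hg.const_mul 2).mul_const s)
  have d3 : HasDerivAt (fun t : ℝ => ((t ^ 2 : ℝ) : 𝕜)) _ r := hasDerivAt_ofReal d0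
  refine ⟨_, _, (d1.mul h1).sub d2,
    ((h1.const_mul _).const_add 1).add (d3.mul (h1.mul h1)), ?_⟩
  have e : denPart g H r s * Hs r s =
      H r s ^ 2 + 2 * (g r : 𝕜) * s * H r s + 2 * (g r : 𝕜) := by
    rw [denPart]; push_cast; linear_combination h2
  rw [h3, linPart, quadPart]
  rw [denPart] at e
  push_cast at e ⊢
  linear_combination (2 * (r : 𝕜) * (2 * b r * s * ((r : 𝕜) ^ 2 - (s : 𝕜) ^ 2) + H r s)) * (-e)

theorem wronskian_snd (h : IsRiccati M g b H Hr Hs) {r s : ℝ} (hrs : (r, s) ∈ region M) :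
    ∃ X' N' : 𝕜, HasDerivAt (fun t => (T r : 𝕜) * linPart g H r t ^ 2) X' s ∧
      HasDerivAt (fun t => quadPart H r t) N' s ∧
      X' * quadPart H r s = (T r : 𝕜) * linPart g H r s ^ 2 * N' := by
  obtain ⟨L', N', hL, hN, e⟩ := h.exists_deriv_snd hrs
  refine ⟨_, _, (hL.pow 2).const_mul _, hN, ?_⟩
  push_cast
  linear_combination (-(T r : 𝕜) * linPart g H r s) * e

theorem wronskian_fst (h : IsRiccati M g b H Hr Hs) {r s : ℝ} (hrs : (r, s) ∈ region M)
    (hg : HasDerivAt g (r * b r * (1 - 2 * r ^ 2 * g r) - 2 * r * g r ^ 2) r)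
    (hT : HasDerivAt T ((4 * r * g r + 4 * r ^ 3 * b r) * T r) r) :
    ∃ X' N' : 𝕜, HasDerivAt (fun t => (T t : 𝕜) * linPart g H t s ^ 2) X' r ∧
      HasDerivAt (fun t => quadPart H t s) N' r ∧
      X' * quadPart H r s = (T r : 𝕜) * linPart g H r s ^ 2 * N' := by
  obtain ⟨L', N', hL, hN, e⟩ := h.exists_deriv_fst hrs hg
  refine ⟨_, _, (hasDerivAt_ofReal hT).mul (hL.pow 2), hN, ?_⟩
  push_cast at e ⊢
  linear_combination (-(T r : 𝕜) * linPart g H r s) * e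

end IsRiccati

theorem hasDerivAt_div_of_wronskian {u v : ℝ → 𝕜} {u' v' : 𝕜} {x : ℝ} (hu : HasDerivAt u u' x)
    (hv : HasDerivAt v v' x) (h0 : v x ≠ 0) (h : u' * v x = u x * v') :
    HasDerivAt (fun t => u t / v t) 0 x :=
  (hu.div hv h0).congr_deriv (by rw [h, sub_self, zero_div])

theorem eq_of_hasDerivAt_zero {f : ℝ → 𝕜} {x y : ℝ}
    (h : ∀ t ∈ Set.uIcc x y, HasDerivAt f 0 t) : f x = f y := by
  have := (convex_uIcc x y).norm_image_sub_le_of_norm_hasDerivWithin_le (f := f) (C := 0)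
    (fun t ht => (h t ht).hasDerivWithinAt) (fun t _ => by simp)
    Set.right_mem_uIcc Set.left_mem_uIcc
  rw [zero_mul] at this
  exact sub_eq_zero.1 (norm_le_zero_iff.1 this)

/-- Only a path of three axis-parallel segments has to lie in `D`, so `D` need not be convex and the
path can avoid singular points. -/
theorem eq_of_partials_zero {f : ℝ → ℝ → 𝕜} {D : Set (ℝ × ℝ)}
    (hr : ∀ r s, (r, s) ∈ D → HasDerivAt (fun t => f t s) 0 r)
    (hs : ∀ r s, (r, s) ∈ D → HasDerivAt (fun t => f r t) 0 s) {r₁ r₂ s₁ s₂ s' : ℝ}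
    (h1 : ∀ t ∈ Set.uIcc s₁ s', (r₁, t) ∈ D) (h2 : ∀ t ∈ Set.uIcc r₁ r₂, (t, s') ∈ D)
    (h3 : ∀ t ∈ Set.uIcc s' s₂, (r₂, t) ∈ D) : f r₁ s₁ = f r₂ s₂ :=
  (eq_of_hasDerivAt_zero fun t ht => hs _ _ (h1 t ht)).trans
    ((eq_of_hasDerivAt_zero (f := fun t => f t s') fun t ht => hr _ _ (h2 t ht)).trans
      (eq_of_hasDerivAt_zero fun t ht => hs _ _ (h3 t ht)))

theorem region_uIcc {r s t : ℝ} (hs : (r, s) ∈ region M) (ht : (r, t) ∈ region M) {x : ℝ}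
    (hx : x ∈ Set.uIcc s t) : (r, x) ∈ region M := by
  refine ⟨hs.1, abs_lt.2 ?_⟩
  have h1 := abs_lt.1 hs.2
  have h2 := abs_lt.1 ht.2
  obtain ⟨h3, h4⟩ := hx
  exact ⟨lt_of_lt_of_le (lt_inf_iff.2 ⟨h1.1, h2.1⟩) h3,
    lt_of_le_of_lt h4 (sup_lt_iff.2 ⟨h1.2, h2.2⟩)⟩

/-- Follows from r² `Tbar` = (1 - (1 - 2r²g)²) T. The resulting denominator is visibly nonzero for s
≠ 0. -/
theorem charFn_eq {g T : ℝ → ℝ} {r s : ℝ} (hr : 0 < r) :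
    (r ^ 2 - s ^ 2) * (4 * g r * (1 - r ^ 2 * g r) * T r) - T r =
        -(T r * ((1 - 2 * r ^ 2 * g r) ^ 2 * (r ^ 2 - s ^ 2) + s ^ 2) / r ^ 2) ∧
      charFn T (fun r => 4 * g r * (1 - r ^ 2 * g r) * T r) r s = -(r ^ 2 * (r ^ 2 - s ^ 2) /
        (T r * ((1 - 2 * r ^ 2 * g r) ^ 2 * (r ^ 2 - s ^ 2) + s ^ 2))) := by
  have e : (r ^ 2 - s ^ 2) * (4 * g r * (1 - r ^ 2 * g r) * T r) - T r =
      -(T r * ((1 - 2 * r ^ 2 * g r) ^ 2 * (r ^ 2 - s ^ 2) + s ^ 2) / r ^ 2) := by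
    field_simp
    ring
  refine ⟨e, ?_⟩
  simp only [charFn]
  rw [e, div_neg, div_div_eq_mul_div, mul_comm]

theorem modulus_pos {g : ℝ → ℝ} {r s : ℝ} (h : (r, s) ∈ regionNe M) :
    0 < (1 - 2 * r ^ 2 * g r) ^ 2 * (r ^ 2 - s ^ 2) + s ^ 2 := by
  have h1 := region_rho_pos h.1
  have h2 : s ≠ 0 := h.2
  positivity

/-- Insert N = γTℓ² and ℓ = VD into r²(D² + ρℓ²) = N((1 - 2r²g)²ρ + s²) and cancel D². This gives
r²(1 + ρV²) = γTV²((1 - 2r²g)²ρ + s²), which is the claim rewritten in terms of `charFn`. -/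
theorem IsRiccati.sq_mul_eq {g b T : ℝ → ℝ} {H Hr Hs : ℝ → ℝ → 𝕜} (h : IsRiccati M g b H Hr Hs)
    (hT : ∀ r, 0 < T r) {r s : ℝ} (hrs : (r, s) ∈ regionNe M) {γ : 𝕜}
    (hγ : quadPart H r s = γ * (T r * linPart g H r s ^ 2)) (h0 : linPart g H r s ≠ 0) :
    ((r ^ 2 - s ^ 2 : ℝ) : 𝕜) * (H r s - s * Hs r s) ^ 2 *
        (γ + (charFn T (fun r => 4 * g r * (1 - r ^ 2 * g r) * T r) r s : ℝ)) =
      -(charFn T (fun r => 4 * g r * (1 - r ^ 2 * g r) * T r) r s : ℝ) := by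
  have key := h.mul_denPart hrs.1
  have hD : denPart g H r s ≠ 0 := fun h1 => h0 (by rw [← key, h1, mul_zero])
  have hN := IsRiccati.denPart_sq (g := g) (H := H) r s
  rw [(charFn_eq (region_pos hrs.1)).2]
  have hm : (((1 - 2 * r ^ 2 * g r) ^ 2 * (r ^ 2 - s ^ 2) + s ^ 2 : ℝ) : 𝕜) ≠ 0 :=
    RCLike.ofReal_ne_zero.2 (modulus_pos hrs).ne'
  have hT0 : (T r : 𝕜) ≠ 0 := RCLike.ofReal_ne_zero.2 (hT r).ne'
  have hr : (r : 𝕜) ≠ 0 := RCLike.ofReal_ne_zero.2 (region_pos hrs.1).ne'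
  generalize (1 - 2 * r ^ 2 * g r) ^ 2 * (r ^ 2 - s ^ 2) + s ^ 2 = m at hm hN ⊢
  rw [hγ] at hN
  push_cast
  generalize H r s - s * Hs r s = V at key ⊢
  rw [← key] at hN
  have e : (r : 𝕜) ^ 2 * (1 + ((r : 𝕜) ^ 2 - (s : 𝕜) ^ 2) * V ^ 2) = γ * T r * V ^ 2 * m := by
    apply mul_right_cancel₀ (pow_ne_zero 2 hD)
    linear_combination hN
  field_simp
  linear_combination (-((r : 𝕜) ^ 2 - (s : 𝕜) ^ 2)) * e

end Riccati

/-! ### Extracting η for real H -/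

section RealCase

variable {n : ℕ} {M : Set (E n)}

theorem region_convex (hc : (radii M).OrdConnected) : Convex ℝ (region M) := by
  rintro ⟨r, s⟩ ⟨h1, h2⟩ ⟨r', s'⟩ ⟨h1', h2'⟩ a b ha hb hab
  refine ⟨hc.convex h1 h1' ha hb hab, abs_lt.2 ?_⟩
  have h3 := abs_lt.1 h2
  have h4 := abs_lt.1 h2'
  simp only [Prod.smul_mk, Prod.mk_add_mk, smul_eq_mul] at h3 h4 ⊢
  rcases ha.eq_or_lt with rfl | ha
  · constructor <;> nlinarith
  · constructor <;> nlinarith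

/-- For real H, N = (1 + sH)² + ρH², and the two squares cannot vanish together. -/
theorem quadPart_pos {H : ℝ → ℝ → ℝ} {r s : ℝ} (h : (r, s) ∈ region M) : 0 < quadPart H r s := by
  have h1 := region_rho_pos h
  have e : quadPart H r s = (1 + s * H r s) ^ 2 + (r ^ 2 - s ^ 2) * H r s ^ 2 := by
    simp only [quadPart, RCLike.ofReal_real_eq_id, id]; ring
  rw [e]
  by_cases h0 : H r s = 0
  · simp [h0]
  · positivity

theorem charFn_neg {g T : ℝ → ℝ} (hT : ∀ r, 0 < T r) {r s : ℝ} (h : (r, s) ∈ regionNe M) :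
    charFn T (fun r => 4 * g r * (1 - r ^ 2 * g r) * T r) r s < 0 := by
  rw [(charFn_eq (region_pos h.1)).2]
  have := modulus_pos (g := g) h
  have := region_pos h.1
  have := region_rho_pos h.1
  have := hT r
  exact neg_neg_of_pos (by positivity)

/-- Here N > 0, so Tℓ²/N is a constant c on the whole region. For c ≠ 0, ρV² = -ψ/(c⁻¹ + ψ) and V
has constant sign. -/
theorem IsRiccati.exists_eta_real {g b T : ℝ → ℝ} {H Hr Hs : ℝ → ℝ → ℝ}
    (h : IsRiccati M g b H Hr Hs) (hc : (radii M).OrdConnected) (hne : (radii M).Nonempty)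
    (hV : ContinuousOn (fun p : ℝ × ℝ => H p.1 p.2 - p.2 * Hs p.1 p.2) (region M))
    (hg : ∀ r ∈ radii M, HasDerivAt g (r * b r * (1 - 2 * r ^ 2 * g r) - 2 * r * g r ^ 2) r)
    (hT : ∀ r, 0 < T r)
    (hT' : ∀ r ∈ radii M, HasDerivAt T ((4 * r * g r + 4 * r ^ 3 * b r) * T r) r) :
    ∃ η : ℝ → ℝ, ContDiffOn ℝ ∞ η ((fun p : ℝ × ℝ =>
        charFn T (fun r => 4 * g r * (1 - r ^ 2 * g r) * T r) p.1 p.2) '' regionNe M) ∧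
      ∀ r s : ℝ, (r, s) ∈ regionNe M → Real.sqrt (r ^ 2 - s ^ 2) * (H r s - s * Hs r s) =
        η (charFn T (fun r => 4 * g r * (1 - r ^ 2 * g r) * T r) r s) := by
  obtain ⟨r₀, hr₀⟩ := hne
  set c : ℝ := T r₀ * linPart g H r₀ 0 ^ 2 / quadPart H r₀ 0 with hcdef
  have hconst : ∀ r s, (r, s) ∈ region M → T r * linPart g H r s ^ 2 / quadPart H r s = c := by
    intro r s hrs
    refine eq_of_partials_zero (f := fun r s => T r * linPart g H r s ^ 2 / quadPart H r s)
      (D := region M) (s' := 0) (fun r s hrs => ?_) (fun r s hrs => ?_)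
      (fun t ht => region_uIcc hrs (region_mem_zero hrs) ht)
      (fun t ht => radii_mem_region (hc.uIcc_subset hrs.1 hr₀ ht))
      (fun t ht => region_uIcc (radii_mem_region hr₀) (radii_mem_region hr₀) ht)
    · obtain ⟨X', N', hX, hN, e⟩ := h.wronskian_fst hrs (hg r hrs.1) (hT' r hrs.1)
      exact hasDerivAt_div_of_wronskian hX hN (quadPart_pos hrs).ne' e
    · obtain ⟨X', N', hX, hN, e⟩ := h.wronskian_snd (T := T) hrs
      exact hasDerivAt_div_of_wronskian hX hN (quadPart_pos hrs).ne' e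
  by_cases hc0 : c = 0
  -- If c = 0, then ℓ vanishes identically; for s ≠ 0 the identity `IsRiccati.denPart_sq` keeps D
  -- nonzero, so V = 0 there.
  · refine ⟨fun _ => 0, contDiffOn_const, fun r s hrs => ?_⟩
    have h1 := hconst r s hrs.1
    have hN := quadPart_pos (H := H) hrs.1
    rw [hc0, div_eq_zero_iff, or_iff_left hN.ne', mul_eq_zero, or_iff_right (hT r).ne',
      pow_eq_zero_iff two_ne_zero] at h1
    have h2 := IsRiccati.denPart_sq (g := g) (H := H) r s
    rw [h1] at h2
    have hD : denPart g H r s ≠ 0 := by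
      intro hD
      rw [hD] at h2
      have h3 := mul_pos hN (modulus_pos (g := g) hrs)
      simp only [RCLike.ofReal_real_eq_id, id] at h2
      rw [← h2] at h3
      simp at h3
    have h3 := h.mul_denPart hrs.1
    rw [h1] at h3
    have h4 := (mul_eq_zero.1 h3).resolve_right hD
    simp only [RCLike.ofReal_real_eq_id, id] at h4
    rw [h4, mul_zero]
  · have hL : ∀ r s, (r, s) ∈ region M → linPart g H r s ≠ 0 := by
      intro r s hrs h0
      apply hc0
      rw [← hconst r s hrs, h0]
      simp
    have hV0 : ∀ p ∈ region M, |H p.1 p.2 - p.2 * Hs p.1 p.2| ≠ 0 := by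
      rintro ⟨r, s⟩ hrs h0
      have h3 := h.mul_denPart hrs
      apply hL r s hrs
      rw [abs_eq_zero] at h0
      simp only [RCLike.ofReal_real_eq_id, id] at h0 h3
      rw [← h3, h0, zero_mul]
    have hsq : ∀ r s, (r, s) ∈ regionNe M → (r ^ 2 - s ^ 2) * (H r s - s * Hs r s) ^ 2 *
        (c⁻¹ + charFn T (fun r => 4 * g r * (1 - r ^ 2 * g r) * T r) r s) =
          -charFn T (fun r => 4 * g r * (1 - r ^ 2 * g r) * T r) r s := by
      intro r s hrs
      refine h.sq_mul_eq hT hrs ?_ (hL r s hrs.1)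
      have h1 := hconst r s hrs.1
      rw [div_eq_iff (quadPart_pos hrs.1).ne'] at h1
      have h2 : ((T r : ℝ) : ℝ) = T r := rfl
      simp only [RCLike.ofReal_real_eq_id, id]
      rw [h1]
      field_simp
    have hpos : ∀ r s, (r, s) ∈ regionNe M →
        c⁻¹ + charFn T (fun r => 4 * g r * (1 - r ^ 2 * g r) * T r) r s ≠ 0 ∧
        (r ^ 2 - s ^ 2) * (H r s - s * Hs r s) ^ 2 =
          -charFn T (fun r => 4 * g r * (1 - r ^ 2 * g r) * T r) r s /
            (c⁻¹ + charFn T (fun r => 4 * g r * (1 - r ^ 2 * g r) * T r) r s) := by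
      intro r s hrs
      have h1 := hsq r s hrs
      have h2 := charFn_neg (g := g) hT hrs
      have h0 : c⁻¹ + charFn T (fun r => 4 * g r * (1 - r ^ 2 * g r) * T r) r s ≠ 0 := by
        intro h0
        rw [h0, mul_zero] at h1
        linarith
      exact ⟨h0, (eq_div_iff h0).2 h1⟩
    -- `charFn` is even in s, so one η must serve both s > 0 and s < 0. The sign of V is therefore
    -- fixed on the full connected region, across s = 0.
    obtain ⟨σ, hσ⟩ : ∃ σ : ℝ, ∀ p ∈ region M,
        H p.1 p.2 - p.2 * Hs p.1 p.2 = σ * |H p.1 p.2 - p.2 * Hs p.1 p.2| := by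
      rcases (region_convex hc).isPreconnected.eq_or_eq_neg_of_sq_eq hV hV.abs
        (fun p _ => (sq_abs _).symm) (fun {p} hp => hV0 p hp) with h1 | h1
      · exact ⟨1, fun p hp => by rw [one_mul]; exact h1 hp⟩
      · exact ⟨-1, fun p hp => by rw [neg_one_mul]; exact h1 hp⟩
    refine ⟨fun x => σ * Real.sqrt (-x / (c⁻¹ + x)), ?_, fun r s hrs => ?_⟩
    · rintro _ ⟨⟨r, s⟩, hrs, rfl⟩
      obtain ⟨h1, h2⟩ := hpos r s hrs
      have h3 : -charFn T (fun r => 4 * g r * (1 - r ^ 2 * g r) * T r) r s /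
            (c⁻¹ + charFn T (fun r => 4 * g r * (1 - r ^ 2 * g r) * T r) r s) ≠ 0 := by
        have := charFn_neg (g := g) hT hrs
        exact div_ne_zero (neg_ne_zero.2 this.ne) h1
      exact (contDiffAt_const.mul (ContDiffAt.sqrt (contDiffAt_id.neg.div
        (contDiffAt_const.add contDiffAt_id) h1) h3)).contDiffWithinAt
    · have h1 := hσ (r, s) hrs.1
      simp only at h1 ⊢
      rw [← (hpos r s hrs).2, Real.sqrt_mul (region_rho_pos hrs.1).le, Real.sqrt_sq_eq_abs]
      linear_combination Real.sqrt (r ^ 2 - s ^ 2) * h1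

end RealCase

/-! ### Extracting η for complex H -/

section ComplexCase

variable {n : ℕ} {M : Set (E n)}

theorem exists_ne_zero (hI : IsOpen (radii M)) (hne : (radii M).Nonempty) {g : ℝ → ℝ}
    (hz : {r | r ∈ radii M ∧ 1 - 2 * r ^ 2 * g r = 0}.Subsingleton) :
    ∃ r ∈ radii M, 1 - 2 * r ^ 2 * g r ≠ 0 := by
  by_contra! hall
  obtain ⟨r, hr⟩ := hne
  obtain ⟨ε, hε, hb⟩ := Metric.isOpen_iff.1 hI r hr
  have h1 : r + ε / 2 ∈ radii M := hb (by
    rw [Metric.mem_ball, Real.dist_eq, add_sub_cancel_left, abs_of_pos (by positivity)]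
    linarith)
  have := hz ⟨hr, hall r hr⟩ ⟨h1, hall _ h1⟩
  linarith

/-- The imaginary part of ℓ is (1 - 2r²g) Im H. If it vanishes, 1 - 2r²g = 0, and for s ≠ 0 the real
part then forces g = 0, a contradiction. -/
theorem linPart_ne_zero {g : ℝ → ℝ} {H : ℝ → ℝ → ℂ} {r s : ℝ} (hH : 0 < (H r s).im)
    (h : 1 - 2 * r ^ 2 * g r ≠ 0 ∨ s ≠ 0) : linPart g H r s ≠ 0 := by
  intro h0
  have him := congrArg Complex.im h0
  have hre := congrArg Complex.re h0
  simp only [linPart, RCLike.ofReal_eq_complex_ofReal, Complex.sub_im, Complex.sub_re, Complex.re_ofReal_mul,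
    Complex.im_ofReal_mul, Complex.ofReal_im, Complex.ofReal_re, Complex.zero_im,
    Complex.zero_re, sub_zero] at him hre
  have hw := (mul_eq_zero.1 him).resolve_right hH.ne'
  rw [hw, zero_mul, zero_sub, neg_eq_zero] at hre
  have hs := h.resolve_left (not_not.2 hw)
  have hg : g r = 0 := by
    have := (mul_eq_zero.1 hre).resolve_right hs
    linarith
  rw [hg] at hw
  simp at hw

/-- N is no longer known to be nonzero, so the quotient is inverted to N/(Tℓ²). Its possible
singularities lie on s = 0 at the zero of 1 - 2r²g. The path crosses between radii with s ≠ 0 and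
descends to s = 0 only at `r₀`, where 1 - 2r²g ≠ 0; both signs of s thus share the same constant. -/
theorem IsRiccati.quadPart_eq {g b T : ℝ → ℝ} {H Hr Hs : ℝ → ℝ → ℂ}
    (h : IsRiccati M g b H Hr Hs) (hc : (radii M).OrdConnected)
    (hH : ∀ r s, (r, s) ∈ region M → 0 < (H r s).im)
    (hg : ∀ r ∈ radii M, HasDerivAt g (r * b r * (1 - 2 * r ^ 2 * g r) - 2 * r * g r ^ 2) r)
    (hT : ∀ r, 0 < T r)
    (hT' : ∀ r ∈ radii M, HasDerivAt T ((4 * r * g r + 4 * r ^ 3 * b r) * T r) r)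
    {r₀ : ℝ} (hr₀ : r₀ ∈ radii M) (hw : 1 - 2 * r₀ ^ 2 * g r₀ ≠ 0) {r s : ℝ}
    (hrs : (r, s) ∈ regionNe M) :
    quadPart H r s / ((T r : ℂ) * linPart g H r s ^ 2) =
      quadPart H r₀ 0 / ((T r₀ : ℂ) * linPart g H r₀ 0 ^ 2) := by
  have hX : ∀ {r s}, (r, s) ∈ region M → linPart g H r s ≠ 0 →
      (T r : ℂ) * linPart g H r s ^ 2 ≠ 0 := fun {r s} h1 h2 =>
    mul_ne_zero (Complex.ofReal_ne_zero.2 (hT r).ne') (pow_ne_zero 2 h2)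
  have hr := region_pos hrs.1
  have hr₀' : 0 < r₀ := hr₀.1
  have hm : 0 < min r r₀ := lt_min hr hr₀'
  -- `s'` has the sign of s, so the first leg avoids 0, and |s'| is below every radius between r and
  -- `r₀`, so the horizontal leg stays in the region.
  obtain ⟨s', h1, h2⟩ : ∃ s', |s'| = min r r₀ / 2 ∧ ∀ t ∈ Set.uIcc s s', t ≠ 0 := by
    rcases lt_or_gt_of_ne (show s ≠ 0 from hrs.2) with hs | hs
    · refine ⟨-(min r r₀ / 2), by rw [abs_neg, abs_of_pos (by positivity)], fun t ht => ?_⟩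
      exact (lt_of_le_of_lt ht.2 (sup_lt_iff.2 ⟨hs, by linarith⟩)).ne
    · refine ⟨min r r₀ / 2, abs_of_pos (by positivity), fun t ht => ?_⟩
      exact (lt_of_lt_of_le (lt_inf_iff.2 ⟨hs, by linarith⟩) ht.1).ne'
  have hs' : ∀ t ∈ Set.uIcc r r₀, (t, s') ∈ region M := fun t ht =>
    ⟨hc.uIcc_subset hrs.1.1 hr₀ ht, by
      have : min r r₀ ≤ t := ht.1
      show |s'| < t
      linarith⟩
  have hs'0 : s' ≠ 0 := h2 s' Set.right_mem_uIcc
  refine eq_of_partials_zero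
    (f := fun r s => quadPart H r s / ((T r : ℂ) * linPart g H r s ^ 2))
    (D := {p | p ∈ region M ∧ linPart g H p.1 p.2 ≠ 0}) (s' := s') (fun r s hrs => ?_)
    (fun r s hrs => ?_) (fun t ht => ?_) (fun t ht => ?_) (fun t ht => ?_)
  · obtain ⟨X', N', hX', hN, e⟩ := h.wronskian_fst hrs.1 (hg r hrs.1.1) (hT' r hrs.1.1)
    exact hasDerivAt_div_of_wronskian hN hX' (hX hrs.1 hrs.2) 
      ((mul_comm _ _).trans (e.symm.trans (mul_comm _ _)))
  · obtain ⟨X', N', hX', hN, e⟩ := h.wronskian_snd (T := T) hrs.1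
    exact hasDerivAt_div_of_wronskian hN hX' (hX hrs.1 hrs.2) 
      ((mul_comm _ _).trans (e.symm.trans (mul_comm _ _)))
  · have := region_uIcc hrs.1 (hs' r Set.left_mem_uIcc) ht
    exact ⟨this, linPart_ne_zero (hH _ _ this) (Or.inr (h2 t ht))⟩
  · exact ⟨hs' t ht, linPart_ne_zero (hH _ _ (hs' t ht)) (Or.inr hs'0)⟩
  · have := region_uIcc (hs' r₀ Set.right_mem_uIcc) (radii_mem_region hr₀) ht
    exact ⟨this, linPart_ne_zero (hH _ _ this) (Or.inl hw)⟩

/-- The number Y = -i√ρ V satisfies Y² = ψ/(γ + ψ), and Re Y = √ρ Im V > 0. Hence Y is the principal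
square root of ψ/(γ + ψ), which is analytic off the negative axis, and Re(√ρ V) = -Im Y. -/
theorem IsRiccati.exists_eta_complex {g b T : ℝ → ℝ} {H Hr Hs : ℝ → ℝ → ℂ}
    (h : IsRiccati M g b H Hr Hs) (hc : (radii M).OrdConnected)
    (hH : ∀ r s, (r, s) ∈ region M → 0 < (H r s).im)
    (hV : ∀ r s, (r, s) ∈ region M → 0 < (H r s - s * Hs r s).im)
    (hg : ∀ r ∈ radii M, HasDerivAt g (r * b r * (1 - 2 * r ^ 2 * g r) - 2 * r * g r ^ 2) r)
    (hT : ∀ r, 0 < T r)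
    (hT' : ∀ r ∈ radii M, HasDerivAt T ((4 * r * g r + 4 * r ^ 3 * b r) * T r) r)
    {r₀ : ℝ} (hr₀ : r₀ ∈ radii M) (hw : 1 - 2 * r₀ ^ 2 * g r₀ ≠ 0) :
    ∃ η : ℝ → ℝ, ContDiffOn ℝ ∞ η ((fun p : ℝ × ℝ =>
        charFn T (fun r => 4 * g r * (1 - r ^ 2 * g r) * T r) p.1 p.2) '' regionNe M) ∧
      ∀ r s : ℝ, (r, s) ∈ regionNe M → Real.sqrt (r ^ 2 - s ^ 2) * (H r s - s * Hs r s).re =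
        η (charFn T (fun r => 4 * g r * (1 - r ^ 2 * g r) * T r) r s) := by
  set γ := quadPart H r₀ 0 / ((T r₀ : ℂ) * linPart g H r₀ 0 ^ 2) with hγ
  have hsq : ∀ r s, (r, s) ∈ regionNe M → ∃ Y : ℂ, 0 < Y.re ∧
      -Y.im = Real.sqrt (r ^ 2 - s ^ 2) * (H r s - s * Hs r s).re ∧
      γ + (charFn T (fun r => 4 * g r * (1 - r ^ 2 * g r) * T r) r s : ℝ) ≠ 0 ∧
      (charFn T (fun r => 4 * g r * (1 - r ^ 2 * g r) * T r) r s : ℝ) /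
        (γ + (charFn T (fun r => 4 * g r * (1 - r ^ 2 * g r) * T r) r s : ℝ)) = Y ^ 2 := by
    intro r s hrs
    have hL := linPart_ne_zero (g := g) (hH r s hrs.1) (Or.inr hrs.2)
    have h1 := h.quadPart_eq hc hH hg hT hT' hr₀ hw hrs
    rw [← hγ, div_eq_iff (mul_ne_zero (Complex.ofReal_ne_zero.2 (hT r).ne')
      (pow_ne_zero 2 hL))] at h1
    have h2 := h.sq_mul_eq hT hrs h1 hL
    have h3 := (charFn_neg (g := g) hT hrs).ne
    have hρ := region_rho_pos hrs.1
    have h4 : γ + (charFn T (fun r => 4 * g r * (1 - r ^ 2 * g r) * T r) r s : ℝ) ≠ 0 := by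
      intro h0
      simp only [RCLike.ofReal_eq_complex_ofReal] at h2
      rw [h0, mul_zero, eq_comm, neg_eq_zero, Complex.ofReal_eq_zero] at h2
      exact h3 h2
    have hS : ((Real.sqrt (r ^ 2 - s ^ 2) : ℝ) : ℂ) ^ 2 = ((r ^ 2 - s ^ 2 : ℝ) : ℂ) := by
      rw [← Complex.ofReal_pow, Real.sq_sqrt hρ.le]
    refine ⟨-Complex.I * (Real.sqrt (r ^ 2 - s ^ 2) * (H r s - s * Hs r s)), ?_, ?_, h4, ?_⟩
    · have := mul_pos (Real.sqrt_pos.2 hρ) (hV r s hrs.1)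
      rw [neg_mul, Complex.neg_re, Complex.I_mul_re, neg_neg, Complex.im_ofReal_mul]
      exact this
    · rw [neg_mul, Complex.neg_im, Complex.I_mul_im, neg_neg, Complex.re_ofReal_mul]
    · rw [div_eq_iff h4, mul_pow, mul_pow, hS, neg_sq, Complex.I_sq]
      simp only [RCLike.ofReal_eq_complex_ofReal] at h2
      linear_combination h2
  refine ⟨fun x => -(((x : ℂ) / (γ + x)) ^ (2⁻¹ : ℂ)).im, ?_, fun r s hrs => ?_⟩
  · rintro _ ⟨⟨r, s⟩, hrs, rfl⟩
    obtain ⟨Y, hY, -, h0, hYe⟩ := hsq r s hrs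
    have hslit : Y ^ 2 ∈ Complex.slitPlane := by
      rw [Complex.mem_slitPlane_iff, pow_two, Complex.mul_re, Complex.mul_im]
      by_cases hi : Y.im = 0
      · left
        rw [hi]
        nlinarith
      · right
        have := mul_ne_zero hY.ne' hi
        contrapose! this
        linarith
    have h1 : AnalyticAt ℂ (fun z : ℂ => (z / (γ + z)) ^ (2⁻¹ : ℂ))
        ((charFn T (fun r => 4 * g r * (1 - r ^ 2 * g r) * T r) r s : ℝ) : ℂ) :=
      (analyticAt_id.div (analyticAt_const.add analyticAt_id) h0).cpow analyticAt_const
        (by rw [← hYe] at hslit; exact hslit)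
    have h2 := (h1.contDiffAt (n := ∞)).restrict_scalars ℝ
    exact (Complex.imCLM.contDiff.contDiffAt.comp _
      (h2.comp _ Complex.ofRealCLM.contDiff.contDiffAt)).neg.contDiffWithinAt
  · obtain ⟨Y, hY, hre, -, hYe⟩ := hsq r s hrs
    simp only
    rw [hYe, Complex.sq_cpow_two_inv hY, hre]

end ComplexCase

/-! ### The form of P -/

section Form

variable {n : ℕ} {M : Set (E n)} {φ P Q : ℝ → ℝ → ℝ} {g b T : ℝ → ℝ} {K : ℝ}

namespace IsSolution

/-- Add m times the equations for φ to those for P. Because m² = -K, the curvature terms -Kφφ_s and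
-Kφ(φ - sφ_s) become the missing parts of the quadratic terms in H; and 2Q - sQ_s = 2g. -/
theorem isRiccati {𝕜 : Type*} [RCLike 𝕜] (h : IsSolution M φ P Q g b K) {m : 𝕜}
    (hm : m ^ 2 = -(K : 𝕜)) : IsRiccati M g b (fun r s => (P r s : 𝕜) + m * φ r s)
      (fun r s => (pr P r s : 𝕜) + m * pr φ r s) (fun r s => (ps P r s : 𝕜) + m * ps φ r s) where
  deriv_fst := fun {r s} hrs => (hasDerivAt_ofReal (h.smooth_P.hasDerivAt_fst
    (region_isOpen h.isOpen) hrs)).add ((hasDerivAt_ofReal (h.smooth.hasDerivAt_fst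
      (region_isOpen h.isOpen) hrs)).const_mul m)
  deriv_snd := fun {r s} hrs => (hasDerivAt_ofReal (h.smooth_P.hasDerivAt_snd
    (region_isOpen h.isOpen) hrs)).add ((hasDerivAt_ofReal (h.smooth.hasDerivAt_snd
      (region_isOpen h.isOpen) hrs)).const_mul m)
  fst_eq := fun {r s} hrs => by
    have h1 := congrArg (fun x : ℝ => (x : 𝕜)) (h.pr_P hrs)
    have h2 := congrArg (fun x : ℝ => (x : 𝕜)) (h.pr_phi hrs)
    rw [h.ps_Q hrs] at h1 h2
    push_cast at h1 h2
    linear_combination h1 + m * h2 - (r : 𝕜) * φ r s * ps φ r s * hm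
  snd_eq := fun {r s} hrs => by
    have h1 := congrArg (fun x : ℝ => (x : 𝕜)) (h.ps_P hrs)
    have h2 := congrArg (fun x : ℝ => (x : 𝕜)) (h.ps_phi hrs)
    rw [h.ps_Q hrs, h.Q_eq hrs] at h1 h2
    push_cast at h1 h2
    linear_combination h1 + m * h2 - (φ r s : 𝕜) * (φ r s - s * ps φ r s) * hm

theorem exists_eta (h : IsSolution M φ P Q g b K) (hc : (radii M).OrdConnected)
    (hne : (radii M).Nonempty) (hT : ∀ r, 0 < T r)
    (hT' : ∀ r ∈ radii M, HasDerivAt T ((4 * r * g r + 4 * r ^ 3 * b r) * T r) r) :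
    ∃ η : ℝ → ℝ, ContDiffOn ℝ ∞ η ((fun p : ℝ × ℝ =>
        charFn T (fun r => 4 * g r * (1 - r ^ 2 * g r) * T r) p.1 p.2) '' regionNe M) ∧
      ∀ r s : ℝ, (r, s) ∈ regionNe M → Real.sqrt (r ^ 2 - s ^ 2) * (P r s - s * ps P r s) =
        η (charFn T (fun r => 4 * g r * (1 - r ^ 2 * g r) * T r) r s) := by
  have hR := region_isOpen h.isOpen
  have hg := fun r (hr : r ∈ radii M) => h.hasDerivAt_g hr
  rcases le_or_gt K 0 with hK | hK
  -- For K ≤ 0 both real roots m = ±√(-K) are used; the average of the two values of H is P.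
  · have hV : ∀ m : ℝ, ContinuousOn (fun p : ℝ × ℝ => P p.1 p.2 + m * φ p.1 p.2 -
        p.2 * (ps P p.1 p.2 + m * ps φ p.1 p.2)) (region M) := fun m =>
      ContDiffOn.continuousOn ((h.smooth_P.add ((smoothOn_const m).mul h.smooth)).sub
        (smoothOn_snd.mul ((h.smooth_P.ps hR).add ((smoothOn_const m).mul (h.smooth.ps hR)))))
    have hm : Real.sqrt (-K) ^ 2 = -K := Real.sq_sqrt (neg_nonneg.2 hK)
    obtain ⟨η₁, h1, h1'⟩ := (h.isRiccati (m := Real.sqrt (-K)) hm).exists_eta_real hc hne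
      (hV _) hg hT hT'
    obtain ⟨η₂, h2, h2'⟩ := (h.isRiccati (m := -Real.sqrt (-K))
      ((neg_sq _).trans hm)).exists_eta_real hc hne (hV _) hg hT hT'
    refine ⟨fun x => (η₁ x + η₂ x) / 2, (h1.add h2).div_const 2, fun r s hrs => ?_⟩
    have e1 := h1' r s hrs
    have e2 := h2' r s hrs
    simp only [RCLike.ofReal_real_eq_id, id] at e1 e2 ⊢
    rw [← e1, ← e2]
    ring
  -- For K > 0 take m = i√K: P is the real part of H, and Im H = √K φ and Im V = √K (φ - sφ_s) are
  -- positive.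
  · obtain ⟨r₀, hr₀, hw⟩ := exists_ne_zero h.isOpen hne (h.subsingleton_zeros hc hne)
    have hk := Real.sqrt_pos.2 hK
    have hm : (Complex.I * (Real.sqrt K : ℂ)) ^ 2 = -(K : ℂ) := by
      rw [mul_pow, Complex.I_sq, ← Complex.ofReal_pow, Real.sq_sqrt hK.le, neg_one_mul]
    have hH : ∀ r s, (r, s) ∈ region M →
        0 < ((P r s : ℂ) + Complex.I * (Real.sqrt K : ℂ) * (φ r s : ℂ)).im := fun r s hrs => by
      have := mul_pos hk (h.pos hrs)
      simpa using this
    have hV : ∀ r s, (r, s) ∈ region M →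
        0 < ((P r s : ℂ) + Complex.I * (Real.sqrt K : ℂ) * (φ r s : ℂ) -
          s * ((ps P r s : ℂ) + Complex.I * (Real.sqrt K : ℂ) * (ps φ r s : ℂ))).im :=
      fun r s hrs => by
        have := mul_pos hk (h.intercept_pos hrs)
        rw [intercept] at this
        simp
        linarith
    obtain ⟨η, h1, h2⟩ := (h.isRiccati (𝕜 := ℂ) hm).exists_eta_complex hc hH hV hg hT hT' hr₀ hw
    refine ⟨η, h1, fun r s hrs => ?_⟩
    rw [← h2 r s hrs]
    simp

/-- For s ≠ 0 the function -P/s is itself an admissible integral, since its s-derivative is (P -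
sP_s)/s². The additive function h(r) is absorbed in this choice and can be taken to be 0. -/
theorem exists_hasFormP (h : IsSolution M φ P Q g b K) (hc : (radii M).OrdConnected)
    (hne : (radii M).Nonempty) (hT : ∀ r, 0 < T r)
    (hT' : ∀ r ∈ radii M, HasDerivAt T ((4 * r * g r + 4 * r ^ 3 * b r) * T r) r) :
    ∃ η : ℝ → ℝ, HasFormP M P T (fun r => 4 * g r * (1 - r ^ 2 * g r) * T r) (fun _ => 0) η := by
  obtain ⟨η, h1, h2⟩ := h.exists_eta hc hne hT hT'
  refine ⟨η, contDiffOn_const, fun r s hrs => ?_, h1, fun r s => -(P r s / s),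
    ⟨?_, fun r s hrs => ?_⟩, fun r s hrs => ?_⟩
  · rw [(charFn_eq (region_pos hrs.1)).1]
    have := modulus_pos (g := g) hrs
    have := region_pos hrs.1
    have := hT r
    exact (neg_neg_of_pos (by positivity)).ne
  · exact ((h.smooth_P.mono fun p hp => hp.1).div smoothOn_snd fun r s hrs => hrs.2).neg
  · have hs : s ≠ 0 := hrs.2
    have h3 := (h.smooth_P.hasDerivAt_snd (region_isOpen h.isOpen) hrs.1).div (hasDerivAt_id s) hs
    refine h3.neg.congr_deriv ?_
    have h4 := (Real.sqrt_pos.2 (region_rho_pos hrs.1)).ne'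
    simp only [id]
    rw [← h2 r s hrs]
    field_simp
    ring
  · have hs : s ≠ 0 := hrs.2
    field_simp
    ring

end IsSolution

end Form

theorem exists_isGivenBy {n : ℕ} (hn : 2 ≤ n) {M : Set (E n)} (hM : IsSymmetricDomain M)
    {F : E n → E n → ℝ} (hF : IsFinslerMetric M F) (hsym : IsSphericallySymmetric M F) :
    ∃ φ : ℝ → ℝ → ℝ, IsGivenBy M F φ ∧
      ∀ x ∈ M, ∀ y : E n, y ≠ 0 → F x y = ‖y‖ * φ ‖x‖ (inner ℝ x y / ‖y‖) := by
  obtain ⟨hI, -, -, -, hmem, -⟩ := radii_isOpen (by omega) hM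
  obtain ⟨e₀, e₁, he, -⟩ := exists_orthonormal_pair hn (0 : E n)
    (EuclideanSpace.single (⟨0, by omega⟩ : Fin n) 1) (by simp)
  have hφ := fun x (hx : x ∈ M) (y : E n) (hy : y ≠ 0) => eq_norm_mul_profile hn hF hsym he hx hy
  exact ⟨profile F e₀ e₁, ⟨hI, hmem, profile_smoothOn hF hmem he,
    fun x y hg => hφ x (hmem x hg.2.1) y hg.1⟩, hφ⟩

end SphFinsler

theorem theorem3 (n : ℕ) (hn : 3 ≤ n) (M : Set (SphFinsler.E n))
    (hM : SphFinsler.IsSymmetricDomain M)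
    (F : SphFinsler.E n → SphFinsler.E n → ℝ)
    (hF : SphFinsler.IsFinslerMetric M F)
    (hsym : SphFinsler.IsSphericallySymmetric M F)
    (hD : SphFinsler.IsDouglas M F)
    (hK : SphFinsler.HasConstantFlagCurvature M F) :
    ∃ φ : ℝ → ℝ → ℝ,
      -- `F` is given by `φ`
      (∀ x ∈ M, ∀ y : SphFinsler.E n, y ≠ 0 → F x y = ‖y‖ * φ ‖x‖ (inner ℝ x y / ‖y‖)) ∧
      SphFinsler.SmoothOn φ (SphFinsler.region M) ∧
      -- the form of `Q` and `P`
      (∃ g T Tbar h η : ℝ → ℝ,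
        ContDiffOn ℝ ∞ g (SphFinsler.radii M) ∧
        {r | r ∈ SphFinsler.radii M ∧ 1 - 2 * r ^ 2 * g r = 0}.Subsingleton ∧
        SphFinsler.AreTFunctions (SphFinsler.radii M) g T Tbar ∧
        SphFinsler.HasFormQ M (SphFinsler.coefQ φ) g ∧
        SphFinsler.HasFormP M (SphFinsler.coefP φ) T Tbar h η) ∧
      -- the function `U`, its compatibility equation, and the formula for `φ`
      (∃ U : ℝ → ℝ → ℝ,
        SphFinsler.IsU M (SphFinsler.coefP φ) (SphFinsler.coefQ φ) U ∧
        SphFinsler.SatisfiesCompatibility M (SphFinsler.coefP φ) (SphFinsler.coefQ φ) U ∧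
        ∃ Θ : ℝ → ℝ → ℝ,
          SphFinsler.IsIntegralInS Θ (fun r s => U r s / (r ^ 2 - s ^ 2))
            (SphFinsler.region M) ∧
          ∀ r s : ℝ, (r, s) ∈ SphFinsler.region M →
            φ r s = Real.sqrt (r ^ 2 - s ^ 2) * Real.exp (Θ r s)) ∧
      -- the Finsler inequalities
      (∀ r s : ℝ, (r, s) ∈ SphFinsler.region M →
        0 < φ r s - s * SphFinsler.ps φ r s ∧
        0 < φ r s - s * SphFinsler.ps φ r s
          + (r ^ 2 - s ^ 2) * SphFinsler.ps (SphFinsler.ps φ) r s) := by 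
  obtain ⟨φ, hφ, hrep⟩ := SphFinsler.exists_isGivenBy (by omega) hM hF hsym
  obtain ⟨K, hK⟩ := hK
  obtain ⟨-, hc, hne, -⟩ := SphFinsler.radii_isOpen (by omega) hM
  have hp := hφ.isPositive hn hF
  have h := hφ.isSolution hn hp hF hD hK
  have hz := h.subsingleton_zeros hc hne
  obtain ⟨T, hT, hTs, hT'⟩ := h.exists_T hc hne
  obtain ⟨η, hη⟩ := h.exists_hasFormP hc hne hT hT'
  exact ⟨φ, hrep, hφ.smooth,
    ⟨_, T, _, _, η, h.smooth_g, hz, h.areTFunctions hT hTs hT', h.hasFormQ, hη⟩,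
    ⟨_, h.isU hp hz, hp.satisfiesCompatibility, hp.exists_integral⟩,
    fun r s hrs => ⟨hp.intercept_pos hrs, hp.lambda_pos hrs⟩⟩
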